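/- Let $\Bbbk$ be a commutative ring, $k\in\mathbb Z$, and let $F_1,\dots,F_n$ be $\Bbbk$-algebras, free of finite rank with bases $B_1,\dots,B_n$, with symmetric Frobenius traces $\mathrm{tr}_i\colon F_i\to\Bbbk$ (that is, $\mathrm{tr}_i(ab)=\mathrm{tr}_i(ba)$ and $a\mapsto \mathrm{tr}_i(a\,\cdot)$ is a bijection $F_i\to\mathrm{Hom}_\Bbbk(F_i,\Bbbk)$). Let $F=F_1\oplus\dots\oplus F_n$ with trace $\mathrm{tr}(f_1,\dots,f_n)=\sum_i\mathrm{tr}_i(f_i)$, basis $B=B_1\cup\dots\cup B_n$ and left dual basis $\{b^\vee\}$, $\mathrm{tr}(a^\vee b)=\delta_{a,b}$. Let $e_i$ be the identity of $F_i$. **The category $\mathcal Heis_{F,k}$** is the strict $\Bbbk$-linear monoidal category generated by objects $Q_+,Q_-$ and morphisms $x\colon Q_+\to Q_+$, $s\colon Q_+Q_+\to Q_+Q_+$, $c\colon 1\to Q_-Q_+$, $d\colon Q_+Q_-\to 1$, $\beta_f\colon Q_+\to Q_+$ $(f\in F)$, subject to: 1. $f\mapsto\beta_f$ is a (unital) algebra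 homomorphism $F\to\mathrm{End}(Q_+)$; $s$ satisfies the braid relation and $s^2=1$; $\beta_fx=x\beta_f$; $s(\beta_f\otimes 1)=(1\otimes\beta_f)s$; $(x\otimes1)s-s(1\otimes x)=\sum_{b\in B}\beta_{b^\vee}\otimes\beta_b$; 2. $(d\otimes1)(1\otimes c)=1_{Q_+}$, $(1\otimes d)(c\otimes1)=1_{Q_-}$; 3. with $t=(1\otimes1\otimes d)(1\otimes s\otimes1)(c\otimes1\otimes1)\colon Q_+Q_-\to Q_-Q_+$, the column with entries $t$ and $d(x^r\beta_{b^\vee}\otimes1)$, $0\le r<k$, $b\in B$ (if $k\ge0$), respectively the row with entries $t$ and $(1\otimes x^r\beta_{b^\vee})c$, $0\le r<-k$, $b\in B$ (if $k<0$), is invertible in the additive envelope. That is, one adjoins the entries of a two-sided inverse: $t'\colon Q_-Q_+\to Q_+Q_-$ and, for $k>0$, decorated left cups $u_{r,b}\colon 1\to Q_+Q_-$, respectively, for $k<0$, decorated left caps $v_{r,b}\colon Q_-Q_+\to1$. The cups and caps are extended linearly in $b$ to $u_{r,f}$, $v_{r,f}$, $f\in F$. For $f\in F$ put $\beta'_f=(1\otimes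 d)(1\otimes\beta_f\otimes1)(c\otimes1)\colon Q_-\to Q_-$. **The category $\mathcal Heis'_{F,k}$** is the strict $\Bbbk$-linear monoidal category generated by objects $Q_+,Q_-$ and morphisms $x_i$, $s_{i,j}$, $c_i$, $d_i$, $\beta_{(f,i)}$ ($f\in F_i$, $1\le i,j\le n$) with the same sources and targets as $x,s,c,d,\beta_f$. In $s_{i,j}$ the strand starting at the bottom left has color $i$ and the one starting at the bottom right has color $j$. The upward strand of color $i$ is $1_i:=\beta_{(e_i,i)}$, and the downward strand of color $i$ is $1'_i:=(1\otimes d_i)(1\otimes 1_i\otimes1)(c_i\otimes1)\colon Q_-\to Q_-$. The relations are: 0. (colors) $\sum_i1_i=1_{Q_+}$, $\sum_i1_i'=1_{Q_-}$, $1_i1_j=0$ and $1'_i1'_j=0$ for $i\ne j$, and each generating morphism is unchanged by composing it at its ends with the strands of the colors of these ends; 1. $f\mapsto\beta_{(f,i)}$ is $\Bbbk$-linear and multiplicative on $F_i$ (so it is an algebra homomorphism onto its image, with identity $1_i$); $(s_{j,l}\otimes1_i)(1_j\otimes s_{i,l})(s_{i,j}\otimes1_l)=(1_l\otimes s_{i,j})(s_{i,l}\otimes1_j)(1_i\otimes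 s_{j,l})$; $s_{j,i}s_{i,j}=1_i\otimes1_j$; $\beta_{(f,i)}x_i=x_i\beta_{(f,i)}$; $s_{i,j}(\beta_{(f,i)}\otimes1_j)=(1_j\otimes\beta_{(f,i)})s_{i,j}$; $(x_j\otimes1_i)s_{i,j}-s_{i,j}(1_i\otimes x_j)=\delta_{i,j}\sum_{b\in B_i}\beta_{(b^\vee,i)}\otimes\beta_{(b,i)}$; 2. $(d_i\otimes1_i)(1_i\otimes c_i)=1_i$, $(1'_i\otimes d_i)(c_i\otimes1'_i)=1'_i$; 3. with $t_{i,j}=(1\otimes1\otimes d_j)(1\otimes s_{j,i}\otimes1)(c_j\otimes1\otimes1)$: for $i\ne j$, $t_{i,j}$ is invertible as a morphism from $1_i\otimes1'_j$ to $1'_j\otimes1_i$, i.e. there is an adjoined $t'_{j,i}$ with $t'_{j,i}t_{i,j}=1_i\otimes1'_j$ and $t_{i,j}t'_{j,i}=1'_j\otimes1_i$; and for each $i$ the column with entries $t_{i,i}$ and $d_i(x_i^r\beta_{(b^\vee,i)}\otimes1)$, $0\le r<k$, $b\in B_i$ (if $k\ge0$), respectively the row with entries $t_{i,i}$ and $(1\otimes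 x_i^r\beta_{(b^\vee,i)})c_i$, $0\le r<-k$, $b\in B_i$ (if $k<0$), is invertible between the corresponding colored objects: one adjoins the entries $t'_{i,i}$ and $u^i_{r,b}$, respectively $v^i_{r,b}$, of a two-sided inverse, the identities of $Q_+Q_-$ and $Q_-Q_+$ being replaced by $1_i\otimes1'_i$ and $1'_i\otimes1_i$. In $t'_{i,j}$ the downward strand has color $i$ and the upward one color $j$. Again $u^i_{r,f}$, $v^i_{r,f}$ are defined for $f\in F_i$ by linear extension. **Theorem.** $\mathcal Heis_{F,k}$ and $\mathcal Heis'_{F,k}$ are isomorphic: there are strict $\Bbbk$-linear monoidal functors $\Phi\colon\mathcal Heis'_{F,k}\to\mathcal Heis_{F,k}$ and $\Psi\colon\mathcal Heis_{F,k}\to\mathcal Heis'_{F,k}$, the identity on objects, with $\Psi\Phi=\mathrm{id}$ and $\Phi\Psi=\mathrm{id}$, such that $$\Phi(s_{i,j})=s(\beta_{e_i}\otimes\beta_{e_j}),\quad \Phi(c_i)=(\beta'_{e_i}\otimes1)c,\quad \Phi(d_i)=d(\beta_{e_i}\otimes1),\quad \Phi(x_i)=x\beta_{e_i},\quad \Phi(\beta_{(f,i)})=\beta_f,$$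 $$\Phi(t'_{i,j})=(1\otimes\beta'_{e_i})t'(1\otimes\beta_{e_j}),\quad \Phi(u^i_{r,f})=(\beta_{e_i}\otimes\beta'_{e_i})u_{r,f},\quad \Phi(v^i_{r,f})=v_{r,f}(\beta'_{e_i}\otimes\beta_{e_i})\qquad(f\in F_i),$$ $\Phi(t_{i,j})$ is the morphism obtained from the formula for $t_{i,j}$ by replacing $c_j,s_{j,i},d_j$ with their images, and $$\Psi(s)=\sum_{i,j}s_{i,j},\quad \Psi(c)=\sum_ic_i,\quad \Psi(d)=\sum_id_i,\quad \Psi(x)=\sum_ix_i,\quad \Psi(\beta_{(f_1,\dots,f_n)})=\sum_i\beta_{(f_i,i)},$$ $$\Psi(t)=\sum_{i,j}t_{i,j},\quad \Psi(t')=\sum_{i,j}t'_{i,j},\quad \Psi(u_{r,(f_1,\dots,f_n)})=\sum_iu^i_{r,f_i},\quad \Psi(v_{r,(f_1,\dots,f_n)})=\sum_iv^i_{r,f_i}.$$ -/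

import Mathlib

open CategoryTheory MonoidalCategory

universe u v w z

/-! ### Strict `k`-linear monoidal categories given by generators and relations -/

/-- Formal expressions for morphisms between words in the generating objects `O`, built from the
generating morphisms `Gen X Y` by identities, vertical composition (`comp f g` is `f` followed by
`g`, i.e. `g` is drawn on top of `f`), horizontal juxtaposition and `k`-linear combinations. -/
inductive Term (k : Type u) {O : Type v} (Gen : List O → List O → Type w) :
    List O → List O → Type (max u v w)
  | gen {X Y : List O} (g : Gen X Y) : Term k Gen X Y
  | id (X : List O) : Term k Gen X X
  | comp {X Y Z : List O} (f : Term k Gen X Y) (g : Term k Gen Y Z) : Term k Gen X Z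
  | tens {X Y X' Y' : List O} (f : Term k Gen X Y) (g : Term k Gen X' Y') :
      Term k Gen (X ++ X') (Y ++ Y')
  | zero (X Y : List O) : Term k Gen X Y
  | add {X Y : List O} (f g : Term k Gen X Y) : Term k Gen X Y
  | smul {X Y : List O} (a : k) (f : Term k Gen X Y) : Term k Gen X Y

infixr:70 "⨟" => Term.comp
notation:75 f:76 "⊠" g:75 => (Term.tens f g : Term _ _ (_ ++ _) (_ ++ _))

namespace Term

variable {k : Type u} {O : Type v} {Gen : List O → List O → Type w}

/-- Transport along equalities of words. -/
def cast {X Y X' Y' : List O} (hX : X = X') (hY : Y = Y') (f : Term k Gen X Y) :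
    Term k Gen X' Y' :=
  hX ▸ hY ▸ f

/-- Formal finite sum. -/
noncomputable def sum {ι : Type z} [Fintype ι] {X Y : List O} (f : ι → Term k Gen X Y) :
    Term k Gen X Y :=
  ((Finset.univ : Finset ι).toList.map f).foldr Term.add (Term.zero X Y)

/-- Powers of an endomorphism. -/
def pow {X : List O} (f : Term k Gen X X) : ℕ → Term k Gen X X
  | 0 => Term.id X
  | r + 1 => pow f r⨟f

end Term

/-- The congruence on formal expressions generated by the defining relations `R` and the axioms
of a strict `k`-linear monoidal category. -/
inductive TermRel {k : Type u} [CommRing k] {O : Type v} {Gen : List O → List O → Type w}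
    (R : ∀ X Y : List O, Term k Gen X Y → Term k Gen X Y → Prop) :
    ∀ X Y : List O, Term k Gen X Y → Term k Gen X Y → Prop
  -- the defining relations
  | of {X Y} {f g : Term k Gen X Y} : R X Y f g → TermRel R X Y f g
  -- congruence
  | refl {X Y} (f : Term k Gen X Y) : TermRel R X Y f f
  | symm {X Y} {f g : Term k Gen X Y} : TermRel R X Y f g → TermRel R X Y g f
  | trans {X Y} {f g h : Term k Gen X Y} : TermRel R X Y f g → TermRel R X Y g h → TermRel R X Y f h
  | comp {X Y Z} {f f' : Term k Gen X Y} {g g' : Term k Gen Y Z} :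
      TermRel R X Y f f' → TermRel R Y Z g g' → TermRel R X Z (f⨟g) (f'⨟g')
  | tens {X Y X' Y'} {f f' : Term k Gen X Y} {g g' : Term k Gen X' Y'} :
      TermRel R X Y f f' → TermRel R X' Y' g g' → TermRel R (X ++ X') (Y ++ Y') (f⊠g) (f'⊠g')
  | add {X Y} {f f' g g' : Term k Gen X Y} :
      TermRel R X Y f f' → TermRel R X Y g g' → TermRel R X Y (f.add g) (f'.add g')
  | smul {X Y} (a : k) {f f' : Term k Gen X Y} :
      TermRel R X Y f f' → TermRel R X Y (f.smul a) (f'.smul a)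
  -- category
  | id_comp {X Y} (f : Term k Gen X Y) : TermRel R X Y (Term.id X⨟f) f
  | comp_id {X Y} (f : Term k Gen X Y) : TermRel R X Y (f⨟Term.id Y) f
  | assoc {X Y Z W} (f : Term k Gen X Y) (g : Term k Gen Y Z) (h : Term k Gen Z W) :
      TermRel R X W ((f⨟g)⨟h) (f⨟g⨟h)
  -- morphism spaces are `k`-modules
  | add_assoc {X Y} (f g h : Term k Gen X Y) :
      TermRel R X Y ((f.add g).add h) (f.add (g.add h))
  | add_comm {X Y} (f g : Term k Gen X Y) : TermRel R X Y (f.add g) (g.add f)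
  | zero_add {X Y} (f : Term k Gen X Y) : TermRel R X Y ((Term.zero X Y).add f) f
  | smul_add {X Y} (a : k) (f g : Term k Gen X Y) :
      TermRel R X Y ((f.add g).smul a) ((f.smul a).add (g.smul a))
  | add_smul {X Y} (a b : k) (f : Term k Gen X Y) :
      TermRel R X Y (f.smul (a + b)) ((f.smul a).add (f.smul b))
  | mul_smul {X Y} (a b : k) (f : Term k Gen X Y) :
      TermRel R X Y (f.smul (a * b)) ((f.smul b).smul a)
  | one_smul {X Y} (f : Term k Gen X Y) : TermRel R X Y (f.smul 1) f
  | zero_smul {X Y} (f : Term k Gen X Y) : TermRel R X Y (f.smul 0) (Term.zero X Y)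
  -- composition is bilinear
  | add_comp {X Y Z} (f f' : Term k Gen X Y) (g : Term k Gen Y Z) :
      TermRel R X Z (f.add f'⨟g) ((f⨟g).add (f'⨟g))
  | comp_add {X Y Z} (f : Term k Gen X Y) (g g' : Term k Gen Y Z) :
      TermRel R X Z (f⨟g.add g') ((f⨟g).add (f⨟g'))
  | smul_comp {X Y Z} (a : k) (f : Term k Gen X Y) (g : Term k Gen Y Z) :
      TermRel R X Z (f.smul a⨟g) ((f⨟g).smul a)
  | comp_smul {X Y Z} (a : k) (f : Term k Gen X Y) (g : Term k Gen Y Z) :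
      TermRel R X Z (f⨟g.smul a) ((f⨟g).smul a)
  -- tensor product is bilinear
  | add_tens {X Y X' Y'} (f f' : Term k Gen X Y) (g : Term k Gen X' Y') :
      TermRel R (X ++ X') (Y ++ Y') (f.add f'⊠g) ((f⊠g).add (f'⊠g))
  | tens_add {X Y X' Y'} (f : Term k Gen X Y) (g g' : Term k Gen X' Y') :
      TermRel R (X ++ X') (Y ++ Y') (f⊠g.add g') ((f⊠g).add (f⊠g'))
  | smul_tens {X Y X' Y'} (a : k) (f : Term k Gen X Y) (g : Term k Gen X' Y') :
      TermRel R (X ++ X') (Y ++ Y') (f.smul a⊠g) ((f⊠g).smul a)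
  | tens_smul {X Y X' Y'} (a : k) (f : Term k Gen X Y) (g : Term k Gen X' Y') :
      TermRel R (X ++ X') (Y ++ Y') (f⊠g.smul a) ((f⊠g).smul a)
  -- tensor product is a bifunctor
  | id_tens_id (X X' : List O) :
      TermRel R (X ++ X') (X ++ X') (Term.id X⊠Term.id X') (Term.id (X ++ X'))
  | interchange {X Y Z X' Y' Z'} (f : Term k Gen X Y) (g : Term k Gen Y Z)
      (f' : Term k Gen X' Y') (g' : Term k Gen Y' Z') :
      TermRel R (X ++ X') (Z ++ Z') ((f⨟g)⊠(f'⨟g')) ((f⊠f')⨟(g⊠g'))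
  -- tensor product is strictly associative and unital
  | tens_assoc {X Y X' Y' X'' Y''} (f : Term k Gen X Y) (g : Term k Gen X' Y')
      (h : Term k Gen X'' Y'') :
      TermRel R (X ++ X' ++ X'') (Y ++ Y' ++ Y'') ((f⊠g)⊠h)
        (Term.cast (List.append_assoc _ _ _).symm (List.append_assoc _ _ _).symm (f⊠g⊠h))
  | one_tens {X Y} (f : Term k Gen X Y) : TermRel R X Y (Term.id []⊠f) f
  | tens_one {X Y} (f : Term k Gen X Y) :
      TermRel R (X ++ []) (Y ++ []) (f⊠Term.id [])
        (Term.cast (List.append_nil _).symm (List.append_nil _).symm f)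

/-- The strict `k`-linear monoidal category with generating objects `O`, generating morphisms
`Gen` and defining relations `R`. Its objects are the words in `O`. -/
def Presented {k : Type u} [CommRing k] {O : Type v} {Gen : List O → List O → Type w}
    (_R : ∀ X Y : List O, Term k Gen X Y → Term k Gen X Y → Prop) : Type v :=
  List O

namespace Presented

variable {k : Type u} [CommRing k] {O : Type v} {Gen : List O → List O → Type w}
  (R : ∀ X Y : List O, Term k Gen X Y → Term k Gen X Y → Prop)

/-- Equality of morphisms. -/
@[reducible]
def homSetoid (X Y : List O) : Setoid (Term k Gen X Y) where
  r := TermRel R X Y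
  iseqv := ⟨TermRel.refl, TermRel.symm, TermRel.trans⟩

/-- Morphisms of the presented category. -/
def Mor (X Y : List O) : Type (max u v w) := Quotient (homSetoid R X Y)

variable {R}

/-- The object given by a word. -/
def ob (X : List O) : Presented R := X

/-- The class of a formal expression. -/
def cls {X Y : List O} (f : Term k Gen X Y) : Mor R X Y := Quotient.mk (homSetoid R X Y) f

theorem cls_sound {X Y : List O} {f g : Term k Gen X Y} (h : TermRel R X Y f g) :
    cls (R := R) f = cls g := Quotient.sound (s := homSetoid R X Y) h

instance : Category (Presented R) where
  Hom X Y := Mor R X Y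
  id X := cls (Term.id X)
  comp {X Y Z} f g := Quotient.map₂ (sa := homSetoid R X Y) (sb := homSetoid R Y Z)
    (sc := homSetoid R X Z) Term.comp (fun _ _ h _ _ h' => TermRel.comp h h') f g
  id_comp f := Quotient.inductionOn f fun _ => cls_sound (TermRel.id_comp _)
  comp_id f := Quotient.inductionOn f fun _ => cls_sound (TermRel.comp_id _)
  assoc f g h := Quotient.inductionOn₃ f g h fun _ _ _ => cls_sound (TermRel.assoc _ _ _)

/-- The morphism of the presented category given by a formal expression. -/
def mk {X Y : List O} (f : Term k Gen X Y) : (ob X : Presented R) ⟶ ob Y := cls f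

theorem mk_sound {X Y : List O} {f g : Term k Gen X Y} (h : TermRel R X Y f g) :
    mk (R := R) f = mk g := cls_sound h

theorem mk_surj {X Y : Presented R} (f : X ⟶ Y) : ∃ t : Term k Gen X Y, mk (R := R) t = f :=
  Quotient.exists_rep f

instance (X Y : Presented R) : Add (X ⟶ Y) :=
  ⟨fun f g => Quotient.map₂ (sa := homSetoid R X Y) (sb := homSetoid R X Y)
    (sc := homSetoid R X Y) Term.add (fun _ _ h _ _ h' => TermRel.add h h') f g⟩

instance (X Y : Presented R) : Zero (X ⟶ Y) := ⟨mk (Term.zero X Y)⟩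

instance (X Y : Presented R) : SMul k (X ⟶ Y) :=
  ⟨fun a f => Quotient.map (sa := homSetoid R X Y) (sb := homSetoid R X Y) (Term.smul a)
    (fun _ _ h => TermRel.smul a h) f⟩

instance (X Y : Presented R) : Neg (X ⟶ Y) := ⟨fun f => (-1 : k) • f⟩

theorem mk_id (X : List O) : mk (R := R) (Term.id X) = 𝟙 (ob X) := rfl
theorem mk_comp {X Y Z : List O} (f : Term k Gen X Y) (g : Term k Gen Y Z) :
    mk (R := R) (f⨟g) = mk f ≫ mk g := rfl
theorem mk_add {X Y : List O} (f g : Term k Gen X Y) :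
    mk (R := R) (f.add g) = mk f + mk g := rfl
theorem mk_zero (X Y : List O) : mk (R := R) (Term.zero X Y) = 0 := rfl
theorem mk_smul {X Y : List O} (a : k) (f : Term k Gen X Y) :
    mk (R := R) (f.smul a) = a • mk f := rfl

theorem hom_zero_add {X Y : Presented R} (f : X ⟶ Y) : 0 + f = f := by
  obtain ⟨f, rfl⟩ := mk_surj f; exact mk_sound (TermRel.zero_add _)
theorem hom_add_comm {X Y : Presented R} (f g : X ⟶ Y) : f + g = g + f := by
  obtain ⟨f, rfl⟩ := mk_surj f; obtain ⟨g, rfl⟩ := mk_surj g; exact mk_sound (TermRel.add_comm _ _)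
theorem hom_add_smul {X Y : Presented R} (a b : k) (f : X ⟶ Y) :
    (a + b) • f = a • f + b • f := by
  obtain ⟨f, rfl⟩ := mk_surj f; exact mk_sound (TermRel.add_smul _ _ _)
theorem hom_one_smul {X Y : Presented R} (f : X ⟶ Y) : (1 : k) • f = f := by
  obtain ⟨f, rfl⟩ := mk_surj f; exact mk_sound (TermRel.one_smul _)
theorem hom_zero_smul {X Y : Presented R} (f : X ⟶ Y) : (0 : k) • f = 0 := by
  obtain ⟨f, rfl⟩ := mk_surj f; exact mk_sound (TermRel.zero_smul _)

instance (X Y : Presented R) : AddCommGroup (X ⟶ Y) where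
  add_assoc f g h := by
    obtain ⟨f, rfl⟩ := mk_surj f; obtain ⟨g, rfl⟩ := mk_surj g; obtain ⟨h, rfl⟩ := mk_surj h
    exact mk_sound (TermRel.add_assoc _ _ _)
  zero_add := hom_zero_add
  add_zero f := by rw [hom_add_comm, hom_zero_add]
  add_comm := hom_add_comm
  neg_add_cancel f := by
    change (-1 : k) • f + f = 0
    have h : (-1 : k) • f + (1 : k) • f = 0 := by
      rw [← hom_add_smul, neg_add_cancel, hom_zero_smul]
    rwa [hom_one_smul] at h
  nsmul := nsmulRec
  zsmul := zsmulRec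

instance (X Y : Presented R) : Module k (X ⟶ Y) where
  one_smul := hom_one_smul
  mul_smul a b f := by obtain ⟨f, rfl⟩ := mk_surj f; exact mk_sound (TermRel.mul_smul _ _ _)
  smul_add a f g := by
    obtain ⟨f, rfl⟩ := mk_surj f; obtain ⟨g, rfl⟩ := mk_surj g
    exact mk_sound (TermRel.smul_add _ _ _)
  smul_zero a := by
    rw [← hom_zero_smul (0 : X ⟶ Y)]
    have h : ∀ f : X ⟶ Y, a • (0 : k) • f = (a * 0) • f := fun f => by
      obtain ⟨f, rfl⟩ := mk_surj f; exact (mk_sound (TermRel.mul_smul _ _ _)).symm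
    rw [h, mul_zero]
  add_smul := hom_add_smul
  zero_smul := hom_zero_smul

instance : Preadditive (Presented R) where
  add_comp X Y Z f f' g := by
    obtain ⟨f, rfl⟩ := mk_surj f; obtain ⟨f', rfl⟩ := mk_surj f'; obtain ⟨g, rfl⟩ := mk_surj g
    exact mk_sound (TermRel.add_comp _ _ _)
  comp_add X Y Z f g g' := by
    obtain ⟨f, rfl⟩ := mk_surj f; obtain ⟨g', rfl⟩ := mk_surj g'; obtain ⟨g, rfl⟩ := mk_surj g
    exact mk_sound (TermRel.comp_add _ _ _)

instance : Linear k (Presented R) where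
  smul_comp X Y Z a f g := by
    obtain ⟨f, rfl⟩ := mk_surj f; obtain ⟨g, rfl⟩ := mk_surj g
    exact mk_sound (TermRel.smul_comp _ _ _)
  comp_smul X Y Z f a g := by
    obtain ⟨f, rfl⟩ := mk_surj f; obtain ⟨g, rfl⟩ := mk_surj g
    exact mk_sound (TermRel.comp_smul _ _ _)

/-- Concatenation of words. -/
def tobj (X Y : Presented R) : Presented R := List.append X Y

/-- Horizontal juxtaposition of morphisms. -/
def thom {X Y X' Y' : Presented R} (f : X ⟶ Y) (g : X' ⟶ Y') : tobj X X' ⟶ tobj Y Y' :=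
  Quotient.map₂ (sa := homSetoid R X Y) (sb := homSetoid R X' Y')
    (sc := homSetoid R (List.append X X') (List.append Y Y'))
    Term.tens (fun _ _ h _ _ h' => TermRel.tens h h') f g

theorem tobj_assoc (X Y Z : Presented R) : tobj (tobj X Y) Z = tobj X (tobj Y Z) :=
  List.append_assoc X Y Z
theorem nil_tobj (X : Presented R) : tobj (ob []) X = X := List.nil_append X
theorem tobj_nil (X : Presented R) : tobj X (ob []) = X := List.append_nil X

/-- Tensor product is concatenation, and the associators and unitors are the identities
(`eqToIso` of the equality of words). -/
instance : MonoidalCategoryStruct (Presented R) where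
  tensorObj X Y := tobj X Y
  tensorUnit := ob []
  tensorHom f g := thom f g
  whiskerLeft X _ _ f := thom (𝟙 X) f
  whiskerRight f Y := thom f (𝟙 Y)
  associator X Y Z := eqToIso (tobj_assoc X Y Z)
  leftUnitor X := eqToIso (nil_tobj X)
  rightUnitor X := eqToIso (tobj_nil X)

theorem mk_tens {X Y X' Y' : List O} (f : Term k Gen X Y) (g : Term k Gen X' Y') :
    mk (R := R) (f⊠g) = mk f ⊗ₘ mk g := rfl

theorem mk_cast {X Y X' Y' : List O} (hX : X = X') (hY : Y = Y') (f : Term k Gen X Y) :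
    mk (R := R) (f.cast hX hY) =
      eqToHom (congrArg ob hX.symm) ≫ mk f ≫ eqToHom (congrArg ob hY) := by
  subst hX; subst hY; simp [Term.cast]

theorem thom_id_id (X Y : Presented R) : thom (𝟙 X) (𝟙 Y) = 𝟙 (tobj X Y) :=
  mk_sound (TermRel.id_tens_id _ _)

theorem thom_eqToHom_id {X X' : Presented R} (h : X = X') (Y : Presented R) :
    thom (eqToHom h) (𝟙 Y) = eqToHom (congrArg (fun Z => tobj Z Y) h) := by
  subst h; exact thom_id_id _ _

theorem thom_id_eqToHom {X X' : Presented R} (h : X = X') (Y : Presented R) :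
    thom (𝟙 Y) (eqToHom h) = eqToHom (congrArg (fun Z => tobj Y Z) h) := by
  subst h; exact thom_id_id _ _

theorem mk_comp_eqToHom {X Y X' Y' : List O} {hX : X' = X} {hY : Y' = Y}
    {t : Term k Gen X Y} {f : Term k Gen X' Y'} (h : TermRel R X Y t (f.cast hX hY))
    (p : (ob Y : Presented R) = ob Y') (q : (ob X : Presented R) = ob X') :
    mk t ≫ eqToHom p = eqToHom q ≫ mk f := by
  subst hX; subst hY
  have h' : mk (R := R) t = mk f := mk_sound h
  simp [h']

instance : MonoidalCategory (Presented R) := MonoidalCategory.ofTensorHom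
  (id_tensorHom_id := thom_id_id)
  (id_tensorHom := fun _ _ _ _ => rfl)
  (tensorHom_id := fun _ _ => rfl)
  (tensorHom_comp_tensorHom := fun f f' g g' => by
    obtain ⟨f, rfl⟩ := mk_surj f; obtain ⟨g, rfl⟩ := mk_surj g
    obtain ⟨f', rfl⟩ := mk_surj f'; obtain ⟨g', rfl⟩ := mk_surj g'
    exact (mk_sound (TermRel.interchange f g f' g')).symm)
  (associator_naturality := fun {X₁ X₂ X₃ Y₁ Y₂ Y₃} f g h => by
    obtain ⟨f, rfl⟩ := mk_surj f; obtain ⟨g, rfl⟩ := mk_surj g; obtain ⟨h, rfl⟩ := mk_surj h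
    exact mk_comp_eqToHom (TermRel.tens_assoc (R := R) f g h)
      (List.append_assoc Y₁ Y₂ Y₃) (List.append_assoc X₁ X₂ X₃))
  (leftUnitor_naturality := fun {X Y} f => by
    obtain ⟨f, rfl⟩ := mk_surj f
    exact mk_comp_eqToHom (hX := rfl) (hY := rfl) (TermRel.one_tens (R := R) f)
      (List.nil_append Y) (List.nil_append X))
  (rightUnitor_naturality := fun {X Y} f => by
    obtain ⟨f, rfl⟩ := mk_surj f
    exact mk_comp_eqToHom (TermRel.tens_one (R := R) f)
      (List.append_nil Y) (List.append_nil X))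
  (pentagon := fun W X Y Z => by
    have h₁ := thom_eqToHom_id (tobj_assoc W X Y) Z
    have h₂ := thom_id_eqToHom (tobj_assoc X Y Z) W
    refine (congrArg₂ (fun a b => a ≫ eqToHom (tobj_assoc W (tobj X Y) Z) ≫ b) h₁ h₂).trans ?_
    exact ((congrArg (fun a => _ ≫ a) (eqToHom_trans _ _)).trans (eqToHom_trans _ _)).trans
      (eqToHom_trans (tobj_assoc (tobj W X) Y Z) (tobj_assoc W X (tobj Y Z))).symm)
  (triangle := fun X Y => by
    have h₁ := thom_eqToHom_id (tobj_nil X) Y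
    have h₂ := thom_id_eqToHom (nil_tobj Y) X
    refine (congrArg (fun b => eqToHom (tobj_assoc X (ob []) Y) ≫ b) h₂).trans ?_
    exact (eqToHom_trans _ _).trans h₁.symm)

theorem thom_add {X Y X' Y' : Presented R} (f : X ⟶ Y) (g g' : X' ⟶ Y') :
    thom f (g + g') = thom f g + thom f g' := by
  obtain ⟨f, rfl⟩ := mk_surj f; obtain ⟨g, rfl⟩ := mk_surj g; obtain ⟨g', rfl⟩ := mk_surj g'
  exact mk_sound (TermRel.tens_add _ _ _)
theorem add_thom {X Y X' Y' : Presented R} (f f' : X ⟶ Y) (g : X' ⟶ Y') :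
    thom (f + f') g = thom f g + thom f' g := by
  obtain ⟨f, rfl⟩ := mk_surj f; obtain ⟨f', rfl⟩ := mk_surj f'; obtain ⟨g, rfl⟩ := mk_surj g
  exact mk_sound (TermRel.add_tens _ _ _)
theorem thom_smul {X Y X' Y' : Presented R} (a : k) (f : X ⟶ Y) (g : X' ⟶ Y') :
    thom f (a • g) = a • thom f g := by
  obtain ⟨f, rfl⟩ := mk_surj f; obtain ⟨g, rfl⟩ := mk_surj g
  exact mk_sound (TermRel.tens_smul _ _ _)
theorem smul_thom {X Y X' Y' : Presented R} (a : k) (f : X ⟶ Y) (g : X' ⟶ Y') :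
    thom (a • f) g = a • thom f g := by
  obtain ⟨f, rfl⟩ := mk_surj f; obtain ⟨g, rfl⟩ := mk_surj g
  exact mk_sound (TermRel.smul_tens _ _ _)

instance : MonoidalPreadditive (Presented R) where
  whiskerLeft_zero {X Y Z} := by
    have h := thom_smul (0 : k) (𝟙 X) (0 : Y ⟶ Z)
    rwa [hom_zero_smul, hom_zero_smul] at h
  zero_whiskerRight {X Y Z} := by
    have h := smul_thom (0 : k) (0 : Y ⟶ Z) (𝟙 X)
    rwa [hom_zero_smul, hom_zero_smul] at h
  whiskerLeft_add _ _ := thom_add _ _ _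
  add_whiskerRight _ _ := add_thom _ _ _

instance : MonoidalLinear k (Presented R) where
  whiskerLeft_smul _ _ _ _ _ := thom_smul _ _ _
  smul_whiskerRight _ _ _ _ _ := smul_thom _ _ _

end Presented

/-! ### Functors -/

/-- The functor `Φ` sends the morphism `f : X ⟶ Y` to `g : X' ⟶ Y'`; in particular it sends
`X` to `X'` and `Y` to `Y'`. -/
def SendsTo {C : Type*} [Category* C] {D : Type*} [Category* D] (Φ : C ⥤ D)
    {X Y : C} (f : X ⟶ Y) {X' Y' : D} (g : X' ⟶ Y') : Prop :=
  ∃ (hX : Φ.obj X = X') (hY : Φ.obj Y = Y'), Φ.map f = eqToHom hX ≫ g ≫ eqToHom hY.symm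

/-- `Φ` preserves unit object and tensor products on the nose. -/
structure IsStrictMonoidal {C : Type*} [Category* C] [MonoidalCategory C]
    {D : Type*} [Category* D] [MonoidalCategory D] (Φ : C ⥤ D) : Prop where
  obj_unit : Φ.obj (𝟙_ C) = 𝟙_ D
  obj_tensor (X Y : C) : Φ.obj (X ⊗ Y) = Φ.obj X ⊗ Φ.obj Y
  map_tensor {X Y X' Y' : C} (f : X ⟶ Y) (g : X' ⟶ Y') :
    SendsTo Φ (f ⊗ₘ g) (Φ.map f ⊗ₘ Φ.map g)

/-! ### Symmetric Frobenius algebras -/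

/-- A symmetric trace making `A` a Frobenius algebra: `a ↦ tr (a * ·)` identifies `A` with its
`k`-dual. -/
structure FrobeniusTrace (k : Type u) (A : Type v) [CommRing k] [Ring A] [Algebra k A] where
  tr : A →ₗ[k] k
  symm : ∀ a b : A, tr (a * b) = tr (b * a)
  perfect : Function.Bijective
    (fun a : A => (tr ∘ₗ LinearMap.mulLeft k a : Module.Dual k A))

namespace FrobeniusTrace

variable {k : Type u} [CommRing k]

/-- The left dual basis: `tr (dual a * b) = δ_{a,b}`. -/
noncomputable def dual {A : Type v} [Ring A] [Algebra k A] (φ : FrobeniusTrace k A)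
    {ι : Type w} (B : Module.Basis ι k A) (a : ι) : A :=
  (Equiv.ofBijective _ φ.perfect).symm (B.coord a)

theorem tr_dual_mul {A : Type v} [Ring A] [Algebra k A] (φ : FrobeniusTrace k A)
    {ι : Type w} [DecidableEq ι] (B : Module.Basis ι k A) (a b : ι) :
    φ.tr (φ.dual B a * B b) = if a = b then 1 else 0 := by
  have h := LinearMap.congr_fun
    ((Equiv.ofBijective _ φ.perfect).apply_symm_apply (B.coord a)) (B b)
  rw [Module.Basis.coord_apply, Module.Basis.repr_self, Finsupp.single_apply] at h
  simp only [eq_comm (a := a)]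
  exact h

/-- The trace `(f₁, …, fₙ) ↦ ∑ i, trᵢ fᵢ` on a finite direct sum (product) of algebras. -/
def pi {n : ℕ} {A : Fin n → Type v} [∀ i, Ring (A i)] [∀ i, Algebra k (A i)]
    (φ : ∀ i, FrobeniusTrace k (A i)) : FrobeniusTrace k (∀ i, A i) where
  tr := ∑ i, (φ i).tr ∘ₗ LinearMap.proj i
  symm a b := by simp [(φ _).symm]
  perfect := by
    have key : ∀ (a : ∀ i, A i) (i : Fin n) (c : A i),
        (∑ j, (φ j).tr ∘ₗ LinearMap.proj j) (a * Pi.single i c) = (φ i).tr (a i * c) := by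
      intro a i c
      rw [LinearMap.sum_apply, Finset.sum_eq_single i]
      · simp
      · intro j _ hj; simp [Pi.single_eq_of_ne hj]
      · simp
    constructor
    · intro a a' h
      funext i
      apply (φ i).perfect.1
      ext c
      have := LinearMap.congr_fun h (Pi.single i c)
      simp only [LinearMap.comp_apply, LinearMap.mulLeft_apply] at this ⊢
      rw [← key, ← key]
      exact this
    · intro g
      choose a ha using fun i => (φ i).perfect.2 (g ∘ₗ LinearMap.single k A i)
      refine ⟨a, LinearMap.pi_ext fun i c => ?_⟩
      have := LinearMap.congr_fun (ha i) c
      simp only [LinearMap.comp_apply, LinearMap.mulLeft_apply] at this ⊢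
      rw [key]
      exact this

end FrobeniusTrace

/-! ### The Frobenius Heisenberg category -/

/-- The generating objects `Q₊` and `Q₋`. -/
inductive Sgn
  | up
  | down

open Sgn

namespace Heis

/-- Generating morphisms, for a Frobenius algebra `F` with a basis indexed by `ι` and an
integer `l`. The last three families are the entries of the inverse that the inversion
relation adjoins. -/
inductive Gen (F : Type v) (ι : Type w) (l : ℤ) : List Sgn → List Sgn → Type (max v w)
  | x : Gen F ι l [up] [up]
  | s : Gen F ι l [up, up] [up, up]
  | c : Gen F ι l [] [down, up]
  | d : Gen F ι l [up, down] []
  | tok (f : F) : Gen F ι l [up] [up]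
  | tl : Gen F ι l [down, up] [up, down]
  | cup (r : Fin l.toNat) (b : ι) : Gen F ι l [] [up, down]
  | cap (r : Fin (-l).toNat) (b : ι) : Gen F ι l [down, up] []

variable {k : Type u} [CommRing k] {F : Type v} [Ring F] [Algebra k F]
  {ι : Type w} [Fintype ι] {l : ℤ}

/-- Dot. -/
def x : Term k (Gen F ι l) [up] [up] := .gen .x
/-- Upward crossing. -/
def s : Term k (Gen F ι l) [up, up] [up, up] := .gen .s
/-- Right cup. -/
def c : Term k (Gen F ι l) [] [down, up] := .gen .c
/-- Right cap. -/
def d : Term k (Gen F ι l) [up, down] [] := .gen .d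
/-- Token. -/
def tok (f : F) : Term k (Gen F ι l) [up] [up] := .gen (.tok f)
/-- Left crossing. -/
def tl : Term k (Gen F ι l) [down, up] [up, down] := .gen .tl
/-- Decorated left cup labelled `(r, b)`. -/
def cup (r : Fin l.toNat) (b : ι) : Term k (Gen F ι l) [] [up, down] := .gen (.cup r b)
/-- Decorated left cap labelled `(r, b)`. -/
def cap (r : Fin (-l).toNat) (b : ι) : Term k (Gen F ι l) [down, up] [] := .gen (.cap r b)

/-- Undecorated upward strand. -/
def idUp : Term k (Gen F ι l) [up] [up] := .id [up]
/-- Undecorated downward strand. -/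
def idDown : Term k (Gen F ι l) [down] [down] := .id [down]

/-- Right crossing `Q₊ Q₋ ⟶ Q₋ Q₊`. -/
def t : Term k (Gen F ι l) [up, down] [down, up] :=
  (c⊠idUp⊠idDown)⨟(idDown⊠s⊠idDown)⨟(idDown⊠idUp⊠d)

/-- Token on a downward strand. -/
def tokDown (f : F) : Term k (Gen F ι l) [down] [down] :=
  (c⊠idDown)⨟(idDown⊠tok f⊠idDown)⨟(idDown⊠d)

/-- Right cap with token `f` and `r` dots on its left (upward) leg. -/
def rcap (r : ℕ) (f : F) : Term k (Gen F ι l) [up, down] [] :=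
  ((tok f⨟x.pow r)⊠idDown)⨟d

/-- Right cup with token `f` and `r` dots on its right (upward) leg. -/
def rcup (r : ℕ) (f : F) : Term k (Gen F ι l) [] [down, up] :=
  c⨟(idDown⊠(tok f⨟x.pow r))

/-- Decorated left cup, extended linearly in the second label. -/
noncomputable def cupLin (B : Module.Basis ι k F) (r : Fin l.toNat) (f : F) :
    Term k (Gen F ι l) [] [up, down] :=
  Term.sum fun b => (cup r b).smul (B.repr f b)

/-- Decorated left cap, extended linearly in the second label. -/
noncomputable def capLin (B : Module.Basis ι k F) (r : Fin (-l).toNat) (f : F) :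
    Term k (Gen F ι l) [down, up] [] :=
  Term.sum fun b => (cap r b).smul (B.repr f b)

/-- The defining relations. In the inversion relation at most one of the ranges of `r` is
nonempty; the relations there say that the column (if `0 ≤ l`) with entries `t` and
`rcap r b^∨`, respectively the row (if `l < 0`) with entries `t` and `rcup r b^∨`, is inverse to
the row with entries `tl` and `cup r b`, respectively the column with entries `tl` and
`cap r b`. -/
inductive R (φ : FrobeniusTrace k F) (B : Module.Basis ι k F) (l : ℤ) :
    ∀ X Y : List Sgn, Term k (Gen F ι l) X Y → Term k (Gen F ι l) X Y → Prop
  -- affine wreath product algebra relations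
  | tok_one : R φ B l _ _ (tok 1) idUp
  | tok_mul (f g : F) : R φ B l _ _ (tok (f * g)) (tok g⨟tok f)
  | tok_add (f g : F) : R φ B l _ _ (tok (f + g)) ((tok f).add (tok g))
  | tok_smul (a : k) (f : F) : R φ B l _ _ (tok (a • f)) ((tok f).smul a)
  | braid : R φ B l [up, up, up] [up, up, up]
      ((s⊠idUp)⨟(idUp⊠s)⨟(s⊠idUp)) ((idUp⊠s)⨟(s⊠idUp)⨟(idUp⊠s))
  | s_s : R φ B l _ _ (s⨟s) (idUp⊠idUp)
  | x_tok (f : F) : R φ B l _ _ (x⨟tok f) (tok f⨟x)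
  | tok_s (f : F) : R φ B l _ _ ((tok f⊠idUp)⨟s) (s⨟(idUp⊠tok f))
  | x_s : R φ B l _ _ (s⨟(x⊠idUp))
      (((idUp⊠x)⨟s).add (Term.sum fun b => tok (φ.dual B b)⊠tok (B b)))
  -- right adjunction relations
  | zigzag_up : R φ B l _ _ ((idUp⊠c)⨟(d⊠idUp)) idUp
  | zigzag_down : R φ B l _ _ ((c⊠idDown)⨟(idDown⊠d)) idDown
  -- inversion relation
  | up_down : R φ B l [up, down] [up, down] (idUp⊠idDown)
      ((t⨟tl).add (Term.sum fun r : Fin l.toNat => Term.sum fun b =>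
        rcap r (φ.dual B b)⨟cup r b))
  | down_up : R φ B l [down, up] [down, up] (idDown⊠idUp)
      ((tl⨟t).add (Term.sum fun r : Fin (-l).toNat => Term.sum fun b =>
        cap r b⨟rcup r (φ.dual B b)))
  | cup_t (r : Fin l.toNat) (b : ι) : R φ B l _ _ (cup r b⨟t) (.zero _ _)
  | tl_rcap (r : Fin l.toNat) (b : ι) : R φ B l _ _ (tl⨟rcap r (φ.dual B b)) (.zero _ _)
  | cup_rcap (r : Fin l.toNat) (b : ι) :
      R φ B l _ _ (cup r b⨟rcap r (φ.dual B b)) (.id [])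
  | cup_rcap_ne (r r' : Fin l.toNat) (b b' : ι) (h : (r, b) ≠ (r', b')) :
      R φ B l _ _ (cup r b⨟rcap r' (φ.dual B b')) (.zero _ _)
  | t_cap (r : Fin (-l).toNat) (b : ι) : R φ B l _ _ (t⨟cap r b) (.zero _ _)
  | rcup_tl (r : Fin (-l).toNat) (b : ι) : R φ B l _ _ (rcup r (φ.dual B b)⨟tl) (.zero _ _)
  | rcup_cap (r : Fin (-l).toNat) (b : ι) :
      R φ B l _ _ (rcup r (φ.dual B b)⨟cap r b) (.id [])
  | rcup_cap_ne (r r' : Fin (-l).toNat) (b b' : ι) (h : (r, b) ≠ (r', b')) :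
      R φ B l _ _ (rcup r (φ.dual B b)⨟cap r' b') (.zero _ _)

end Heis

/-- The Frobenius Heisenberg category of `(F, tr)` with integer parameter `l`. -/
abbrev Heis {k : Type u} [CommRing k] {F : Type v} [Ring F] [Algebra k F]
    {ι : Type w} [Fintype ι] (φ : FrobeniusTrace k F) (B : Module.Basis ι k F) (l : ℤ) : Type :=
  Presented (Heis.R φ B l)

/-! ### The colored presentation -/

namespace ColHeis

/-- Generating morphisms, for Frobenius algebras `F i` with bases indexed by `ι i`. The last
three families are the inverses, resp. entries of the inverses, that the inversion relations
adjoin. -/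
inductive Gen {n : ℕ} (F : Fin n → Type v) (ι : Fin n → Type w) (l : ℤ) :
    List Sgn → List Sgn → Type (max v w)
  | x (i : Fin n) : Gen F ι l [up] [up]
  | s (i j : Fin n) : Gen F ι l [up, up] [up, up]
  | c (i : Fin n) : Gen F ι l [] [down, up]
  | d (i : Fin n) : Gen F ι l [up, down] []
  | tok (i : Fin n) (f : F i) : Gen F ι l [up] [up]
  | tl (i j : Fin n) : Gen F ι l [down, up] [up, down]
  | cup (i : Fin n) (r : Fin l.toNat) (b : ι i) : Gen F ι l [] [up, down]
  | cap (i : Fin n) (r : Fin (-l).toNat) (b : ι i) : Gen F ι l [down, up] []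

variable {k : Type u} [CommRing k] {n : ℕ} {F : Fin n → Type v} [∀ i, Ring (F i)]
  [∀ i, Algebra k (F i)] {ι : Fin n → Type w} [∀ i, Fintype (ι i)] {l : ℤ}

/-- Dot of color `i`. -/
def x (i : Fin n) : Term k (Gen F ι l) [up] [up] := .gen (.x i)
/-- Upward crossing; the strand starting at the bottom left (right) has color `i` (`j`). -/
def s (i j : Fin n) : Term k (Gen F ι l) [up, up] [up, up] := .gen (.s i j)
/-- Right cup of color `i`. -/
def c (i : Fin n) : Term k (Gen F ι l) [] [down, up] := .gen (.c i)
/-- Right cap of color `i`. -/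
def d (i : Fin n) : Term k (Gen F ι l) [up, down] [] := .gen (.d i)
/-- Token on a strand of color `i`. -/
def tok (i : Fin n) (f : F i) : Term k (Gen F ι l) [up] [up] := .gen (.tok i f)
/-- Left crossing of a downward strand of color `i` and an upward strand of color `j`. -/
def tl (i j : Fin n) : Term k (Gen F ι l) [down, up] [up, down] := .gen (.tl i j)
/-- Decorated left cup of color `i` labelled `(r, b)`. -/
def cup (i : Fin n) (r : Fin l.toNat) (b : ι i) : Term k (Gen F ι l) [] [up, down] :=
  .gen (.cup i r b)
/-- Decorated left cap of color `i` labelled `(r, b)`. -/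
def cap (i : Fin n) (r : Fin (-l).toNat) (b : ι i) : Term k (Gen F ι l) [down, up] [] :=
  .gen (.cap i r b)

/-- Uncolored upward strand. -/
def idUp : Term k (Gen F ι l) [up] [up] := .id [up]
/-- Uncolored downward strand. -/
def idDown : Term k (Gen F ι l) [down] [down] := .id [down]

/-- Right crossing of an upward strand of color `i` and a downward strand of color `j`. -/
def t (i j : Fin n) : Term k (Gen F ι l) [up, down] [down, up] :=
  (c j⊠idUp⊠idDown)⨟(idDown⊠s j i⊠idDown)⨟(idDown⊠idUp⊠d j)

/-- Token on a downward strand of color `i`. -/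
def tokDown (i : Fin n) (f : F i) : Term k (Gen F ι l) [down] [down] :=
  (c i⊠idDown)⨟(idDown⊠tok i f⊠idDown)⨟(idDown⊠d i)

/-- Upward strand of color `i`: the strand with the identity `eᵢ` of `F i` as token. -/
def E (i : Fin n) : Term k (Gen F ι l) [up] [up] := tok i 1
/-- Downward strand of color `i`. -/
def D (i : Fin n) : Term k (Gen F ι l) [down] [down] := tokDown i 1

/-- Right cap of color `i` with token `f` and `r` dots on its left (upward) leg. -/
def rcap (i : Fin n) (r : ℕ) (f : F i) : Term k (Gen F ι l) [up, down] [] :=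
  ((tok i f⨟(x i).pow r)⊠idDown)⨟d i

/-- Right cup of color `i` with token `f` and `r` dots on its right (upward) leg. -/
def rcup (i : Fin n) (r : ℕ) (f : F i) : Term k (Gen F ι l) [] [down, up] :=
  c i⨟(idDown⊠(tok i f⨟(x i).pow r))

/-- Decorated left cup, extended linearly in the second label. -/
noncomputable def cupLin (B : ∀ i, Module.Basis (ι i) k (F i)) (i : Fin n) (r : Fin l.toNat)
    (f : F i) : Term k (Gen F ι l) [] [up, down] :=
  Term.sum fun b => (cup i r b).smul ((B i).repr f b)

/-- Decorated left cap, extended linearly in the second label. -/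
noncomputable def capLin (B : ∀ i, Module.Basis (ι i) k (F i)) (i : Fin n)
    (r : Fin (-l).toNat) (f : F i) : Term k (Gen F ι l) [down, up] [] :=
  Term.sum fun b => (cap i r b).smul ((B i).repr f b)

/-- The defining relations. -/
inductive R (φ : ∀ i, FrobeniusTrace k (F i)) (B : ∀ i, Module.Basis (ι i) k (F i)) (l : ℤ) :
    ∀ X Y : List Sgn, Term k (Gen F ι l) X Y → Term k (Gen F ι l) X Y → Prop
  -- conventions for colors: an uncolored strand is the sum of the strands of all colors,
  -- strands of different colors compose to zero, and every end of a generating morphism has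
  -- the color with which it is drawn
  | sum_E : R φ B l _ _ (Term.sum fun i => E i) idUp
  | sum_D : R φ B l _ _ (Term.sum fun i => D i) idDown
  | E_E (i j : Fin n) (h : i ≠ j) : R φ B l _ _ (E i⨟E j) (.zero _ _)
  | D_D (i j : Fin n) (h : i ≠ j) : R φ B l _ _ (D i⨟D j) (.zero _ _)
  | color_x (i : Fin n) : R φ B l _ _ (E i⨟x i⨟E i) (x i)
  | color_s (i j : Fin n) : R φ B l _ _ ((E i⊠E j)⨟s i j⨟(E j⊠E i)) (s i j)
  | color_c (i : Fin n) : R φ B l _ _ (c i⨟(D i⊠E i)) (c i)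
  | color_d (i : Fin n) : R φ B l _ _ ((E i⊠D i)⨟d i) (d i)
  | color_tl (i j : Fin n) : R φ B l _ _ ((D i⊠E j)⨟tl i j⨟(E j⊠D i)) (tl i j)
  | color_cup (i : Fin n) (r : Fin l.toNat) (b : ι i) :
      R φ B l _ _ (cup i r b⨟(E i⊠D i)) (cup i r b)
  | color_cap (i : Fin n) (r : Fin (-l).toNat) (b : ι i) :
      R φ B l _ _ ((D i⊠E i)⨟cap i r b) (cap i r b)
  -- colored affine wreath product algebra relations
  | tok_mul (i : Fin n) (f g : F i) : R φ B l _ _ (tok i (f * g)) (tok i g⨟tok i f)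
  | tok_add (i : Fin n) (f g : F i) : R φ B l _ _ (tok i (f + g)) ((tok i f).add (tok i g))
  | tok_smul (i : Fin n) (a : k) (f : F i) : R φ B l _ _ (tok i (a • f)) ((tok i f).smul a)
  | braid (i j m : Fin n) : R φ B l [up, up, up] [up, up, up]
      ((s i j⊠E m)⨟(E j⊠s i m)⨟(s j m⊠E i)) ((E i⊠s j m)⨟(s i m⊠E j)⨟(E m⊠s i j))
  | s_s (i j : Fin n) : R φ B l _ _ (s i j⨟s j i) (E i⊠E j)
  | x_tok (i : Fin n) (f : F i) : R φ B l _ _ (x i⨟tok i f) (tok i f⨟x i)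
  | tok_s (i j : Fin n) (f : F i) :
      R φ B l _ _ ((tok i f⊠E j)⨟s i j) (s i j⨟(E j⊠tok i f))
  | x_s (i : Fin n) : R φ B l _ _ (s i i⨟(x i⊠E i))
      (((E i⊠x i)⨟s i i).add
        (Term.sum fun b => tok i ((φ i).dual (B i) b)⊠tok i (B i b)))
  | x_s_ne (i j : Fin n) (h : i ≠ j) : R φ B l _ _ (s i j⨟(x j⊠E i)) ((E i⊠x j)⨟s i j)
  -- right adjunction relations
  | zigzag_up (i : Fin n) : R φ B l _ _ ((E i⊠c i)⨟(d i⊠E i)) (E i)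
  | zigzag_down (i : Fin n) : R φ B l _ _ ((c i⊠D i)⨟(D i⊠d i)) (D i)
  -- inversion relations for two different colors: `t i j` is invertible, with inverse `tl j i`
  | up_down_ne (i j : Fin n) (h : i ≠ j) :
      R φ B l [up, down] [up, down] (E i⊠D j) (t i j⨟tl j i)
  | down_up_ne (i j : Fin n) (h : i ≠ j) :
      R φ B l [down, up] [down, up] (D i⊠E j) (tl i j⨟t j i)
  -- inversion relations for one color
  | up_down (i : Fin n) : R φ B l [up, down] [up, down] (E i⊠D i)
      ((t i i⨟tl i i).add (Term.sum fun r : Fin l.toNat => Term.sum fun b =>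
        rcap i r ((φ i).dual (B i) b)⨟cup i r b))
  | down_up (i : Fin n) : R φ B l [down, up] [down, up] (D i⊠E i)
      ((tl i i⨟t i i).add (Term.sum fun r : Fin (-l).toNat => Term.sum fun b =>
        cap i r b⨟rcup i r ((φ i).dual (B i) b)))
  | cup_t (i : Fin n) (r : Fin l.toNat) (b : ι i) :
      R φ B l _ _ (cup i r b⨟t i i) (.zero _ _)
  | tl_rcap (i : Fin n) (r : Fin l.toNat) (b : ι i) :
      R φ B l _ _ (tl i i⨟rcap i r ((φ i).dual (B i) b)) (.zero _ _)
  | cup_rcap (i : Fin n) (r : Fin l.toNat) (b : ι i) :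
      R φ B l _ _ (cup i r b⨟rcap i r ((φ i).dual (B i) b)) (.id [])
  | cup_rcap_ne (i : Fin n) (r r' : Fin l.toNat) (b b' : ι i) (h : (r, b) ≠ (r', b')) :
      R φ B l _ _ (cup i r b⨟rcap i r' ((φ i).dual (B i) b')) (.zero _ _)
  | t_cap (i : Fin n) (r : Fin (-l).toNat) (b : ι i) :
      R φ B l _ _ (t i i⨟cap i r b) (.zero _ _)
  | rcup_tl (i : Fin n) (r : Fin (-l).toNat) (b : ι i) :
      R φ B l _ _ (rcup i r ((φ i).dual (B i) b)⨟tl i i) (.zero _ _)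
  | rcup_cap (i : Fin n) (r : Fin (-l).toNat) (b : ι i) :
      R φ B l _ _ (rcup i r ((φ i).dual (B i) b)⨟cap i r b) (.id [])
  | rcup_cap_ne (i : Fin n) (r r' : Fin (-l).toNat) (b b' : ι i) (h : (r, b) ≠ (r', b')) :
      R φ B l _ _ (rcup i r ((φ i).dual (B i) b)⨟cap i r' b') (.zero _ _)

end ColHeis

/-- The category given by the colored presentation, with strands of color `i` carrying tokens
from `F i`. -/
abbrev ColHeis {k : Type u} [CommRing k] {n : ℕ} {F : Fin n → Type v} [∀ i, Ring (F i)]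
    [∀ i, Algebra k (F i)] {ι : Fin n → Type w} [∀ i, Fintype (ι i)]
    (φ : ∀ i, FrobeniusTrace k (F i)) (B : ∀ i, Module.Basis (ι i) k (F i)) (l : ℤ) : Type :=
  Presented (ColHeis.R φ B l)

/-! ### Colored morphisms in the Frobenius Heisenberg category of a direct sum -/

namespace Heis

variable {k : Type u} [CommRing k] {n : ℕ} {F : Fin n → Type v} [∀ i, Ring (F i)]
  [∀ i, Algebra k (F i)] {ι : Type w} [Fintype ι] {l : ℤ}

/-- The central idempotent `eᵢ` of `F = F₁ ⊕ ⋯ ⊕ Fₙ`. -/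
def e (i : Fin n) : ∀ j, F j := Pi.single i 1

/-- Dot of color `i`. -/
def colX (i : Fin n) : Term k (Gen (∀ j, F j) ι l) [up] [up] := tok (e i)⨟x
/-- Upward crossing of colors `i`, `j`. -/
def colS (i j : Fin n) : Term k (Gen (∀ j, F j) ι l) [up, up] [up, up] :=
  (tok (e i)⊠tok (e j))⨟s
/-- Right cup of color `i`. -/
def colC (i : Fin n) : Term k (Gen (∀ j, F j) ι l) [] [down, up] := c⨟(tokDown (e i)⊠idUp)
/-- Right cap of color `i`. -/
def colD (i : Fin n) : Term k (Gen (∀ j, F j) ι l) [up, down] [] := (tok (e i)⊠idDown)⨟d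
/-- Right crossing of colors `i`, `j`. -/
def colT (i j : Fin n) : Term k (Gen (∀ j, F j) ι l) [up, down] [down, up] :=
  (colC j⊠idUp⊠idDown)⨟(idDown⊠colS j i⊠idDown)⨟(idDown⊠idUp⊠colD j)
/-- Left crossing of colors `i`, `j`. -/
def colTl (i j : Fin n) : Term k (Gen (∀ j, F j) ι l) [down, up] [up, down] :=
  (idDown⊠tok (e j))⨟tl⨟(idUp⊠tokDown (e i))
/-- Decorated left cup of color `i`. -/
noncomputable def colCup (B : Module.Basis ι k (∀ j, F j)) (i : Fin n) (r : Fin l.toNat)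
    (f : F i) : Term k (Gen (∀ j, F j) ι l) [] [up, down] :=
  cupLin B r (Pi.single i f)⨟(tok (e i)⊠tokDown (e i))
/-- Decorated left cap of color `i`. -/
noncomputable def colCap (B : Module.Basis ι k (∀ j, F j)) (i : Fin n) (r : Fin (-l).toNat)
    (f : F i) : Term k (Gen (∀ j, F j) ι l) [down, up] [] :=
  (tokDown (e i)⊠tok (e i))⨟capLin B r (Pi.single i f)

end Heis

/-! The elements `e i` are orthogonal central idempotents of the direct sum, with sum 1. Used as
tokens on upward strands and, after rotation by the right cup and cap, on downward strands, they
split every strand into strands of the `n` colors. A colored generator should be the plain generator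
cut down by these idempotents, and a plain generator the sum of its colored pieces. Both functors
are substitutions in formal expressions (`Term.lift`). What needs proof is that the substituted
generators satisfy the defining relations (`Heis.cls_lift_ofColGen` and `ColHeis.cls_lift_ofGen`)
and that the substitutions undo each other on generators.

For the functor to the plain category, the point is that tokens slide through every diagram. Past
`x` and `s` this is a relation, combined with `s² = 1` for the second strand; past `c` and `d` it
follows from the zigzag relations; hence it holds past `t`. The adjoined morphisms `tl`, `cup`,
`cap` have no formula and are known only as entries of an inverse. `Heis.tl_slide` handles `tl`:
depending on the sign of `l`, `t` is inverted by `tl` on one side, and the composites of `tl` with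
decorated right caps (or cups) vanish, so what slides through `t` slides through `tl`. For `cup` and
`cap`, `Heis.cup_fst_tok_e` and its three companions compare composites with the entries of the
column or row, using that the dual basis of the direct sum is the union of the dual bases of the
factors (`FrobeniusTrace.pi_dual`). After this, each colored relation is the plain one with
idempotents collected at one end. Every summand of a correction term carries labels from a single
factor, so it survives only if the two strands have the same color. This is why crossings of
different colors commute with dots and why `t i j` is invertible on its own for `i ≠ j`.

For the functor to the colored category, a plain relation is tested after composing with strands of
all colors, which add up to the identity (`eq_of_sum_eq_one`). Each such composite selects one
summand of the substituted sums, so the plain relation falls apart into the colored ones. Vanishing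
statements that mix colors, which the colored presentation does not list, come from the
orthogonality of the colored strands. -/

/-! ### Functors between presented categories -/

namespace Term

variable {k : Type u} {O : Type v} {Gen Gen' : List O → List O → Type w}

/-- Substitution of formal expressions for the generating morphisms. -/
def lift (m : ∀ {X Y : List O}, Gen X Y → Term k Gen' X Y) {X Y : List O} :
    Term k Gen X Y → Term k Gen' X Y
  | gen g => m g
  | id X => id X
  | comp f g => comp (lift m f) (lift m g)
  | tens f g => tens (lift m f) (lift m g)
  | zero X Y => zero X Y
  | add f g => add (lift m f) (lift m g)
  | smul a f => smul a (lift m f)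

theorem lift_cast (m : ∀ {X Y : List O}, Gen X Y → Term k Gen' X Y) {X Y X' Y' : List O}
    (hX : X = X') (hY : Y = Y') (f : Term k Gen X Y) :
    (f.cast hX hY).lift m = (f.lift m).cast hX hY := by
  subst hX; subst hY; rfl

theorem lift_sum (m : ∀ {X Y : List O}, Gen X Y → Term k Gen' X Y) {ι : Type z} [Fintype ι]
    {X Y : List O} (f : ι → Term k Gen X Y) :
    (Term.sum f).lift m = Term.sum fun i => (f i).lift m := by
  unfold Term.sum
  induction (Finset.univ : Finset ι).toList with
  | nil => rfl
  | cons a l ih =>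
    simp only [List.map_cons, List.foldr_cons]
    rw [← ih]
    rfl

theorem lift_pow (m : ∀ {X Y : List O}, Gen X Y → Term k Gen' X Y) {X : List O}
    (f : Term k Gen X X) (r : ℕ) : (f.pow r).lift m = (f.lift m).pow r := by
  induction r with
  | zero => rfl
  | succ r ih => simp only [Term.pow, lift, ih]

end Term

section lift

variable {k : Type u} [CommRing k] {O : Type v} {Gen Gen' : List O → List O → Type w}
  {R : ∀ X Y : List O, Term k Gen X Y → Term k Gen X Y → Prop}
  {R' : ∀ X Y : List O, Term k Gen' X Y → Term k Gen' X Y → Prop}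

/-- Substitution commutes with all operations on formal expressions, so each axiom of a strict
linear monoidal category goes to an instance of itself. Only the defining relations carry content.
-/
theorem TermRel.lift (m : ∀ {X Y : List O}, Gen X Y → Term k Gen' X Y)
    (hm : ∀ {X Y : List O} {f g : Term k Gen X Y}, R X Y f g →
      TermRel R' X Y (f.lift m) (g.lift m)) {X Y : List O} {f g : Term k Gen X Y}
    (h : TermRel R X Y f g) : TermRel R' X Y (f.lift m) (g.lift m) := by
  induction h with
  | of h => exact hm h
  | refl f => exact .refl _
  | symm _ ih => exact .symm ih
  | trans _ _ ih ih' => exact .trans ih ih'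
  | comp _ _ ih ih' => exact .comp ih ih'
  | tens _ _ ih ih' => exact .tens ih ih'
  | add _ _ ih ih' => exact .add ih ih'
  | smul a _ ih => exact .smul a ih
  | id_comp f => exact .id_comp _
  | comp_id f => exact .comp_id _
  | assoc f g h => exact .assoc _ _ _
  | add_assoc f g h => exact .add_assoc _ _ _
  | add_comm f g => exact .add_comm _ _
  | zero_add f => exact .zero_add _
  | smul_add a f g => exact .smul_add _ _ _
  | add_smul a b f => exact .add_smul _ _ _
  | mul_smul a b f => exact .mul_smul _ _ _
  | one_smul f => exact .one_smul _
  | zero_smul f => exact .zero_smul _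
  | add_comp f f' g => exact .add_comp _ _ _
  | comp_add f g g' => exact .comp_add _ _ _
  | smul_comp a f g => exact .smul_comp _ _ _
  | comp_smul a f g => exact .comp_smul _ _ _
  | add_tens f f' g => exact .add_tens _ _ _
  | tens_add f g g' => exact .tens_add _ _ _
  | smul_tens a f g => exact .smul_tens _ _ _
  | tens_smul a f g => exact .tens_smul _ _ _
  | id_tens_id X X' => exact .id_tens_id _ _
  | interchange f g f' g' => exact .interchange _ _ _ _
  | tens_assoc f g h => rw [Term.lift_cast]; exact .tens_assoc _ _ _
  | one_tens f => exact .one_tens _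
  | tens_one f => rw [Term.lift_cast]; exact .tens_one _

namespace Presented

/-- The strict monoidal functor, the identity on objects, that sends the generating morphisms to
prescribed morphisms satisfying the defining relations. -/
def liftFunctor (m : ∀ {X Y : List O}, Gen X Y → Term k Gen' X Y)
    (hm : ∀ {X Y : List O} {f g : Term k Gen X Y}, R X Y f g →
      cls (R := R') (f.lift m) = cls (g.lift m)) : Presented R ⥤ Presented R' where
  obj X := X
  map {X Y} f := Quotient.map (sa := homSetoid R X Y) (sb := homSetoid R' X Y) (Term.lift m)
    (fun _ _ h => TermRel.lift m
      (fun h => Quotient.exact (s := homSetoid R' _ _) (hm h)) h) f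
  map_id _ := rfl
  map_comp f g := by
    obtain ⟨f, rfl⟩ := mk_surj f; obtain ⟨g, rfl⟩ := mk_surj g; rfl

variable (m : ∀ {X Y : List O}, Gen X Y → Term k Gen' X Y)
    (hm : ∀ {X Y : List O} {f g : Term k Gen X Y}, R X Y f g →
      cls (R := R') (f.lift m) = cls (g.lift m))

theorem liftFunctor_sendsTo {X Y : List O} {f : Term k Gen X Y} {g : (ob X : Presented R') ⟶ ob Y}
    (h : mk (f.lift m) = g) : SendsTo (liftFunctor m hm) (mk f) g :=
  ⟨rfl, rfl, h.trans ((Category.id_comp _).trans (Category.comp_id _)).symm⟩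

theorem liftFunctor_additive : (liftFunctor m hm).Additive where
  map_add {X Y f g} := by
    obtain ⟨f, rfl⟩ := mk_surj f; obtain ⟨g, rfl⟩ := mk_surj g; rfl

theorem liftFunctor_linear : (liftFunctor m hm).Linear k where
  map_smul {X Y} f a := by
    obtain ⟨f, rfl⟩ := mk_surj f; rfl

theorem liftFunctor_isStrictMonoidal : IsStrictMonoidal (liftFunctor m hm) where
  obj_unit := rfl
  obj_tensor _ _ := rfl
  map_tensor f g := ⟨rfl, rfl, by
    obtain ⟨f, rfl⟩ := mk_surj f; obtain ⟨g, rfl⟩ := mk_surj g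
    exact ((Category.id_comp _).trans (Category.comp_id _)).symm⟩

/-- A double substitution that fixes the generators up to the relations fixes all expressions, by
induction on their formation. -/
theorem liftFunctor_comp_liftFunctor (m' : ∀ {X Y : List O}, Gen' X Y → Term k Gen X Y)
    (hm' : ∀ {X Y : List O} {f g : Term k Gen' X Y}, R' X Y f g →
      cls (R := R) (f.lift m') = cls (g.lift m'))
    (h : ∀ {X Y : List O} (g : Gen X Y), cls (R := R) ((m g).lift m') = cls (.gen g)) :
    liftFunctor m hm ⋙ liftFunctor m' hm' = 𝟭 (Presented R) := by
  have key : ∀ {X Y : List O} (f : Term k Gen X Y), TermRel R X Y ((f.lift m).lift m') f := by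
    intro X Y f
    induction f with
    | gen g => exact Quotient.exact (s := homSetoid R _ _) (h g)
    | id X => exact .refl _
    | comp f g ih ih' => exact .comp ih ih'
    | tens f g ih ih' => exact .tens ih ih'
    | zero X Y => exact .refl _
    | add f g ih ih' => exact .add ih ih'
    | smul a f ih => exact .smul a ih
  refine CategoryTheory.Functor.ext (fun _ => rfl) fun X Y f => ?_
  obtain ⟨f, rfl⟩ := mk_surj f
  have : mk (R := R) ((f.lift m).lift m') = mk f := mk_sound (key f)
  exact this.trans ((Category.id_comp _).trans (Category.comp_id _)).symm

end Presented
end lift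

/-! ### Calculus of morphisms between words -/

namespace Presented

variable {k : Type u} [CommRing k] {O : Type v} {Gen : List O → List O → Type w}
  {R : ∀ X Y : List O, Term k Gen X Y → Term k Gen X Y → Prop}

theorem cls_surj {X Y : List O} (f : Mor R X Y) : ∃ t : Term k Gen X Y, cls t = f :=
  Quotient.exists_rep f

/-- The same modules as the morphism spaces of `Presented R`, but indexed by bare words. This allows
a calculus in which neither associators nor unitors occur. -/
instance (X Y : List O) : AddCommGroup (Mor R X Y) :=
  inferInstanceAs (AddCommGroup ((ob X : Presented R) ⟶ ob Y))

instance (X Y : List O) : Module k (Mor R X Y) :=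
  inferInstanceAs (Module k ((ob X : Presented R) ⟶ ob Y))

/-- Vertical composition: `f` followed by `g`. -/
def vcomp {X Y Z : List O} (f : Mor R X Y) (g : Mor R Y Z) : Mor R X Z :=
  Quotient.map₂ (sa := homSetoid R X Y) (sb := homSetoid R Y Z)
    (sc := homSetoid R X Z) Term.comp (fun _ _ h _ _ h' => TermRel.comp h h') f g

infixr:80 "≫ᵥ" => vcomp

/-- The identity morphism of a word. -/
def one (X : List O) : Mor R X X := cls (Term.id X)

/-- Horizontal juxtaposition, between words equal to the concatenations. -/
def hcomp {X Y X' Y' Z W : List O} (f : Mor R X Y) (g : Mor R X' Y') (hZ : Z = X ++ X')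
    (hW : W = Y ++ Y') : Mor R Z W :=
  Quotient.map₂ (sa := homSetoid R X Y) (sb := homSetoid R X' Y') (sc := homSetoid R Z W)
    (fun f g => (Term.tens f g).cast hZ.symm hW.symm)
    (fun _ _ h _ _ h' => by subst hZ; subst hW; exact TermRel.tens h h') f g

theorem cls_id (X : List O) : cls (R := R) (Term.id X) = one X := rfl
theorem cls_comp {X Y Z : List O} (f : Term k Gen X Y) (g : Term k Gen Y Z) :
    cls (R := R) (f⨟g) = cls f≫ᵥcls g := rfl
theorem cls_smul {X Y : List O} (a : k) (f : Term k Gen X Y) :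
    cls (R := R) (f.smul a) = a • cls f := rfl

theorem cls_sum {ι : Type z} [Fintype ι] {X Y : List O} (f : ι → Term k Gen X Y) :
    cls (R := R) (Term.sum f) = ∑ i, cls (f i) := by
  rw [← Finset.sum_map_toList]
  unfold Term.sum
  induction (Finset.univ : Finset ι).toList with
  | nil => rfl
  | cons a l ih =>
    simp only [List.map_cons, List.foldr_cons, List.sum_cons]
    rw [← ih]
    rfl

@[simp] theorem one_vcomp {X Y : List O} (f : Mor R X Y) : one X≫ᵥf = f := by
  obtain ⟨f, rfl⟩ := cls_surj f; exact cls_sound (.id_comp _)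
@[simp] theorem vcomp_one {X Y : List O} (f : Mor R X Y) : f≫ᵥone Y = f := by
  obtain ⟨f, rfl⟩ := cls_surj f; exact cls_sound (.comp_id _)
@[simp] theorem vcomp_assoc {X Y Z W : List O} (f : Mor R X Y) (g : Mor R Y Z) (h : Mor R Z W) :
    (f≫ᵥg)≫ᵥh = f≫ᵥg≫ᵥh := by
  obtain ⟨f, rfl⟩ := cls_surj f; obtain ⟨g, rfl⟩ := cls_surj g; obtain ⟨h, rfl⟩ := cls_surj h
  exact cls_sound (.assoc _ _ _)
theorem add_vcomp {X Y Z : List O} (f f' : Mor R X Y) (g : Mor R Y Z) :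
    (f + f')≫ᵥg = f≫ᵥg + f'≫ᵥg := by
  obtain ⟨f, rfl⟩ := cls_surj f; obtain ⟨f', rfl⟩ := cls_surj f'; obtain ⟨g, rfl⟩ := cls_surj g
  exact cls_sound (.add_comp _ _ _)
theorem vcomp_add {X Y Z : List O} (f : Mor R X Y) (g g' : Mor R Y Z) :
    f≫ᵥ(g + g') = f≫ᵥg + f≫ᵥg' := by
  obtain ⟨f, rfl⟩ := cls_surj f; obtain ⟨g', rfl⟩ := cls_surj g'; obtain ⟨g, rfl⟩ := cls_surj g
  exact cls_sound (.comp_add _ _ _)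
theorem smul_vcomp {X Y Z : List O} (a : k) (f : Mor R X Y) (g : Mor R Y Z) :
    (a • f)≫ᵥg = a • (f≫ᵥg) := by
  obtain ⟨f, rfl⟩ := cls_surj f; obtain ⟨g, rfl⟩ := cls_surj g
  exact cls_sound (.smul_comp _ _ _)
theorem vcomp_smul {X Y Z : List O} (a : k) (f : Mor R X Y) (g : Mor R Y Z) :
    f≫ᵥ(a • g) = a • (f≫ᵥg) := by
  obtain ⟨f, rfl⟩ := cls_surj f; obtain ⟨g, rfl⟩ := cls_surj g
  exact cls_sound (.comp_smul _ _ _)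

/-- Vertical composition as a bilinear map. -/
def vcompLin (X Y Z : List O) : Mor R X Y →ₗ[k] Mor R Y Z →ₗ[k] Mor R X Z :=
  LinearMap.mk₂ k vcomp add_vcomp smul_vcomp vcomp_add vcomp_smul

@[simp] theorem zero_vcomp {X Y Z : List O} (g : Mor R Y Z) : (0 : Mor R X Y)≫ᵥg = 0 :=
  LinearMap.map_zero₂ (vcompLin X Y Z) g
@[simp] theorem vcomp_zero {X Y Z : List O} (f : Mor R X Y) : f≫ᵥ(0 : Mor R Y Z) = 0 :=
  map_zero (vcompLin X Y Z f)
theorem sum_vcomp {ι : Type z} {X Y Z : List O} (s : Finset ι) (f : ι → Mor R X Y)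
    (g : Mor R Y Z) : (∑ i ∈ s, f i)≫ᵥg = ∑ i ∈ s, f i≫ᵥg :=
  LinearMap.map_sum₂ (vcompLin X Y Z) s f g
theorem vcomp_sum {ι : Type z} {X Y Z : List O} (s : Finset ι) (f : Mor R X Y)
    (g : ι → Mor R Y Z) : f≫ᵥ(∑ i ∈ s, g i) = ∑ i ∈ s, f≫ᵥg i :=
  map_sum (vcompLin X Y Z f) g s

section hcomp

variable {X Y X' Y' X'' Y'' Z Z' Z'' W W' W'' : List O}

theorem hcomp_add (f : Mor R X Y) (g g' : Mor R X' Y') (hZ : Z = X ++ X') (hW : W = Y ++ Y') :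
    hcomp f (g + g') hZ hW = hcomp f g hZ hW + hcomp f g' hZ hW := by
  subst hZ; subst hW
  obtain ⟨f, rfl⟩ := cls_surj f; obtain ⟨g', rfl⟩ := cls_surj g'; obtain ⟨g, rfl⟩ := cls_surj g
  exact cls_sound (.tens_add _ _ _)
theorem add_hcomp (f f' : Mor R X Y) (g : Mor R X' Y') (hZ : Z = X ++ X') (hW : W = Y ++ Y') :
    hcomp (f + f') g hZ hW = hcomp f g hZ hW + hcomp f' g hZ hW := by
  subst hZ; subst hW
  obtain ⟨f, rfl⟩ := cls_surj f; obtain ⟨f', rfl⟩ := cls_surj f'; obtain ⟨g, rfl⟩ := cls_surj g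
  exact cls_sound (.add_tens _ _ _)
theorem hcomp_smul (a : k) (f : Mor R X Y) (g : Mor R X' Y') (hZ : Z = X ++ X')
    (hW : W = Y ++ Y') : hcomp f (a • g) hZ hW = a • hcomp f g hZ hW := by
  subst hZ; subst hW
  obtain ⟨f, rfl⟩ := cls_surj f; obtain ⟨g, rfl⟩ := cls_surj g
  exact cls_sound (.tens_smul _ _ _)
theorem smul_hcomp (a : k) (f : Mor R X Y) (g : Mor R X' Y') (hZ : Z = X ++ X')
    (hW : W = Y ++ Y') : hcomp (a • f) g hZ hW = a • hcomp f g hZ hW := by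
  subst hZ; subst hW
  obtain ⟨f, rfl⟩ := cls_surj f; obtain ⟨g, rfl⟩ := cls_surj g
  exact cls_sound (.smul_tens _ _ _)

theorem hcomp_one_one (hZ : Z = X ++ X') : hcomp (one (R := R) X) (one X') hZ hZ = one Z := by
  subst hZ; exact cls_sound (.id_tens_id _ _)

theorem hcomp_vcomp_hcomp (f : Mor R X Y) (f' : Mor R X' Y') (g : Mor R Y Z) (g' : Mor R Y' Z')
    (hX : X'' = X ++ X') (hY : Y'' = Y ++ Y') (hZ : Z'' = Z ++ Z') :
    hcomp f f' hX hY≫ᵥhcomp g g' hY hZ = hcomp (f≫ᵥg) (f'≫ᵥg') hX hZ := by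
  subst hX; subst hY; subst hZ
  obtain ⟨f, rfl⟩ := cls_surj f; obtain ⟨g, rfl⟩ := cls_surj g
  obtain ⟨f', rfl⟩ := cls_surj f'; obtain ⟨g', rfl⟩ := cls_surj g'
  exact (cls_sound (.interchange f g f' g')).symm

/-- Since `hcomp` accepts any word equal to the concatenation, strict associativity is an honest
equality without transport. For explicit words all the side conditions are `rfl`. -/
theorem hcomp_assoc {V V' : List O} (f : Mor R X Y) (g : Mor R X' Y') (h : Mor R X'' Y'')
    (hV : V = X ++ X') (hW : W = Y ++ Y') (hZ : Z = V ++ X'') (hZ' : Z' = W ++ Y'')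
    (hV' : V' = X' ++ X'') (hW' : W' = Y' ++ Y'') (hU : Z = X ++ V') (hU' : Z' = Y ++ W') :
    hcomp (hcomp f g hV hW) h hZ hZ' = hcomp f (hcomp g h hV' hW') hU hU' := by
  subst hV; subst hW; subst hV'; subst hW'; subst hZ; subst hZ'
  obtain ⟨f, rfl⟩ := cls_surj f; obtain ⟨g, rfl⟩ := cls_surj g; obtain ⟨h, rfl⟩ := cls_surj h
  exact cls_sound (.tens_assoc f g h)

theorem one_hcomp (f : Mor R X Y) (hX : X = [] ++ X) (hY : Y = [] ++ Y) :
    hcomp (one []) f hX hY = f := by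
  obtain ⟨f, rfl⟩ := cls_surj f; exact cls_sound (.one_tens f)

theorem hcomp_one (f : Mor R X Y) (hX : X = X ++ []) (hY : Y = Y ++ []) :
    hcomp f (one []) hX hY = f := by
  obtain ⟨f, rfl⟩ := cls_surj f
  -- `X = X ++ []` cannot be eliminated, because `X` occurs on both sides; the end words are
  -- therefore generalized first.
  have key : ∀ {A B : List O} (hA : X ++ [] = A) (hB : Y ++ [] = B) (hA' : X = A) (hB' : Y = B),
      cls (R := R) ((f⊠Term.id []).cast hA hB) = cls (f.cast hA' hB') := by
    intro A B hA hB hA' hB'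
    subst hA; subst hB; exact cls_sound (.tens_one f)
  exact key hX.symm hY.symm rfl rfl

end hcomp

section whisker

variable {X Y X' Y' Z Z' Z₁ Z₂ Z₃ Z₄ : List O}

/-- Whiskering on both sides, between words equal to the concatenations. -/
def whisk (L N : List O) (f : Mor R X Y) (hZ : Z = L ++ (X ++ N)) (hZ' : Z' = L ++ (Y ++ N)) :
    Mor R Z Z' :=
  hcomp (one L) (hcomp f (one N) rfl rfl) hZ hZ'

theorem whisk_one {L N : List O} (hZ : Z = L ++ (X ++ N)) :
    whisk L N (one (R := R) X) hZ hZ = one Z := by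
  rw [whisk, hcomp_one_one, hcomp_one_one]

theorem whisk_vcomp_whisk {L N : List O} (f : Mor R X Y) (g : Mor R Y X')
    (h₁ : Z₁ = L ++ (X ++ N)) (h₂ : Z₂ = L ++ (Y ++ N)) (h₃ : Z₃ = L ++ (X' ++ N)) :
    whisk L N f h₁ h₂≫ᵥwhisk L N g h₂ h₃ = whisk L N (f≫ᵥg) h₁ h₃ := by
  simp only [whisk, hcomp_vcomp_hcomp, one_vcomp]

/-- The word at which the inner juxtaposition lives is invisible in the outer type, so rebracketing
can produce different but equal inner words. This identifies the results. -/
theorem hcomp_hcomp_congr {A A' B B' C C' V V' : List O} (f : Mor R X Y) (a : Mor R X' Y')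
    (b : Mor R C C') (hA : A = X' ++ C) (hB : B = Y' ++ C') (hV : V = X ++ A) (hV' : V' = Y ++ B)
    (hA' : A' = X' ++ C) (hB' : B' = Y' ++ C') (hW : V = X ++ A') (hW' : V' = Y ++ B') :
    hcomp f (hcomp a b hA hB) hV hV' = hcomp f (hcomp a b hA' hB') hW hW' := by
  subst hA; subst hB; subst hA'; subst hB'; rfl

theorem whisk_whisk {L N L' N' L'' N'' : List O} (f : Mor R X Y)
    (hX : X' = L' ++ (X ++ N')) (hY : Y' = L' ++ (Y ++ N'))
    (hZ : Z = L ++ (X' ++ N)) (hZ' : Z' = L ++ (Y' ++ N))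
    (hL : L'' = L ++ L') (hN : N'' = N' ++ N)
    (h : Z = L'' ++ (X ++ N'')) (h' : Z' = L'' ++ (Y ++ N'')) :
    whisk L N (whisk L' N' f hX hY) hZ hZ' = whisk L'' N'' f h h' := by
  simp only [whisk]
  rw [← hcomp_one_one (R := R) hN, ← hcomp_one_one (R := R) hL,
    hcomp_assoc (one L) (one L') _ hL hL h h' rfl rfl (by simp [h, hL]) (by simp [h', hL]),
    hcomp_assoc (one L') (hcomp f (one N') rfl rfl) (one N) hX hY rfl rfl
      (by rw [List.append_assoc, ← hN]) (by rw [List.append_assoc, ← hN])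
      (by simp [hX, hN]) (by simp [hY, hN]),
    hcomp_assoc f (one N') (one N) rfl rfl _ _ hN hN rfl rfl]
  apply hcomp_hcomp_congr

/-- Morphisms on disjoint strands commute. -/
theorem whisk_swap {L M N P P' Q Q' : List O} (f : Mor R X Y) (g : Mor R X' Y')
    {h₁ : Z₁ = L ++ (X ++ P)} {h₂ : Z₂ = L ++ (Y ++ P)} {h₃ : Z₂ = Q ++ (X' ++ N)}
    {h₄ : Z₃ = Q ++ (Y' ++ N)} (hP : P = M ++ (X' ++ N)) (hQ : Q = L ++ (Y ++ M))
    (hP' : P' = M ++ (Y' ++ N)) (hQ' : Q' = L ++ (X ++ M))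
    (h₅ : Z₁ = Q' ++ (X' ++ N)) (h₆ : Z₄ = Q' ++ (Y' ++ N)) (h₇ : Z₄ = L ++ (X ++ P'))
    (h₈ : Z₃ = L ++ (Y ++ P')) :
    whisk L P f h₁ h₂≫ᵥwhisk Q N g h₃ h₄ = whisk Q' N g h₅ h₆≫ᵥwhisk L P' f h₇ h₈ := by
  -- Both whiskered morphisms are brought to a right-nested juxtaposition of five blocks: `L`, the
  -- strands of `f`, `M`, the strands of `g`, `N`. There the interchange law acts block by block.
  have key : ∀ {A B A' B' V V' Q : List O} (a : Mor R A B) (b : Mor R A' B')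
      (hQ : Q = L ++ (A ++ M)) (h : V = Q ++ (A' ++ N)) (h' : V' = L ++ (B ++ (M ++ (B' ++ N))))
      (h'' : V' = (L ++ (B ++ M)) ++ (B' ++ N)),
      hcomp (hcomp (one L) (hcomp a (one M) rfl rfl) hQ rfl) (hcomp b (one N) rfl rfl) h h'' =
      hcomp (one L) (hcomp a (hcomp (one M) (hcomp b (one N) rfl rfl) rfl rfl) rfl rfl)
        (by simp [h, hQ]) h' := by
    intro A B A' B' V V' Q a b hQ h h' h''
    rw [hcomp_assoc (one L) (hcomp a (one M) rfl rfl) (hcomp b (one N) rfl rfl) hQ rfl h h'' rfl rfl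
      (by simp [h, hQ]) (by simp [h']),
      hcomp_assoc a (one M) (hcomp b (one N) rfl rfl) rfl rfl rfl rfl rfl rfl (by simp) (by simp)]
    apply hcomp_hcomp_congr
  have hf : ∀ {A V V' : List O} (h : V = L ++ (X ++ (M ++ (A ++ N))))
      (h' : V' = L ++ (Y ++ (M ++ (A ++ N)))),
      whisk L (M ++ (A ++ N)) f h h' = hcomp (one L) (hcomp f (hcomp (one M)
        (hcomp (one A) (one N) rfl rfl) rfl rfl) rfl rfl) h h' := by
    intro A V V' h h'
    rw [hcomp_one_one, hcomp_one_one, whisk]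
  have hg : ∀ {A V V' Q : List O} (hQ : Q = L ++ (A ++ M)) (h : V = Q ++ (X' ++ N))
      (h' : V' = Q ++ (Y' ++ N)),
      whisk Q N g h h' = hcomp (one L) (hcomp (one A) (hcomp (one M)
        (hcomp g (one N) rfl rfl) rfl rfl) rfl rfl) (by simp [h, hQ]) (by simp [h', hQ]) := by
    intro A V V' Q hQ h h'
    subst hQ
    rw [← key (one A) g rfl h (by simp [h']) h', hcomp_one_one, hcomp_one_one, whisk]
  subst hP; subst hP'
  rw [hf, hf, hg hQ, hg hQ']
  simp only [hcomp_vcomp_hcomp, one_vcomp, vcomp_one]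

theorem whisk_add (L N : List O) (f g : Mor R X Y) (hZ : Z = L ++ (X ++ N))
    (hZ' : Z' = L ++ (Y ++ N)) :
    whisk L N (f + g) hZ hZ' = whisk L N f hZ hZ' + whisk L N g hZ hZ' := by
  simp only [whisk, add_hcomp, hcomp_add]

theorem whisk_smul (L N : List O) (a : k) (f : Mor R X Y) (hZ : Z = L ++ (X ++ N))
    (hZ' : Z' = L ++ (Y ++ N)) :
    whisk L N (a • f) hZ hZ' = a • whisk L N f hZ hZ' := by
  simp only [whisk, smul_hcomp, hcomp_smul]

/-- Whiskering as a linear map. -/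
def whiskLin (L N : List O) (hZ : Z = L ++ (X ++ N)) (hZ' : Z' = L ++ (Y ++ N)) :
    Mor R X Y →ₗ[k] Mor R Z Z' where
  toFun f := whisk L N f hZ hZ'
  map_add' f g := whisk_add L N f g hZ hZ'
  map_smul' a f := whisk_smul L N a f hZ hZ'

theorem whisk_zero (L N : List O) (hZ : Z = L ++ (X ++ N)) (hZ' : Z' = L ++ (Y ++ N)) :
    whisk L N (0 : Mor R X Y) hZ hZ' = 0 :=
  map_zero (whiskLin L N hZ hZ')

theorem whisk_sum {ι : Type z} (s : Finset ι) (L N : List O) (f : ι → Mor R X Y)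
    (hZ : Z = L ++ (X ++ N)) (hZ' : Z' = L ++ (Y ++ N)) :
    whisk L N (∑ i ∈ s, f i) hZ hZ' = ∑ i ∈ s, whisk L N (f i) hZ hZ' :=
  map_sum (whiskLin L N hZ hZ') f s

theorem whisk_nil_left (N : List O) (f : Mor R X Y) (hZ : Z = [] ++ (X ++ N))
    (hZ' : Z' = [] ++ (Y ++ N)) : whisk [] N f hZ hZ' = hcomp f (one N) hZ hZ' := by
  subst hZ; subst hZ'; exact one_hcomp _ _ _

theorem whisk_nil_right (L : List O) (f : Mor R X Y) (hZ : Z = L ++ (X ++ []))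
    (hZ' : Z' = L ++ (Y ++ [])) :
    whisk L [] f hZ hZ' = hcomp (one L) f (by simpa using hZ) (by simpa using hZ') := by
  subst hZ; subst hZ'
  have := hcomp_hcomp_congr (one L) f (one []) rfl rfl rfl rfl (List.append_nil X).symm
    (List.append_nil Y).symm (by simp) (by simp)
  rw [hcomp_one] at this
  exact this

theorem hcomp_eq_whisk (f : Mor R X Y) (g : Mor R X' Y') (hZ : Z = X ++ X') (hZ' : Z' = Y ++ Y') :
    hcomp f g hZ hZ' = whisk [] X' f hZ rfl≫ᵥwhisk Y [] g (by simp) (by simpa using hZ') := by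
  rw [whisk_nil_left, whisk_nil_right, hcomp_vcomp_hcomp, vcomp_one, one_vcomp]

end whisker
end Presented

/-! ### Diagrams on few strands -/

namespace Presented

variable {k : Type u} [CommRing k] {O : Type v} {Gen : List O → List O → Type w}
  {R : ∀ X Y : List O, Term k Gen X Y → Term k Gen X Y → Prop}

/-- Composites are kept bracketed to the right. This form lets a relation between two consecutive
factors be applied in the middle of a longer composite. -/
theorem vcomp_eq_assoc {X Y Y' Z W : List O} {f : Mor R X Y} {g : Mor R Y Z} {f' : Mor R X Y'}
    {g' : Mor R Y' Z} (h : f≫ᵥg = f'≫ᵥg') (e : Mor R Z W) : f≫ᵥg≫ᵥe = f'≫ᵥg'≫ᵥe := by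
  rw [← vcomp_assoc, h, vcomp_assoc]

theorem vcomp_eq_assoc' {X Y Z W : List O} {f : Mor R X Y} {g : Mor R Y Z} {f' : Mor R X Z}
    (h : f≫ᵥg = f') (e : Mor R Z W) : f≫ᵥg≫ᵥe = f'≫ᵥe := by
  rw [← vcomp_assoc, h]

variable {p p' p'' q q' q'' a b : O}

/-- A one-strand diagram as the first of two strands. -/
def fst (q : O) (f : Mor R [p] [p']) : Mor R [p, q] [p', q] := whisk [] [q] f rfl rfl

/-- A one-strand diagram as the second of two strands. -/
def snd (p : O) (f : Mor R [q] [q']) : Mor R [p, q] [p, q'] := whisk [p] [] f rfl rfl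

/-- Juxtaposition of two one-strand diagrams. -/
def two (f : Mor R [p] [p']) (g : Mor R [q] [q']) : Mor R [p, q] [p', q'] := hcomp f g rfl rfl

theorem two_eq (f : Mor R [p] [p']) (g : Mor R [q] [q']) : two f g = fst q f≫ᵥsnd p' g :=
  hcomp_eq_whisk f g rfl rfl

@[simp] theorem fst_one : fst q (one (R := R) [p]) = one [p, q] := whisk_one rfl
@[simp] theorem snd_one : snd p (one (R := R) [q]) = one [p, q] := whisk_one rfl

theorem fst_vcomp (f : Mor R [p] [p']) (g : Mor R [p'] [p'']) :
    fst q (f≫ᵥg) = fst q f≫ᵥfst q g := (whisk_vcomp_whisk f g rfl rfl rfl).symm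
theorem snd_vcomp (f : Mor R [q] [q']) (g : Mor R [q'] [q'']) :
    snd p (f≫ᵥg) = snd p f≫ᵥsnd p g := (whisk_vcomp_whisk f g rfl rfl rfl).symm

theorem snd_fst (f : Mor R [p] [p']) (g : Mor R [q] [q']) :
    snd p g≫ᵥfst q' f = fst q f≫ᵥsnd p' g :=
  Eq.symm (whisk_swap (M := []) f g rfl rfl rfl rfl rfl rfl rfl rfl)
theorem snd_fst_assoc {W : List O} (f : Mor R [p] [p']) (g : Mor R [q] [q'])
    (h : Mor R [p', q'] W) : snd p g≫ᵥfst q' f≫ᵥh = fst q f≫ᵥsnd p' g≫ᵥh :=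
  vcomp_eq_assoc (snd_fst f g) h

@[simp] theorem fst_zero : fst q (0 : Mor R [p] [p']) = 0 := whisk_zero _ _ _ _
@[simp] theorem snd_zero : snd p (0 : Mor R [q] [q']) = 0 := whisk_zero _ _ _ _
theorem fst_add (f g : Mor R [p] [p']) : fst q (f + g) = fst q f + fst q g :=
  whisk_add _ _ _ _ _ _
theorem snd_add (f g : Mor R [q] [q']) : snd p (f + g) = snd p f + snd p g :=
  whisk_add _ _ _ _ _ _
theorem fst_smul (a : k) (f : Mor R [p] [p']) : fst q (a • f) = a • fst q f :=
  whisk_smul _ _ _ _ _ _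
theorem snd_smul (a : k) (f : Mor R [q] [q']) : snd p (a • f) = a • snd p f :=
  whisk_smul _ _ _ _ _ _
theorem fst_sum {ι : Type z} (s : Finset ι) (f : ι → Mor R [p] [p']) :
    fst q (∑ i ∈ s, f i) = ∑ i ∈ s, fst q (f i) := whisk_sum _ _ _ _ _ _
theorem snd_sum {ι : Type z} (s : Finset ι) (f : ι → Mor R [q] [q']) :
    snd p (∑ i ∈ s, f i) = ∑ i ∈ s, snd p (f i) := whisk_sum _ _ _ _ _ _

/-- The crossing `s` turned sideways by the cup `c` and the cap `d`. -/
def rotate (c : Mor R [] [b, a]) (s : Mor R [a, a] [a, a]) (d : Mor R [a, b] []) :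
    Mor R [a, b] [b, a] :=
  (whisk [] [a, b] c rfl rfl : Mor R [a, b] [b, a, a, b])≫ᵥ
    (whisk [b] [b] s rfl rfl : Mor R [b, a, a, b] [b, a, a, b])≫ᵥwhisk [b, a] [] d rfl rfl

/-- The diagram `f` turned upside down by the cup `c` and the cap `d`. -/
def mate (c : Mor R [] [b, a]) (f : Mor R [a] [a]) (d : Mor R [a, b] []) : Mor R [b] [b] :=
  (whisk [] [b] c rfl rfl : Mor R [b] [b, a, b])≫ᵥ
    (whisk [b] [b] f rfl rfl : Mor R [b, a, b] [b, a, b])≫ᵥwhisk [b] [] d rfl rfl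

/-- The zigzag of the cup `c` and the cap `d`. -/
def zigzag (c : Mor R [] [b, a]) (d : Mor R [a, b] []) : Mor R [a] [a] :=
  (whisk [a] [] c rfl rfl : Mor R [a] [a, b, a])≫ᵥwhisk [] [a] d rfl rfl

variable (c c' : Mor R [] [b, a]) (s : Mor R [a, a] [a, a]) (d d' : Mor R [a, b] [])
  (f g : Mor R [a] [a]) (h : Mor R [b] [b])

/-- The left side is the literal formula for right crossings. With `c`, `s`, `d` arbitrary, it
covers plain, colored and substituted crossings alike. -/
theorem hcomp_rotate : (hcomp c (hcomp (one [a]) (one [b]) rfl rfl) rfl rfl :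
      Mor R [a, b] [b, a, a, b])≫ᵥ(hcomp (one [b]) (hcomp s (one [b]) rfl rfl) rfl rfl :
      Mor R [b, a, a, b] [b, a, a, b])≫ᵥhcomp (one [b]) (hcomp (one [a]) d rfl rfl) rfl rfl =
    rotate c s d := by
  have h₁ : (hcomp c (hcomp (one [a]) (one [b]) rfl rfl) rfl rfl : Mor R [a, b] [b, a, a, b]) =
      whisk [] [a, b] c rfl rfl := by
    rw [hcomp_one_one, whisk_nil_left]; rfl
  have h₂ : (hcomp (one [b]) (hcomp (one [a]) d rfl rfl) rfl rfl : Mor R [b, a, a, b] [b, a]) =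
      whisk [b, a] [] d rfl rfl := by
    rw [whisk_nil_right, ← hcomp_one_one (R := R) (X := [b]) (X' := [a]) (Z := [b, a]) rfl,
      hcomp_assoc _ _ _ rfl rfl rfl rfl rfl rfl rfl rfl]
  rw [h₁, h₂]; rfl

theorem hcomp_mate : (hcomp c (one [b]) rfl rfl : Mor R [b] [b, a, b])≫ᵥ
      (hcomp (one [b]) (hcomp f (one [b]) rfl rfl) rfl rfl : Mor R [b, a, b] [b, a, b])≫ᵥ
      hcomp (one [b]) d rfl rfl = mate c f d := by
  have h₁ : (hcomp c (one [b]) rfl rfl : Mor R [b] [b, a, b]) = whisk [] [b] c rfl rfl := by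
    rw [whisk_nil_left]
  have h₂ : (hcomp (one [b]) d rfl rfl : Mor R [b, a, b] [b]) = whisk [b] [] d rfl rfl := by
    rw [whisk_nil_right]
  rw [h₁, h₂]; rfl

theorem hcomp_mate_one : (hcomp c (one [b]) rfl rfl : Mor R [b] [b, a, b])≫ᵥ
      hcomp (one [b]) d rfl rfl = mate c (one [a]) d := by
  rw [← hcomp_mate, hcomp_one_one, hcomp_one_one, one_vcomp]

theorem hcomp_zigzag : (hcomp (one [a]) c rfl rfl : Mor R [a] [a, b, a])≫ᵥ
      hcomp d (one [a]) rfl rfl = zigzag c d := by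
  have h₁ : (hcomp d (one [a]) rfl rfl : Mor R [a, b, a] [a]) = whisk [] [a] d rfl rfl := by
    rw [whisk_nil_left]
  have h₂ : (hcomp (one [a]) c rfl rfl : Mor R [a] [a, b, a]) = whisk [a] [] c rfl rfl := by
    rw [whisk_nil_right]
  rw [h₁, h₂]; rfl

/-- In the colored zigzag relation the free strand carries `f` below and `g` above; both lie at the
free ends and can be pulled out of the zigzag. -/
theorem hcomp_zigzag_colored : (hcomp f c rfl rfl : Mor R [a] [a, b, a])≫ᵥ
      hcomp d g rfl rfl = f≫ᵥzigzag c d≫ᵥg := by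
  have h₁ : (hcomp f c rfl rfl : Mor R [a] [a, b, a]) = f≫ᵥhcomp (one [a]) c rfl rfl := by
    conv_rhs => rw [← hcomp_one f rfl rfl, hcomp_vcomp_hcomp, vcomp_one, one_vcomp]
  have h₂ : (hcomp d g rfl rfl : Mor R [a, b, a] [a]) = hcomp d (one [a]) rfl rfl≫ᵥg := by
    conv_rhs => rw [← one_hcomp g rfl rfl, hcomp_vcomp_hcomp, vcomp_one, one_vcomp]
  rw [h₁, h₂, ← hcomp_zigzag, vcomp_assoc, vcomp_assoc]

theorem hcomp_mate_one_colored (h' : Mor R [b] [b]) :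
    (hcomp c h rfl rfl : Mor R [b] [b, a, b])≫ᵥhcomp h' d rfl rfl =
      h≫ᵥmate c (one [a]) d≫ᵥh' := by
  have h₁ : (hcomp c h rfl rfl : Mor R [b] [b, a, b]) = h≫ᵥhcomp c (one [b]) rfl rfl := by
    conv_rhs => rw [← one_hcomp h rfl rfl, hcomp_vcomp_hcomp, vcomp_one, one_vcomp]
  have h₂ : (hcomp h' d rfl rfl : Mor R [b, a, b] [b]) = hcomp (one [b]) d rfl rfl≫ᵥh' := by
    conv_rhs => rw [← hcomp_one h' rfl rfl, hcomp_vcomp_hcomp, vcomp_one, one_vcomp]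
  rw [h₁, h₂, ← hcomp_mate_one, vcomp_assoc, vcomp_assoc]

/-- Inside `rotate c s d`, the incoming strand `a` is the second input of `s` and the outgoing
strand `a` is its first output; the first input comes from the cup and the second output goes to the
cap. This lemma and the next five move a one-strand diagram along these connections. -/
theorem fst_rotate : fst b f≫ᵥrotate c s d = rotate c (snd a f≫ᵥs) d := by
  have h₁ : fst b f≫ᵥ(whisk [] [a, b] c rfl rfl : Mor R [a, b] [b, a, a, b]) =
      whisk [] [a, b] c rfl rfl≫ᵥwhisk [b, a] [b] f rfl rfl :=
    Eq.symm (whisk_swap (M := []) c f rfl rfl rfl rfl rfl rfl rfl rfl)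
  have h₂ : (whisk [b, a] [b] f rfl rfl : Mor R [b, a, a, b] [b, a, a, b]) =
      whisk [b] [b] (snd a f) rfl rfl :=
    Eq.symm (whisk_whisk _ _ _ _ _ rfl rfl _ _)
  rw [rotate, vcomp_eq_assoc h₁, h₂, vcomp_eq_assoc' (whisk_vcomp_whisk _ _ _ _ _)]
  rfl

theorem rotate_snd : rotate c s d≫ᵥsnd b f = rotate c (s≫ᵥfst a f) d := by
  have h₁ : (whisk [b, a] [] d rfl rfl : Mor R [b, a, a, b] [b, a])≫ᵥsnd b f =
      whisk [b] [a, b] f rfl rfl≫ᵥwhisk [b, a] [] d rfl rfl :=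
    Eq.symm (whisk_swap (M := []) f d rfl rfl rfl rfl rfl rfl rfl rfl)
  have h₂ : (whisk [b] [a, b] f rfl rfl : Mor R [b, a, a, b] [b, a, a, b]) =
      whisk [b] [b] (fst a f) rfl rfl :=
    Eq.symm (whisk_whisk _ _ _ _ _ rfl rfl _ _)
  rw [rotate, vcomp_assoc, vcomp_assoc, h₁, h₂, vcomp_eq_assoc' (whisk_vcomp_whisk _ _ _ _ _)]
  rfl

theorem rotate_fst_cap : rotate c s (fst b f≫ᵥd) = rotate c (s≫ᵥsnd a f) d := by
  have h₁ : (whisk [b, a] [] (fst b f≫ᵥd) rfl rfl : Mor R [b, a, a, b] [b, a]) =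
      (whisk [b] [b] (snd a f) rfl rfl : Mor R [b, a, a, b] [b, a, a, b])≫ᵥ
        whisk [b, a] [] d rfl rfl := by
    rw [← whisk_vcomp_whisk (Z₂ := [b, a, a, b]) _ _ rfl rfl rfl]
    congr 1
    exact (whisk_whisk (L'' := [b, a]) (N'' := [b]) _ _ _ _ _ rfl rfl rfl rfl).trans
      (Eq.symm (whisk_whisk _ _ _ _ _ rfl rfl rfl rfl))
  rw [rotate, h₁, vcomp_eq_assoc' (whisk_vcomp_whisk _ _ _ _ _)]
  rfl

theorem rotate_cup_snd : rotate (c≫ᵥsnd b f) s d = rotate c (fst a f≫ᵥs) d := by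
  have h₁ : (whisk [] [a, b] (c≫ᵥsnd b f) rfl rfl : Mor R [a, b] [b, a, a, b]) =
      (whisk [] [a, b] c rfl rfl : Mor R [a, b] [b, a, a, b])≫ᵥ
        whisk [b] [b] (fst a f) rfl rfl := by
    rw [← whisk_vcomp_whisk (Z₂ := [b, a, a, b]) _ _ rfl rfl rfl]
    congr 1
    exact (whisk_whisk (L'' := [b]) (N'' := [a, b]) _ _ _ _ _ rfl rfl rfl rfl).trans
      (Eq.symm (whisk_whisk _ _ _ _ _ rfl rfl rfl rfl))
  rw [rotate, h₁, vcomp_assoc, vcomp_eq_assoc' (whisk_vcomp_whisk _ _ _ _ _)]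
  rfl

theorem rotate_cup_fst : rotate (c≫ᵥfst a h) s d = rotate c s d≫ᵥfst a h := by
  have h₁ : (whisk [] [a, b] (c≫ᵥfst a h) rfl rfl : Mor R [a, b] [b, a, a, b]) =
      (whisk [] [a, b] c rfl rfl : Mor R [a, b] [b, a, a, b])≫ᵥ
        whisk [] [a, a, b] h rfl rfl := by
    rw [← whisk_vcomp_whisk (Z₂ := [b, a, a, b]) _ _ rfl rfl rfl]
    congr 1
    exact whisk_whisk _ _ _ _ _ rfl rfl rfl rfl
  have h₂ : (whisk [] [a, a, b] h rfl rfl : Mor R [b, a, a, b] [b, a, a, b])≫ᵥ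
      (whisk [b] [b] s rfl rfl : Mor R [b, a, a, b] [b, a, a, b]) =
      whisk [b] [b] s rfl rfl≫ᵥwhisk [] [a, a, b] h rfl rfl :=
    whisk_swap (M := []) h s rfl rfl rfl rfl rfl rfl rfl rfl
  have h₃ : (whisk [] [a, a, b] h rfl rfl : Mor R [b, a, a, b] [b, a, a, b])≫ᵥ
      (whisk [b, a] [] d rfl rfl : Mor R [b, a, a, b] [b, a]) =
      whisk [b, a] [] d rfl rfl≫ᵥfst a h :=
    whisk_swap (M := [a]) h d rfl rfl rfl rfl rfl rfl rfl rfl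
  rw [rotate, h₁, vcomp_assoc, vcomp_eq_assoc h₂, h₃, rotate, vcomp_assoc, vcomp_assoc]

theorem snd_rotate : snd a h≫ᵥrotate c s d = rotate c s (snd a h≫ᵥd) := by
  have h₁ : snd a h≫ᵥ(whisk [] [a, b] c rfl rfl : Mor R [a, b] [b, a, a, b]) =
      whisk [] [a, b] c rfl rfl≫ᵥwhisk [b, a, a] [] h rfl rfl :=
    Eq.symm (whisk_swap (M := [a]) c h rfl rfl rfl rfl rfl rfl rfl rfl)
  have h₂ : (whisk [b, a, a] [] h rfl rfl : Mor R [b, a, a, b] [b, a, a, b])≫ᵥ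
      (whisk [b] [b] s rfl rfl : Mor R [b, a, a, b] [b, a, a, b]) =
      whisk [b] [b] s rfl rfl≫ᵥwhisk [b, a, a] [] h rfl rfl :=
    Eq.symm (whisk_swap (M := []) s h rfl rfl rfl rfl rfl rfl rfl rfl)
  have h₃ : (whisk [b, a] [] (snd a h≫ᵥd) rfl rfl : Mor R [b, a, a, b] [b, a]) =
      (whisk [b, a, a] [] h rfl rfl : Mor R [b, a, a, b] [b, a, a, b])≫ᵥ
        whisk [b, a] [] d rfl rfl := by
    rw [← whisk_vcomp_whisk (Z₂ := [b, a, a, b]) _ _ rfl rfl rfl]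
    congr 1
    exact whisk_whisk _ _ _ _ _ rfl rfl rfl rfl
  rw [rotate, vcomp_eq_assoc h₁, vcomp_eq_assoc h₂, rotate, h₃]

theorem mate_cup_snd : mate (c≫ᵥsnd b f) g d = mate c (f≫ᵥg) d := by
  have h₁ : (whisk [] [b] (c≫ᵥsnd b f) rfl rfl : Mor R [b] [b, a, b]) =
      (whisk [] [b] c rfl rfl : Mor R [b] [b, a, b])≫ᵥwhisk [b] [b] f rfl rfl := by
    rw [← whisk_vcomp_whisk (Z₂ := [b, a, b]) _ _ rfl rfl rfl]
    congr 1
    exact whisk_whisk _ _ _ _ _ rfl rfl rfl rfl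
  rw [mate, h₁, vcomp_assoc, vcomp_eq_assoc' (whisk_vcomp_whisk _ _ _ _ _)]
  rfl

theorem mate_fst_cap : mate c f (fst b g≫ᵥd) = mate c (f≫ᵥg) d := by
  have h₁ : (whisk [b] [] (fst b g≫ᵥd) rfl rfl : Mor R [b, a, b] [b]) =
      (whisk [b] [b] g rfl rfl : Mor R [b, a, b] [b, a, b])≫ᵥwhisk [b] [] d rfl rfl := by
    rw [← whisk_vcomp_whisk (Z₂ := [b, a, b]) _ _ rfl rfl rfl]
    congr 1
    exact whisk_whisk _ _ _ _ _ rfl rfl rfl rfl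
  rw [mate, h₁, vcomp_eq_assoc' (whisk_vcomp_whisk _ _ _ _ _)]
  rfl

theorem mate_cup_fst : mate (c≫ᵥfst a h) f d = mate c f d≫ᵥh := by
  have h₁ : (whisk [] [b] (c≫ᵥfst a h) rfl rfl : Mor R [b] [b, a, b]) =
      (whisk [] [b] c rfl rfl : Mor R [b] [b, a, b])≫ᵥwhisk [] [a, b] h rfl rfl := by
    rw [← whisk_vcomp_whisk (Z₂ := [b, a, b]) _ _ rfl rfl rfl]
    congr 1
    exact whisk_whisk _ _ _ _ _ rfl rfl rfl rfl
  have h₂ : (whisk [] [a, b] h rfl rfl : Mor R [b, a, b] [b, a, b])≫ᵥ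
      (whisk [b] [b] f rfl rfl : Mor R [b, a, b] [b, a, b]) =
      whisk [b] [b] f rfl rfl≫ᵥwhisk [] [a, b] h rfl rfl :=
    whisk_swap (M := []) h f rfl rfl rfl rfl rfl rfl rfl rfl
  have h₃ : (whisk [] [a, b] h rfl rfl : Mor R [b, a, b] [b, a, b])≫ᵥ
      (whisk [b] [] d rfl rfl : Mor R [b, a, b] [b]) =
      whisk [b] [] d rfl rfl≫ᵥwhisk [] [] h rfl rfl :=
    whisk_swap (M := []) h d rfl rfl rfl rfl rfl rfl rfl rfl
  have h₄ : (whisk [] [] h rfl rfl : Mor R [b] [b]) = h := by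
    rw [whisk_nil_left, hcomp_one]
  rw [mate, h₁, vcomp_assoc, vcomp_eq_assoc h₂, h₃, mate, vcomp_assoc, vcomp_assoc, h₄]

theorem vcomp_mate : h≫ᵥmate c f d = mate c f (snd a h≫ᵥd) := by
  have h₀ : (whisk [] [] h rfl rfl : Mor R [b] [b]) = h := by
    rw [whisk_nil_left, hcomp_one]
  have h₁ : h≫ᵥ(whisk [] [b] c rfl rfl : Mor R [b] [b, a, b]) =
      whisk [] [b] c rfl rfl≫ᵥwhisk [b, a] [] h rfl rfl := by
    conv_lhs => rw [← h₀]
    exact Eq.symm (whisk_swap (M := []) c h rfl rfl rfl rfl rfl rfl rfl rfl)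
  have h₂ : (whisk [b, a] [] h rfl rfl : Mor R [b, a, b] [b, a, b])≫ᵥ
      (whisk [b] [b] f rfl rfl : Mor R [b, a, b] [b, a, b]) =
      whisk [b] [b] f rfl rfl≫ᵥwhisk [b, a] [] h rfl rfl :=
    Eq.symm (whisk_swap (M := []) f h rfl rfl rfl rfl rfl rfl rfl rfl)
  have h₃ : (whisk [b] [] (snd a h≫ᵥd) rfl rfl : Mor R [b, a, b] [b]) =
      (whisk [b, a] [] h rfl rfl : Mor R [b, a, b] [b, a, b])≫ᵥwhisk [b] [] d rfl rfl := by
    rw [← whisk_vcomp_whisk (Z₂ := [b, a, b]) _ _ rfl rfl rfl]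
    congr 1
    exact whisk_whisk _ _ _ _ _ rfl rfl rfl rfl
  rw [mate, vcomp_eq_assoc h₁, vcomp_eq_assoc h₂, mate, h₃]

theorem mate_add : mate c (f + g) d = mate c f d + mate c g d := by
  simp only [mate, whisk_add, add_vcomp, vcomp_add]

theorem mate_smul (r : k) : mate c (r • f) d = r • mate c f d := by
  simp only [mate, whisk_smul, smul_vcomp, vcomp_smul]

theorem vcomp_zigzag : f≫ᵥzigzag c d = zigzag c (fst b f≫ᵥd) := by
  have h₀ : (whisk [] [] f rfl rfl : Mor R [a] [a]) = f := by
    rw [whisk_nil_left, hcomp_one]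
  have h₁ : f≫ᵥ(whisk [a] [] c rfl rfl : Mor R [a] [a, b, a]) =
      whisk [a] [] c rfl rfl≫ᵥwhisk [] [b, a] f rfl rfl := by
    conv_lhs => rw [← h₀]
    exact whisk_swap (M := []) f c rfl rfl rfl rfl rfl rfl rfl rfl
  have h₃ : (whisk [] [a] (fst b f≫ᵥd) rfl rfl : Mor R [a, b, a] [a]) =
      (whisk [] [b, a] f rfl rfl : Mor R [a, b, a] [a, b, a])≫ᵥwhisk [] [a] d rfl rfl := by
    rw [← whisk_vcomp_whisk (Z₂ := [a, b, a]) _ _ rfl rfl rfl]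
    congr 1
    exact whisk_whisk _ _ _ _ _ rfl rfl rfl rfl
  rw [zigzag, vcomp_eq_assoc h₁, zigzag, h₃]

theorem zigzag_cup_snd : zigzag (c≫ᵥsnd b f) d = zigzag c d≫ᵥf := by
  have h₀ : (whisk [] [] f rfl rfl : Mor R [a] [a]) = f := by
    rw [whisk_nil_left, hcomp_one]
  have h₁ : (whisk [a, b] [] f rfl rfl : Mor R [a, b, a] [a, b, a])≫ᵥ
      (whisk [] [a] d rfl rfl : Mor R [a, b, a] [a]) = whisk [] [a] d rfl rfl≫ᵥf := by
    conv_rhs => rw [← h₀]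
    exact Eq.symm (whisk_swap (M := []) d f rfl rfl rfl rfl rfl rfl rfl rfl)
  have h₃ : (whisk [a] [] (c≫ᵥsnd b f) rfl rfl : Mor R [a] [a, b, a]) =
      (whisk [a] [] c rfl rfl : Mor R [a] [a, b, a])≫ᵥwhisk [a, b] [] f rfl rfl := by
    rw [← whisk_vcomp_whisk (Z₂ := [a, b, a]) _ _ rfl rfl rfl]
    congr 1
    exact whisk_whisk _ _ _ _ _ rfl rfl rfl rfl
  rw [zigzag, h₃, vcomp_assoc, h₁, zigzag, vcomp_assoc]

theorem zigzag_cup_fst : zigzag (c≫ᵥfst a h) d = zigzag c (snd a h≫ᵥd) := by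
  have h₁ : (whisk [a] [] (c≫ᵥfst a h) rfl rfl : Mor R [a] [a, b, a]) =
      (whisk [a] [] c rfl rfl : Mor R [a] [a, b, a])≫ᵥwhisk [a] [a] h rfl rfl := by
    rw [← whisk_vcomp_whisk (Z₂ := [a, b, a]) _ _ rfl rfl rfl]
    congr 1
    exact whisk_whisk _ _ _ _ _ rfl rfl rfl rfl
  have h₂ : (whisk [] [a] (snd a h≫ᵥd) rfl rfl : Mor R [a, b, a] [a]) =
      (whisk [a] [a] h rfl rfl : Mor R [a, b, a] [a, b, a])≫ᵥwhisk [] [a] d rfl rfl := by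
    rw [← whisk_vcomp_whisk (Z₂ := [a, b, a]) _ _ rfl rfl rfl]
    congr 1
    exact whisk_whisk _ _ _ _ _ rfl rfl rfl rfl
  rw [zigzag, h₁, vcomp_assoc, zigzag, h₂]

/-- The disjoint cups `c'` and `c` are interchanged in height. Then `c` is the surviving cup, with
`f` on its leg `a`, and `c'` forms a zigzag with `d`. If `c' = c` and the zigzag is straight, a
token has passed from one leg of the cup to the other. The next lemma is the analogue for caps. -/
theorem cup_fst_mate : c'≫ᵥfst a (mate c f d) = c≫ᵥsnd b (f≫ᵥzigzag c' d) := by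
  have e₁ : fst a (mate c f d) = (whisk [] [b, a] c rfl rfl : Mor R [b, a] [b, a, b, a])≫ᵥ
      (whisk [b] [b, a] f rfl rfl : Mor R [b, a, b, a] [b, a, b, a])≫ᵥ
      whisk [b] [a] d rfl rfl := by
    rw [mate, fst, ← whisk_vcomp_whisk (Z₂ := [b, a, b, a]) _ _ rfl rfl rfl,
      ← whisk_vcomp_whisk (Z₂ := [b, a, b, a]) _ _ rfl rfl rfl]
    congr 1
    · exact whisk_whisk _ _ _ _ _ rfl rfl rfl rfl
    congr 1 <;> exact whisk_whisk _ _ _ _ _ rfl rfl rfl rfl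
  have e₂ : snd b (f≫ᵥzigzag c' d) = snd b f≫ᵥ
      (whisk [b, a] [] c' rfl rfl : Mor R [b, a] [b, a, b, a])≫ᵥwhisk [b] [a] d rfl rfl := by
    rw [snd_vcomp, zigzag, snd, snd, ← whisk_vcomp_whisk (Z₂ := [b, a, b, a]) _ _ rfl rfl rfl]
    congr 1
    congr 1 <;> exact whisk_whisk _ _ _ _ _ rfl rfl rfl rfl
  have h₀ : ∀ c : Mor R [] [b, a], (whisk [] [] c rfl rfl : Mor R [] [b, a]) = c := by
    intro c; rw [whisk_nil_left, hcomp_one]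
  have h₁ : c'≫ᵥ(whisk [] [b, a] c rfl rfl : Mor R [b, a] [b, a, b, a]) =
      c≫ᵥwhisk [b, a] [] c' rfl rfl := by
    conv_lhs => rw [← h₀ c']
    conv_rhs => rw [← h₀ c]
    exact Eq.symm (whisk_swap (M := []) c c' rfl rfl rfl rfl rfl rfl rfl rfl)
  have h₂ : (whisk [b, a] [] c' rfl rfl : Mor R [b, a] [b, a, b, a])≫ᵥ
      (whisk [b] [b, a] f rfl rfl : Mor R [b, a, b, a] [b, a, b, a]) =
      snd b f≫ᵥwhisk [b, a] [] c' rfl rfl :=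
    Eq.symm (whisk_swap (M := []) f c' rfl rfl rfl rfl rfl rfl rfl rfl)
  rw [e₁, e₂, vcomp_eq_assoc h₁, vcomp_eq_assoc h₂]

theorem snd_mate_cap : snd a (mate c f d)≫ᵥd' = fst b (zigzag c d'≫ᵥf)≫ᵥd := by
  have e₁ : snd a (mate c f d) = (whisk [a] [b] c rfl rfl : Mor R [a, b] [a, b, a, b])≫ᵥ
      (whisk [a, b] [b] f rfl rfl : Mor R [a, b, a, b] [a, b, a, b])≫ᵥ
      whisk [a, b] [] d rfl rfl := by
    rw [mate, snd, ← whisk_vcomp_whisk (Z₂ := [a, b, a, b]) _ _ rfl rfl rfl,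
      ← whisk_vcomp_whisk (Z₂ := [a, b, a, b]) _ _ rfl rfl rfl]
    congr 1
    · exact whisk_whisk _ _ _ _ _ rfl rfl rfl rfl
    congr 1 <;> exact whisk_whisk _ _ _ _ _ rfl rfl rfl rfl
  have e₂ : fst b (zigzag c d'≫ᵥf) =
      (whisk [a] [b] c rfl rfl : Mor R [a, b] [a, b, a, b])≫ᵥ
      (whisk [] [a, b] d' rfl rfl : Mor R [a, b, a, b] [a, b])≫ᵥfst b f := by
    rw [fst_vcomp, zigzag, fst, fst, ← whisk_vcomp_whisk (Z₂ := [a, b, a, b]) _ _ rfl rfl rfl,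
      vcomp_assoc]
    congr 1
    · exact whisk_whisk _ _ _ _ _ rfl rfl rfl rfl
    congr 1
    exact whisk_whisk _ _ _ _ _ rfl rfl rfl rfl
  have h₀ : ∀ d : Mor R [a, b] [], (whisk [] [] d rfl rfl : Mor R [a, b] []) = d := by
    intro d; rw [whisk_nil_left, hcomp_one]
  have h₁ : (whisk [a, b] [] d rfl rfl : Mor R [a, b, a, b] [a, b])≫ᵥd' =
      whisk [] [a, b] d' rfl rfl≫ᵥd := by
    conv_lhs => rw [← h₀ d']
    conv_rhs => rw [← h₀ d]
    exact Eq.symm (whisk_swap (M := []) d' d rfl rfl rfl rfl rfl rfl rfl rfl)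
  have h₂ : (whisk [a, b] [b] f rfl rfl : Mor R [a, b, a, b] [a, b, a, b])≫ᵥ
      (whisk [] [a, b] d' rfl rfl : Mor R [a, b, a, b] [a, b]) =
      whisk [] [a, b] d' rfl rfl≫ᵥfst b f :=
    Eq.symm (whisk_swap (M := []) d' f rfl rfl rfl rfl rfl rfl rfl rfl)
  rw [e₁, e₂, vcomp_assoc, vcomp_assoc, h₁, vcomp_eq_assoc h₂, vcomp_assoc, vcomp_assoc]

end Presented

/-! ### Three strands and the colored braid relation. -/

namespace Presented

variable {k : Type u} [CommRing k] {O : Type v} {Gen : List O → List O → Type w}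
  {R : ∀ X Y : List O, Term k Gen X Y → Term k Gen X Y → Prop} {a : O}

/-- A two-strand diagram on the first two of three strands. -/
def lft (s : Mor R [a, a] [a, a]) : Mor R [a, a, a] [a, a, a] := whisk [] [a] s rfl rfl

/-- A two-strand diagram on the last two of three strands. -/
def rgt (s : Mor R [a, a] [a, a]) : Mor R [a, a, a] [a, a, a] := whisk [a] [] s rfl rfl

/-- A one-strand diagram as the first of three strands. -/
def strand₁ (f : Mor R [a] [a]) : Mor R [a, a, a] [a, a, a] := whisk [] [a, a] f rfl rfl

/-- A one-strand diagram as the second of three strands. -/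
def strand₂ (f : Mor R [a] [a]) : Mor R [a, a, a] [a, a, a] := whisk [a] [a] f rfl rfl

/-- A one-strand diagram as the third of three strands. -/
def strand₃ (f : Mor R [a] [a]) : Mor R [a, a, a] [a, a, a] := whisk [a, a] [] f rfl rfl

theorem lft_vcomp (s t : Mor R [a, a] [a, a]) : lft (s≫ᵥt) = lft s≫ᵥlft t :=
  Eq.symm (whisk_vcomp_whisk s t rfl rfl rfl)
theorem rgt_vcomp (s t : Mor R [a, a] [a, a]) : rgt (s≫ᵥt) = rgt s≫ᵥrgt t :=
  Eq.symm (whisk_vcomp_whisk s t rfl rfl rfl)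
theorem strand₁_vcomp (f g : Mor R [a] [a]) : strand₁ (f≫ᵥg) = strand₁ f≫ᵥstrand₁ g :=
  Eq.symm (whisk_vcomp_whisk f g rfl rfl rfl)
theorem strand₂_vcomp (f g : Mor R [a] [a]) : strand₂ (f≫ᵥg) = strand₂ f≫ᵥstrand₂ g :=
  Eq.symm (whisk_vcomp_whisk f g rfl rfl rfl)
theorem strand₃_vcomp (f g : Mor R [a] [a]) : strand₃ (f≫ᵥg) = strand₃ f≫ᵥstrand₃ g :=
  Eq.symm (whisk_vcomp_whisk f g rfl rfl rfl)

@[simp] theorem strand₁_one : strand₁ (one (R := R) [a]) = one _ := whisk_one rfl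
@[simp] theorem strand₂_one : strand₂ (one (R := R) [a]) = one _ := whisk_one rfl
@[simp] theorem strand₃_one : strand₃ (one (R := R) [a]) = one _ := whisk_one rfl

theorem strand₁_sum {ι : Type z} (s : Finset ι) (f : ι → Mor R [a] [a]) :
    strand₁ (∑ i ∈ s, f i) = ∑ i ∈ s, strand₁ (f i) := whisk_sum _ _ _ _ _ _
theorem strand₂_sum {ι : Type z} (s : Finset ι) (f : ι → Mor R [a] [a]) :
    strand₂ (∑ i ∈ s, f i) = ∑ i ∈ s, strand₂ (f i) := whisk_sum _ _ _ _ _ _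
theorem strand₃_sum {ι : Type z} (s : Finset ι) (f : ι → Mor R [a] [a]) :
    strand₃ (∑ i ∈ s, f i) = ∑ i ∈ s, strand₃ (f i) := whisk_sum _ _ _ _ _ _

theorem lft_fst (f : Mor R [a] [a]) : lft (fst a f) = strand₁ f :=
  whisk_whisk _ _ _ _ _ rfl rfl rfl rfl
theorem lft_snd (f : Mor R [a] [a]) : lft (snd a f) = strand₂ f :=
  whisk_whisk _ _ _ _ _ rfl rfl rfl rfl
theorem rgt_fst (f : Mor R [a] [a]) : rgt (fst a f) = strand₂ f :=
  whisk_whisk _ _ _ _ _ rfl rfl rfl rfl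
theorem rgt_snd (f : Mor R [a] [a]) : rgt (snd a f) = strand₃ f :=
  whisk_whisk _ _ _ _ _ rfl rfl rfl rfl

theorem lft_strand₃ (s : Mor R [a, a] [a, a]) (f : Mor R [a] [a]) :
    lft s≫ᵥstrand₃ f = strand₃ f≫ᵥlft s :=
  whisk_swap (M := []) s f rfl rfl rfl rfl rfl rfl rfl rfl
theorem rgt_strand₁ (s : Mor R [a, a] [a, a]) (f : Mor R [a] [a]) :
    rgt s≫ᵥstrand₁ f = strand₁ f≫ᵥrgt s :=
  Eq.symm (whisk_swap (M := []) f s rfl rfl rfl rfl rfl rfl rfl rfl)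
theorem strand₂_strand₁ (f g : Mor R [a] [a]) : strand₂ f≫ᵥstrand₁ g = strand₁ g≫ᵥstrand₂ f :=
  Eq.symm (whisk_swap (M := []) g f rfl rfl rfl rfl rfl rfl rfl rfl)
theorem strand₃_strand₁ (f g : Mor R [a] [a]) : strand₃ f≫ᵥstrand₁ g = strand₁ g≫ᵥstrand₃ f :=
  Eq.symm (whisk_swap (M := [a]) g f rfl rfl rfl rfl rfl rfl rfl rfl)
theorem strand₃_strand₂ (f g : Mor R [a] [a]) : strand₃ f≫ᵥstrand₂ g = strand₂ g≫ᵥstrand₃ f :=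
  Eq.symm (whisk_swap (M := []) g f rfl rfl rfl rfl rfl rfl rfl rfl)

theorem hcomp_lft (s : Mor R [a, a] [a, a]) (f : Mor R [a] [a]) :
    (hcomp s f rfl rfl : Mor R [a, a, a] [a, a, a]) = lft s≫ᵥstrand₃ f :=
  hcomp_eq_whisk s f rfl rfl
theorem hcomp_rgt (s : Mor R [a, a] [a, a]) (f : Mor R [a] [a]) :
    (hcomp f s rfl rfl : Mor R [a, a, a] [a, a, a]) = strand₁ f≫ᵥrgt s :=
  hcomp_eq_whisk f s rfl rfl

section slide

variable {s : Mor R [a, a] [a, a]} {f : Mor R [a] [a]}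

theorem lft_strand₁ (hf : snd a f≫ᵥs = s≫ᵥfst a f) :
    lft s≫ᵥstrand₁ f = strand₂ f≫ᵥlft s := by
  rw [← lft_fst, ← lft_snd, ← lft_vcomp, ← lft_vcomp, hf]
theorem lft_strand₂ (hf : fst a f≫ᵥs = s≫ᵥsnd a f) :
    lft s≫ᵥstrand₂ f = strand₁ f≫ᵥlft s := by
  rw [← lft_fst, ← lft_snd, ← lft_vcomp, ← lft_vcomp, hf]
theorem rgt_strand₂ (hf : snd a f≫ᵥs = s≫ᵥfst a f) :
    rgt s≫ᵥstrand₂ f = strand₃ f≫ᵥrgt s := by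
  rw [← rgt_fst, ← rgt_snd, ← rgt_vcomp, ← rgt_vcomp, hf]
theorem rgt_strand₃ (hf : fst a f≫ᵥs = s≫ᵥsnd a f) :
    rgt s≫ᵥstrand₃ f = strand₂ f≫ᵥrgt s := by
  rw [← rgt_fst, ← rgt_snd, ← rgt_vcomp, ← rgt_vcomp, hf]

variable {ι : Type z} {e : ι → Mor R [a] [a]}

/-- All the idempotents slide down to the bottom, where repeated copies on a strand merge and one
per strand remains, below an uncolored side of the braid relation. Together with its mirror
`colored_braid_right` this gives the colored relation from the plain one and, read backwards, the
plain one from the colored ones. -/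
theorem colored_braid_left (he : ∀ i, e i≫ᵥe i = e i)
    (hf : ∀ i, fst a (e i)≫ᵥs = s≫ᵥsnd a (e i)) (hs : ∀ i, snd a (e i)≫ᵥs = s≫ᵥfst a (e i))
    (i j l : ι) :
    (lft (fst a (e i)≫ᵥsnd a (e j)≫ᵥs)≫ᵥstrand₃ (e l))≫ᵥ
      (strand₁ (e j)≫ᵥrgt (fst a (e i)≫ᵥsnd a (e l)≫ᵥs))≫ᵥ
      (lft (fst a (e j)≫ᵥsnd a (e l)≫ᵥs)≫ᵥstrand₃ (e i)) =
    strand₁ (e i)≫ᵥstrand₂ (e j)≫ᵥstrand₃ (e l)≫ᵥlft s≫ᵥrgt s≫ᵥlft s := by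
  have l₁ := fun i => lft_strand₁ (hs i)
  have l₂ := fun i => lft_strand₂ (hf i)
  have r₂ := fun i => rgt_strand₂ (hs i)
  have r₃ := fun i => rgt_strand₃ (hf i)
  have e₁ : ∀ i, strand₁ (e i)≫ᵥstrand₁ (e i) = strand₁ (e i) := fun i => by
    rw [← strand₁_vcomp, he]
  have e₂ : ∀ i, strand₂ (e i)≫ᵥstrand₂ (e i) = strand₂ (e i) := fun i => by
    rw [← strand₂_vcomp, he]
  have e₃ : ∀ i, strand₃ (e i)≫ᵥstrand₃ (e i) = strand₃ (e i) := fun i => by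
    rw [← strand₃_vcomp, he]
  simp only [lft_vcomp, rgt_vcomp, lft_fst, lft_snd, rgt_fst, rgt_snd, vcomp_assoc,
    lft_strand₃,
    vcomp_eq_assoc (lft_strand₃ _ _), vcomp_eq_assoc (rgt_strand₁ _ _),
    vcomp_eq_assoc (l₁ _), vcomp_eq_assoc (l₂ _), vcomp_eq_assoc (r₂ _), vcomp_eq_assoc (r₃ _),
    vcomp_eq_assoc (strand₂_strand₁ _ _), vcomp_eq_assoc (strand₃_strand₁ _ _),
    vcomp_eq_assoc (strand₃_strand₂ _ _), vcomp_eq_assoc' (e₁ _), vcomp_eq_assoc' (e₂ _),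
    vcomp_eq_assoc' (e₃ _)]

theorem colored_braid_right (he : ∀ i, e i≫ᵥe i = e i)
    (hf : ∀ i, fst a (e i)≫ᵥs = s≫ᵥsnd a (e i)) (hs : ∀ i, snd a (e i)≫ᵥs = s≫ᵥfst a (e i))
    (i j l : ι) :
    (strand₁ (e i)≫ᵥrgt (fst a (e j)≫ᵥsnd a (e l)≫ᵥs))≫ᵥ
      (lft (fst a (e i)≫ᵥsnd a (e l)≫ᵥs)≫ᵥstrand₃ (e j))≫ᵥ
      (strand₁ (e l)≫ᵥrgt (fst a (e i)≫ᵥsnd a (e j)≫ᵥs)) =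
    strand₁ (e i)≫ᵥstrand₂ (e j)≫ᵥstrand₃ (e l)≫ᵥrgt s≫ᵥlft s≫ᵥrgt s := by
  have l₁ := fun i => lft_strand₁ (hs i)
  have l₂ := fun i => lft_strand₂ (hf i)
  have r₂ := fun i => rgt_strand₂ (hs i)
  have r₃ := fun i => rgt_strand₃ (hf i)
  have e₁ : ∀ i, strand₁ (e i)≫ᵥstrand₁ (e i) = strand₁ (e i) := fun i => by
    rw [← strand₁_vcomp, he]
  have e₂ : ∀ i, strand₂ (e i)≫ᵥstrand₂ (e i) = strand₂ (e i) := fun i => by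
    rw [← strand₂_vcomp, he]
  have e₃ : ∀ i, strand₃ (e i)≫ᵥstrand₃ (e i) = strand₃ (e i) := fun i => by
    rw [← strand₃_vcomp, he]
  simp only [lft_vcomp, rgt_vcomp, lft_fst, lft_snd, rgt_fst, rgt_snd, vcomp_assoc,
    lft_strand₃,
    vcomp_eq_assoc (lft_strand₃ _ _), vcomp_eq_assoc (rgt_strand₁ _ _),
    vcomp_eq_assoc (l₁ _), vcomp_eq_assoc (l₂ _), vcomp_eq_assoc (r₂ _), vcomp_eq_assoc (r₃ _),
    vcomp_eq_assoc (strand₂_strand₁ _ _), vcomp_eq_assoc (strand₃_strand₁ _ _),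
    vcomp_eq_assoc (strand₃_strand₂ _ _), vcomp_eq_assoc' (e₁ _), vcomp_eq_assoc' (e₂ _),
    vcomp_eq_assoc' (e₃ _)]

end slide
end Presented

/-! ### Consequences of the relations in the Frobenius Heisenberg category -/

namespace Heis

open Presented

variable {k : Type u} [CommRing k] {F : Type v} [Ring F] [Algebra k F]
  {ι : Type w} [Fintype ι] {φ : FrobeniusTrace k F} {B : Module.Basis ι k F} {l : ℤ}

local notation "⟪" t "⟫" => cls (R := R φ B l) t

theorem cls_tok_one : ⟪tok 1⟫ = one [up] := cls_sound (.of .tok_one)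
theorem cls_tok_mul (f g : F) : ⟪tok (f * g)⟫ = ⟪tok g⟫≫ᵥ⟪tok f⟫ := cls_sound (.of (.tok_mul f g))
theorem cls_tok_add (f g : F) : ⟪tok (f + g)⟫ = ⟪tok f⟫ + ⟪tok g⟫ := cls_sound (.of (.tok_add f g))
theorem cls_tok_smul (a : k) (f : F) : ⟪tok (a • f)⟫ = a • ⟪tok f⟫ :=
  cls_sound (.of (.tok_smul a f))

/-- Tokens as a linear map. -/
def tokLin : F →ₗ[k] Mor (R φ B l) [up] [up] where
  toFun f := ⟪tok f⟫
  map_add' := cls_tok_add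
  map_smul' := cls_tok_smul

theorem cls_tok_zero : ⟪tok 0⟫ = 0 := map_zero (tokLin (φ := φ) (B := B) (l := l))
theorem cls_tok_sum {α : Type z} (s : Finset α) (f : α → F) :
    ⟪tok (∑ i ∈ s, f i)⟫ = ∑ i ∈ s, ⟪tok (f i)⟫ := map_sum (tokLin (φ := φ) (B := B) (l := l)) f s

theorem cls_s_s : ⟪s⟫≫ᵥ⟪s⟫ = one [up, up] := by
  have h : ⟪s⟫≫ᵥ⟪s⟫ = two (one [up]) (one [up]) := cls_sound (.of .s_s)
  simpa [two_eq] using h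

theorem fst_tok_s (f : F) : fst up ⟪tok f⟫≫ᵥ⟪s⟫ = ⟪s⟫≫ᵥsnd up ⟪tok f⟫ := by
  have h : two ⟪tok f⟫ (one [up])≫ᵥ⟪s⟫ = ⟪s⟫≫ᵥtwo (one [up]) ⟪tok f⟫ :=
    cls_sound (.of (.tok_s f))
  simpa [two_eq] using h

/-- The relation only moves tokens off the first strand; composing it with `s` below and above and
using `s² = 1` gives the other strand. -/
theorem snd_tok_s (f : F) : snd up ⟪tok f⟫≫ᵥ⟪s⟫ = ⟪s⟫≫ᵥfst up ⟪tok f⟫ := by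
  have h := congrArg (fun g => ⟪s⟫≫ᵥg≫ᵥ⟪s⟫) (fst_tok_s (φ := φ) (B := B) (l := l) f)
  simp only [vcomp_assoc, cls_s_s, vcomp_one, vcomp_eq_assoc' cls_s_s, one_vcomp] at h
  exact h.symm

theorem cls_braid : lft ⟪s⟫≫ᵥrgt ⟪s⟫≫ᵥlft ⟪s⟫ = rgt ⟪s⟫≫ᵥlft ⟪s⟫≫ᵥrgt ⟪s⟫ := by
  have h : (hcomp ⟪s⟫ (one [up]) rfl rfl : Mor (R φ B l) [up, up, up] [up, up, up])≫ᵥ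
      (hcomp (one [up]) ⟪s⟫ rfl rfl : Mor (R φ B l) [up, up, up] [up, up, up])≫ᵥ
      (hcomp ⟪s⟫ (one [up]) rfl rfl : Mor (R φ B l) [up, up, up] [up, up, up]) =
      (hcomp (one [up]) ⟪s⟫ rfl rfl : Mor (R φ B l) [up, up, up] [up, up, up])≫ᵥ
      (hcomp ⟪s⟫ (one [up]) rfl rfl : Mor (R φ B l) [up, up, up] [up, up, up])≫ᵥ
      (hcomp (one [up]) ⟪s⟫ rfl rfl : Mor (R φ B l) [up, up, up] [up, up, up]) :=
    cls_sound (.of .braid)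
  simpa only [hcomp_lft, hcomp_rgt, strand₁_one, strand₃_one, one_vcomp, vcomp_one] using h

theorem x_tok (f : F) : ⟪x⟫≫ᵥ⟪tok f⟫ = ⟪tok f⟫≫ᵥ⟪x⟫ := cls_sound (.of (.x_tok f))

theorem pow_x_tok (f : F) (r : ℕ) : ⟪x.pow r⟫≫ᵥ⟪tok f⟫ = ⟪tok f⟫≫ᵥ⟪x.pow r⟫ := by
  induction r with
  | zero => simp only [Term.pow, cls_id, one_vcomp, vcomp_one]
  | succ r ih =>
    rw [Term.pow, cls_comp, vcomp_assoc, x_tok, vcomp_eq_assoc ih]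

theorem s_fst_x : ⟪s⟫≫ᵥfst up ⟪x⟫ = snd up ⟪x⟫≫ᵥ⟪s⟫ +
    ∑ b, fst up ⟪tok (φ.dual B b)⟫≫ᵥsnd up ⟪tok (B b)⟫ := by
  have h : ⟪s⟫≫ᵥtwo ⟪x⟫ (one [up]) = two (one [up]) ⟪x⟫≫ᵥ⟪s⟫ +
      cls (Term.sum fun b => tok (φ.dual B b)⊠tok (B b)) := cls_sound (.of .x_s)
  rw [cls_sum] at h
  simp only [two_eq, snd_one, vcomp_one, fst_one, one_vcomp] at h
  rw [h]
  congr 1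
  exact Finset.sum_congr rfl fun b _ => two_eq ⟪tok (φ.dual B b)⟫ ⟪tok (B b)⟫

theorem cls_zigzag : zigzag ⟪c⟫ ⟪d⟫ = one [up] :=
  (hcomp_zigzag ⟪c⟫ ⟪d⟫).symm.trans (cls_sound (.of .zigzag_up))

theorem cls_mate_one : mate ⟪c⟫ (one [up]) ⟪d⟫ = one [down] :=
  (hcomp_mate_one ⟪c⟫ ⟪d⟫).symm.trans (cls_sound (.of .zigzag_down))

theorem cls_tokDown (f : F) : ⟪tokDown f⟫ = mate ⟪c⟫ ⟪tok f⟫ ⟪d⟫ := hcomp_mate ⟪c⟫ ⟪d⟫ ⟪tok f⟫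

theorem cls_t : ⟪t⟫ = rotate ⟪c⟫ ⟪s⟫ ⟪d⟫ := hcomp_rotate ⟪c⟫ ⟪s⟫ ⟪d⟫

theorem c_fst_tokDown (f : F) : ⟪c⟫≫ᵥfst up ⟪tokDown f⟫ = ⟪c⟫≫ᵥsnd down ⟪tok f⟫ := by
  rw [cls_tokDown, cup_fst_mate, cls_zigzag, vcomp_one]

theorem snd_tokDown_d (f : F) : snd up ⟪tokDown f⟫≫ᵥ⟪d⟫ = fst down ⟪tok f⟫≫ᵥ⟪d⟫ := by
  rw [cls_tokDown, snd_mate_cap, cls_zigzag, one_vcomp]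

/-- Turning a strand upside down reverses the order of the tokens on it, so the multiplication order
is opposite to that of `cls_tok_mul`. -/
theorem tokDown_mul (f g : F) : ⟪tokDown (f * g)⟫ = ⟪tokDown f⟫≫ᵥ⟪tokDown g⟫ := by
  rw [cls_tokDown, cls_tok_mul, cls_tokDown f, ← mate_cup_fst, c_fst_tokDown, mate_cup_snd]

theorem tokDown_one : ⟪tokDown 1⟫ = one [down] := by
  rw [cls_tokDown, cls_tok_one, cls_mate_one]

/-- Tokens on downward strands as a linear map. -/
def tokDownLin : F →ₗ[k] Mor (R φ B l) [down] [down] where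
  toFun f := ⟪tokDown f⟫
  map_add' f g := by simp only [cls_tokDown, cls_tok_add, mate_add]
  map_smul' a f := by simp only [cls_tokDown, cls_tok_smul, mate_smul, RingHom.id_apply]

theorem tokDown_zero : ⟪tokDown 0⟫ = 0 := map_zero (tokDownLin (φ := φ) (B := B) (l := l))
theorem tokDown_sum {α : Type z} (s : Finset α) (f : α → F) :
    ⟪tokDown (∑ i ∈ s, f i)⟫ = ∑ i ∈ s, ⟪tokDown (f i)⟫ :=
  map_sum (tokDownLin (φ := φ) (B := B) (l := l)) f s

theorem t_snd_tok (f : F) : ⟪t⟫≫ᵥsnd down ⟪tok f⟫ = fst down ⟪tok f⟫≫ᵥ⟪t⟫ := by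
  rw [cls_t, rotate_snd, fst_rotate, snd_tok_s]

/-- The token follows the downward strand of `t` backwards from its upper end: through the cup,
along the upward strand through `s`, and through the cap to the lower end. -/
theorem t_fst_tokDown (f : F) : ⟪t⟫≫ᵥfst up ⟪tokDown f⟫ = snd up ⟪tokDown f⟫≫ᵥ⟪t⟫ := by
  rw [cls_t, ← rotate_cup_fst, c_fst_tokDown, rotate_cup_snd, fst_tok_s, snd_rotate,
    snd_tokDown_d, rotate_fst_cap]

theorem cls_rcap (r : ℕ) (f : F) :
    ⟪rcap r f⟫ = fst down ⟪tok f⟫≫ᵥfst down ⟪x.pow r⟫≫ᵥ⟪d⟫ := by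
  have h : ⟪rcap r f⟫ = two (⟪tok f⟫≫ᵥ⟪x.pow r⟫) (one [down])≫ᵥ⟪d⟫ := rfl
  rw [h, two_eq, snd_one, vcomp_one, fst_vcomp, vcomp_assoc]

theorem cls_rcup (r : ℕ) (f : F) :
    ⟪rcup r f⟫ = ⟪c⟫≫ᵥsnd down ⟪tok f⟫≫ᵥsnd down ⟪x.pow r⟫ := by
  have h : ⟪rcup r f⟫ = ⟪c⟫≫ᵥtwo (one [down]) (⟪tok f⟫≫ᵥ⟪x.pow r⟫) := rfl
  rw [h, two_eq, fst_one, one_vcomp, snd_vcomp]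

/-- Right caps as a linear function of the token. -/
def rcapLin (r : ℕ) : F →ₗ[k] Mor (R φ B l) [up, down] [] where
  toFun f := ⟪rcap r f⟫
  map_add' f g := by simp only [cls_rcap, cls_tok_add, fst_add, add_vcomp]
  map_smul' a f := by simp only [cls_rcap, cls_tok_smul, fst_smul, smul_vcomp, RingHom.id_apply]

/-- Right cups as a linear function of the token. -/
def rcupLin (r : ℕ) : F →ₗ[k] Mor (R φ B l) [] [down, up] where
  toFun f := ⟪rcup r f⟫
  map_add' f g := by simp only [cls_rcup, cls_tok_add, snd_add, add_vcomp, vcomp_add]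
  map_smul' a f := by
    simp only [cls_rcup, cls_tok_smul, snd_smul, smul_vcomp, vcomp_smul, RingHom.id_apply]

theorem rcap_zero (r : ℕ) : ⟪rcap r 0⟫ = 0 := map_zero (rcapLin (φ := φ) (B := B) (l := l) r)
theorem rcup_zero (r : ℕ) : ⟪rcup r 0⟫ = 0 := map_zero (rcupLin (φ := φ) (B := B) (l := l) r)

theorem fst_tok_rcap (r : ℕ) (f g : F) :
    fst down ⟪tok g⟫≫ᵥ⟪rcap r f⟫ = ⟪rcap r (f * g)⟫ := by
  rw [cls_rcap, cls_rcap, cls_tok_mul, fst_vcomp, vcomp_assoc]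

theorem snd_tokDown_rcap (r : ℕ) (f g : F) :
    snd up ⟪tokDown g⟫≫ᵥ⟪rcap r f⟫ = ⟪rcap r (g * f)⟫ := by
  rw [cls_rcap, cls_rcap, cls_tok_mul, fst_vcomp, vcomp_assoc, snd_fst_assoc, snd_fst_assoc,
    snd_tokDown_d, vcomp_eq_assoc (f := fst down ⟪x.pow r⟫)]
  rw [← fst_vcomp, ← fst_vcomp, pow_x_tok]

theorem rcup_snd_tok (r : ℕ) (f g : F) :
    ⟪rcup r f⟫≫ᵥsnd down ⟪tok g⟫ = ⟪rcup r (g * f)⟫ := by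
  rw [cls_rcup, cls_rcup, cls_tok_mul, snd_vcomp, vcomp_assoc, vcomp_assoc, vcomp_assoc,
    ← snd_vcomp, pow_x_tok, snd_vcomp]

theorem rcup_fst_tokDown (r : ℕ) (f g : F) :
    ⟪rcup r f⟫≫ᵥfst up ⟪tokDown g⟫ = ⟪rcup r (f * g)⟫ := by
  rw [cls_rcup, cls_rcup, cls_tok_mul, snd_vcomp, vcomp_assoc, vcomp_assoc, vcomp_assoc,
    snd_fst, snd_fst_assoc, vcomp_eq_assoc (c_fst_tokDown g)]

theorem up_down : one [up, down] = ⟪t⟫≫ᵥ⟪tl⟫ + ∑ r : Fin l.toNat, ∑ b,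
    ⟪rcap r (φ.dual B b)⟫≫ᵥ⟪cup r b⟫ := by
  have h : two (one [up]) (one [down]) = ⟪t⟫≫ᵥ⟪tl⟫ + cls (Term.sum fun r : Fin l.toNat =>
      Term.sum fun b => rcap r (φ.dual B b)⨟cup r b) := cls_sound (.of .up_down)
  simpa only [two_eq, fst_one, snd_one, vcomp_one, cls_sum, cls_comp] using h

theorem down_up : one [down, up] = ⟪tl⟫≫ᵥ⟪t⟫ + ∑ r : Fin (-l).toNat, ∑ b,
    ⟪cap r b⟫≫ᵥ⟪rcup r (φ.dual B b)⟫ := by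
  have h : two (one [down]) (one [up]) = ⟪tl⟫≫ᵥ⟪t⟫ + cls (Term.sum fun r : Fin (-l).toNat =>
      Term.sum fun b => cap r b⨟rcup r (φ.dual B b)) := cls_sound (.of .down_up)
  simpa only [two_eq, fst_one, snd_one, vcomp_one, cls_sum, cls_comp] using h

theorem cup_t (r : Fin l.toNat) (b : ι) : ⟪cup r b⟫≫ᵥ⟪t⟫ = 0 := cls_sound (.of (.cup_t r b))
theorem t_cap (r : Fin (-l).toNat) (b : ι) : ⟪t⟫≫ᵥ⟪cap r b⟫ = 0 := cls_sound (.of (.t_cap r b))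

theorem cup_rcap [DecidableEq ι] (r r' : Fin l.toNat) (b b' : ι) :
    ⟪cup r b⟫≫ᵥ⟪rcap r' (φ.dual B b')⟫ = if (r, b) = (r', b') then one [] else 0 := by
  split_ifs with h
  · obtain ⟨rfl, rfl⟩ := Prod.mk.inj h
    exact cls_sound (.of (.cup_rcap r b))
  · exact cls_sound (.of (.cup_rcap_ne r r' b b' h))

theorem rcup_cap [DecidableEq ι] (r r' : Fin (-l).toNat) (b b' : ι) :
    ⟪rcup r (φ.dual B b)⟫≫ᵥ⟪cap r' b'⟫ = if (r, b) = (r', b') then one [] else 0 := by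
  split_ifs with h
  · obtain ⟨rfl, rfl⟩ := Prod.mk.inj h
    exact cls_sound (.of (.rcup_cap r b))
  · exact cls_sound (.of (.rcup_cap_ne r r' b b' h))

/-- Expansion in the dual basis. The vanishing relations for `tl` mention only the labels `φ.dual B
b`, while sliding tokens into a right cup or cap produces arbitrary labels. -/
theorem sum_tr_smul_dual (f : F) : ∑ b, φ.tr (f * B b) • φ.dual B b = f := by
  classical
  apply φ.perfect.1
  refine B.ext fun b => ?_
  simp only [LinearMap.comp_apply, LinearMap.mulLeft_apply, Finset.sum_mul, map_sum,
    smul_mul_assoc, map_smul, FrobeniusTrace.tr_dual_mul, smul_eq_mul, mul_ite, mul_one, mul_zero,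
    Finset.sum_ite_eq', Finset.mem_univ, if_true]

theorem tl_rcap (r : Fin l.toNat) (f : F) : ⟪tl⟫≫ᵥ⟪rcap r f⟫ = 0 := by
  have h : ⟪rcap r f⟫ = ∑ b, φ.tr (f * B b) • ⟪rcap r (φ.dual B b)⟫ := by
    conv_lhs => rw [← sum_tr_smul_dual (φ := φ) (B := B) f]
    change rcapLin (r : ℕ) _ = _
    simp only [map_sum, map_smul]
    rfl
  rw [h, vcomp_sum]
  refine Finset.sum_eq_zero fun b _ => ?_
  rw [vcomp_smul, show ⟪tl⟫≫ᵥ⟪rcap r (φ.dual B b)⟫ = 0 from cls_sound (.of (.tl_rcap r b)),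
    smul_zero]

theorem rcup_tl (r : Fin (-l).toNat) (f : F) : ⟪rcup r f⟫≫ᵥ⟪tl⟫ = 0 := by
  have h : ⟪rcup r f⟫ = ∑ b, φ.tr (f * B b) • ⟪rcup r (φ.dual B b)⟫ := by
    conv_lhs => rw [← sum_tr_smul_dual (φ := φ) (B := B) f]
    change rcupLin (r : ℕ) _ = _
    simp only [map_sum, map_smul]
    rfl
  rw [h, sum_vcomp]
  refine Finset.sum_eq_zero fun b _ => ?_
  rw [smul_vcomp, show ⟪rcup r (φ.dual B b)⟫≫ᵥ⟪tl⟫ = 0 from cls_sound (.of (.rcup_tl r b)),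
    smul_zero]

/-- Two morphisms out of `X` are equal if their composites with all entries of the inversion
relation's column are. -/
theorem eq_of_vcomp_t {X : List Sgn} {f g : Mor (R φ B l) X [up, down]}
    (h : f≫ᵥ⟪t⟫ = g≫ᵥ⟪t⟫)
    (h' : ∀ (r : Fin l.toNat) b, f≫ᵥ⟪rcap r (φ.dual B b)⟫ = g≫ᵥ⟪rcap r (φ.dual B b)⟫) : f = g := by
  -- `up_down` factors the identity through `t` and the decorated right caps.
  rw [← vcomp_one f, ← vcomp_one g, up_down]
  simp only [vcomp_add, vcomp_sum, ← vcomp_assoc, h, h']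

/-- Two morphisms into `X` are equal if their composites with all entries of the inversion
relation's row are. -/
theorem eq_of_t_vcomp {X : List Sgn} {f g : Mor (R φ B l) [down, up] X}
    (h : ⟪t⟫≫ᵥf = ⟪t⟫≫ᵥg)
    (h' : ∀ (r : Fin (-l).toNat) b, ⟪rcup r (φ.dual B b)⟫≫ᵥf = ⟪rcup r (φ.dual B b)⟫≫ᵥg) :
    f = g := by
  rw [← one_vcomp f, ← one_vcomp g, down_up]
  simp only [add_vcomp, sum_vcomp, vcomp_assoc, h, h']

/-- Endomorphisms that slide through `t` and preserve the spaces of right cups and caps slide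
through `tl`. -/
theorem tl_slide (f : Mor (R φ B l) [down, up] [down, up]) (g : Mor (R φ B l) [up, down] [up, down])
    (h : ⟪t⟫≫ᵥf = g≫ᵥ⟪t⟫) (hcap : ∀ (r : ℕ) (a : F), ∃ a' : F, g≫ᵥ⟪rcap r a⟫ = ⟪rcap r a'⟫)
    (hcup : ∀ (r : ℕ) (a : F), ∃ a' : F, ⟪rcup r a⟫≫ᵥf = ⟪rcup r a'⟫) :
    ⟪tl⟫≫ᵥg = f≫ᵥ⟪tl⟫ := by
  -- For `0 ≤ l` there are no labels `Fin (-l).toNat` and `tl` followed by `t` is the identity; for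
  -- `l ≤ 0` there are no labels `Fin l.toNat` and `t` followed by `tl` is the identity. In the
  -- first case the two sides are compared above with the column, in the second below with the row.
  rcases le_total 0 l with hl | hl
  · have h₁ : ⟪tl⟫≫ᵥ⟪t⟫ = one [down, up] := by
      have : IsEmpty (Fin (-l).toNat) := by
        rw [Int.toNat_of_nonpos (by omega)]; infer_instance
      have h := down_up (φ := φ) (B := B) (l := l)
      rw [Fintype.sum_empty, add_zero] at h
      exact h.symm
    refine eq_of_vcomp_t ?_ fun r b => ?_
    · rw [vcomp_assoc, ← h, vcomp_eq_assoc' h₁, vcomp_assoc, h₁, one_vcomp, vcomp_one]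
    -- Both sides vanish here: `g` turns a right cap into a right cap with the same number of dots,
    -- and `tl` kills that for every label.
    · obtain ⟨a, ha⟩ := hcap r (φ.dual B b)
      rw [vcomp_assoc, ha, tl_rcap, vcomp_assoc, tl_rcap, vcomp_zero]
  · have h₁ : ⟪t⟫≫ᵥ⟪tl⟫ = one [up, down] := by
      have : IsEmpty (Fin l.toNat) := by
        rw [Int.toNat_of_nonpos hl]; infer_instance
      have h := up_down (φ := φ) (B := B) (l := l)
      rw [Fintype.sum_empty, add_zero] at h
      exact h.symm
    refine eq_of_t_vcomp ?_ fun r b => ?_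
    · rw [vcomp_eq_assoc h, h₁, vcomp_one, vcomp_eq_assoc' h₁, one_vcomp]
    · obtain ⟨a, ha⟩ := hcup r (φ.dual B b)
      rw [vcomp_eq_assoc' ha, rcup_tl, vcomp_eq_assoc' (rcup_tl r _), zero_vcomp]

theorem tl_fst_tok (f : F) : ⟪tl⟫≫ᵥfst down ⟪tok f⟫ = snd down ⟪tok f⟫≫ᵥ⟪tl⟫ :=
  tl_slide _ _ (t_snd_tok f) (fun r a => ⟨_, fst_tok_rcap r a f⟩)
    (fun r a => ⟨_, rcup_snd_tok r a f⟩)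

theorem tl_snd_tokDown (f : F) : ⟪tl⟫≫ᵥsnd up ⟪tokDown f⟫ = fst up ⟪tokDown f⟫≫ᵥ⟪tl⟫ :=
  tl_slide _ _ (t_fst_tokDown f) (fun r a => ⟨_, snd_tokDown_rcap r a f⟩)
    (fun r a => ⟨_, rcup_fst_tokDown r a f⟩)

end Heis

/-! ### Colored morphisms satisfy the colored relations -/

theorem FrobeniusTrace.dual_unique {k : Type u} [CommRing k] {A : Type v} [Ring A] [Algebra k A]
    (φ : FrobeniusTrace k A) {ι : Type w} [DecidableEq ι] (B : Module.Basis ι k A) (a : ι) (x : A)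
    (h : ∀ b, φ.tr (x * B b) = if a = b then 1 else 0) : φ.dual B a = x := by
  apply φ.perfect.1
  refine B.ext fun b => ?_
  simp only [LinearMap.comp_apply, LinearMap.mulLeft_apply, tr_dual_mul, h]

/-- The factors are orthogonal for the summed trace, so the dual vector computed in the `i`th factor
pairs to zero with the basis vectors of all other factors. -/
theorem FrobeniusTrace.pi_dual {k : Type u} [CommRing k] {n : ℕ} {F : Fin n → Type v}
    [∀ i, Ring (F i)] [∀ i, Algebra k (F i)] {ι : Fin n → Type w} [∀ i, Fintype (ι i)]
    (φ : ∀ i, FrobeniusTrace k (F i)) (B : ∀ i, Module.Basis (ι i) k (F i)) (i : Fin n) (b : ι i) :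
    (FrobeniusTrace.pi φ).dual (Pi.basis B) ⟨i, b⟩ = Pi.single i ((φ i).dual (B i) b) := by
  classical
  refine dual_unique _ _ _ _ ?_
  rintro ⟨j, b'⟩
  have h : (FrobeniusTrace.pi φ).tr (Pi.single i ((φ i).dual (B i) b) * Pi.basis B ⟨j, b'⟩) =
      ∑ m, (φ m).tr (Pi.single (M := F) i ((φ i).dual (B i) b) m * Pi.single j (B j b') m) := by
    rw [Pi.basis_apply]
    simp [FrobeniusTrace.pi]
  rw [h, Finset.sum_eq_single i]
  · rcases eq_or_ne i j with rfl | hij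
    · simp [tr_dual_mul]
    · rw [Pi.single_eq_of_ne hij, mul_zero, map_zero, if_neg]
      intro h
      exact hij (congrArg Sigma.fst h)
  · intro m _ hm
    rw [Pi.single_eq_of_ne hm, zero_mul, map_zero]
  · simp

namespace Heis

open Presented

variable {k : Type u} [CommRing k] {n : ℕ} {F : Fin n → Type v} [∀ i, Ring (F i)]
  [∀ i, Algebra k (F i)] {ι : Fin n → Type w} [∀ i, Fintype (ι i)]
  {φ : ∀ i, FrobeniusTrace k (F i)} {B : ∀ i, Module.Basis (ι i) k (F i)} {l : ℤ}

/-! ### The color idempotents and their action on cups and caps. -/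

section e

theorem e_mul_single (i : Fin n) (f : F i) : e i * Pi.single i f = Pi.single i f := by
  rw [e, ← Pi.single_mul, one_mul]
theorem single_mul_e (i : Fin n) (f : F i) : Pi.single i f * e i = Pi.single i f := by
  rw [e, ← Pi.single_mul, mul_one]
theorem single_mul_single_ne {i j : Fin n} (h : i ≠ j) (f : F i) (g : F j) :
    (Pi.single i f * Pi.single j g : ∀ m, F m) = 0 := by
  funext m
  rcases eq_or_ne m i with rfl | hm
  · simp [Pi.single_eq_of_ne h]
  · simp [Pi.single_eq_of_ne hm]
theorem e_mul_single_ne {i j : Fin n} (h : i ≠ j) (f : F j) :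
    (e i * Pi.single j f : ∀ m, F m) = 0 := single_mul_single_ne h _ _
theorem single_mul_e_ne {i j : Fin n} (h : i ≠ j) (f : F i) :
    (Pi.single i f * e j : ∀ m, F m) = 0 := single_mul_single_ne h _ _
theorem e_mul_e (i : Fin n) : (e i * e i : ∀ m, F m) = e i := e_mul_single i 1
theorem sum_e : (∑ i, e i : ∀ m, F m) = 1 := by
  funext m
  simp [e, Finset.sum_apply]

end e

local notation "⟪" t "⟫" => cls (R := R (FrobeniusTrace.pi φ) (Pi.basis B) l) t

theorem tok_e_tok_e (i : Fin n) : ⟪tok (e i)⟫≫ᵥ⟪tok (e i)⟫ = ⟪tok (e i)⟫ := by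
  rw [← cls_tok_mul, e_mul_e]
theorem tok_e_tok_e_ne {i j : Fin n} (h : i ≠ j) : ⟪tok (e i)⟫≫ᵥ⟪tok (e j)⟫ = 0 := by
  rw [← cls_tok_mul, e, e, single_mul_single_ne h.symm, cls_tok_zero]
theorem tokDown_e_tokDown_e (i : Fin n) :
    ⟪tokDown (e i)⟫≫ᵥ⟪tokDown (e i)⟫ = ⟪tokDown (e i)⟫ := by
  rw [← tokDown_mul, e_mul_e]
theorem tokDown_e_tokDown_e_ne {i j : Fin n} (h : i ≠ j) :
    ⟪tokDown (e i)⟫≫ᵥ⟪tokDown (e j)⟫ = 0 := by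
  rw [← tokDown_mul, e, e, single_mul_single_ne h, tokDown_zero]

theorem tok_e_tok_single (i : Fin n) (f : F i) :
    ⟪tok (e i)⟫≫ᵥ⟪tok (Pi.single i f)⟫ = ⟪tok (Pi.single i f)⟫ := by
  rw [← cls_tok_mul, single_mul_e]
theorem tok_single_tok_e (i : Fin n) (f : F i) :
    ⟪tok (Pi.single i f)⟫≫ᵥ⟪tok (e i)⟫ = ⟪tok (Pi.single i f)⟫ := by
  rw [← cls_tok_mul, e_mul_single]
theorem tok_e_tok_single_ne {i j : Fin n} (h : i ≠ j) (f : F j) :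
    ⟪tok (e i)⟫≫ᵥ⟪tok (Pi.single j f)⟫ = 0 := by
  rw [← cls_tok_mul, single_mul_e_ne h.symm, cls_tok_zero]

theorem fst_tok_e_rcap (i : Fin n) (r : ℕ) (f : F i) :
    fst down ⟪tok (e i)⟫≫ᵥ⟪rcap r (Pi.single i f)⟫ = ⟪rcap r (Pi.single i f)⟫ := by
  rw [fst_tok_rcap, single_mul_e]
theorem fst_tok_e_rcap_ne {i j : Fin n} (h : i ≠ j) (r : ℕ) (f : F j) :
    fst down ⟪tok (e i)⟫≫ᵥ⟪rcap r (Pi.single j f)⟫ = 0 := by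
  rw [fst_tok_rcap, single_mul_e_ne h.symm, rcap_zero]
theorem snd_tokDown_e_rcap (i : Fin n) (r : ℕ) (f : F i) :
    snd up ⟪tokDown (e i)⟫≫ᵥ⟪rcap r (Pi.single i f)⟫ = ⟪rcap r (Pi.single i f)⟫ := by
  rw [snd_tokDown_rcap, e_mul_single]
theorem snd_tokDown_e_rcap_ne {i j : Fin n} (h : i ≠ j) (r : ℕ) (f : F j) :
    snd up ⟪tokDown (e i)⟫≫ᵥ⟪rcap r (Pi.single j f)⟫ = 0 := by
  rw [snd_tokDown_rcap, e_mul_single_ne h, rcap_zero]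
theorem rcup_snd_tok_e (i : Fin n) (r : ℕ) (f : F i) :
    ⟪rcup r (Pi.single i f)⟫≫ᵥsnd down ⟪tok (e i)⟫ = ⟪rcup r (Pi.single i f)⟫ := by
  rw [rcup_snd_tok, e_mul_single]
theorem rcup_snd_tok_e_ne {i j : Fin n} (h : i ≠ j) (r : ℕ) (f : F j) :
    ⟪rcup r (Pi.single j f)⟫≫ᵥsnd down ⟪tok (e i)⟫ = 0 := by
  rw [rcup_snd_tok, e_mul_single_ne h, rcup_zero]
theorem rcup_fst_tokDown_e (i : Fin n) (r : ℕ) (f : F i) :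
    ⟪rcup r (Pi.single i f)⟫≫ᵥfst up ⟪tokDown (e i)⟫ = ⟪rcup r (Pi.single i f)⟫ := by
  rw [rcup_fst_tokDown, single_mul_e]
theorem rcup_fst_tokDown_e_ne {i j : Fin n} (h : i ≠ j) (r : ℕ) (f : F j) :
    ⟪rcup r (Pi.single j f)⟫≫ᵥfst up ⟪tokDown (e i)⟫ = 0 := by
  rw [rcup_fst_tokDown, single_mul_e_ne h.symm, rcup_zero]

/-- An adjoined cup is determined by its composites with the column. With `t` the token slides
through, and both sides are 0. With a right cap of color `j`, the idempotent is absorbed if `j = i`;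
if `j ≠ i`, it kills the cap, and the plain composite is already 0. The next three lemmas treat the
other leg of the cup and the two legs of the decorated left cap. -/
theorem cup_fst_tok_e (r : Fin l.toNat) (i : Fin n) (b : ι i) :
    ⟪cup r ⟨i, b⟩⟫≫ᵥfst down ⟪tok (e i)⟫ = ⟪cup r ⟨i, b⟩⟫ := by
  classical
  refine eq_of_vcomp_t ?_ ?_
  · rw [vcomp_assoc, ← t_snd_tok, vcomp_eq_assoc' (cup_t _ _), cup_t, zero_vcomp]
  · rintro r' ⟨j, b'⟩
    rcases eq_or_ne i j with rfl | h
    · rw [vcomp_assoc, FrobeniusTrace.pi_dual, fst_tok_e_rcap]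
    · rw [cup_rcap, vcomp_assoc, FrobeniusTrace.pi_dual, fst_tok_e_rcap_ne h, vcomp_zero, if_neg]
      simp [h]

theorem cup_snd_tokDown_e (r : Fin l.toNat) (i : Fin n) (b : ι i) :
    ⟪cup r ⟨i, b⟩⟫≫ᵥsnd up ⟪tokDown (e i)⟫ = ⟪cup r ⟨i, b⟩⟫ := by
  classical
  refine eq_of_vcomp_t ?_ ?_
  · rw [vcomp_assoc, ← t_fst_tokDown, vcomp_eq_assoc' (cup_t _ _), cup_t, zero_vcomp]
  · rintro r' ⟨j, b'⟩
    rcases eq_or_ne i j with rfl | h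
    · rw [vcomp_assoc, FrobeniusTrace.pi_dual, snd_tokDown_e_rcap]
    · rw [cup_rcap, vcomp_assoc, FrobeniusTrace.pi_dual, snd_tokDown_e_rcap_ne h, vcomp_zero,
        if_neg]
      simp [h]

theorem snd_tok_e_cap (r : Fin (-l).toNat) (i : Fin n) (b : ι i) :
    snd down ⟪tok (e i)⟫≫ᵥ⟪cap r ⟨i, b⟩⟫ = ⟪cap r ⟨i, b⟩⟫ := by
  classical
  refine eq_of_t_vcomp ?_ ?_
  · rw [vcomp_eq_assoc (t_snd_tok _), t_cap, vcomp_zero]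
  · rintro r' ⟨j, b'⟩
    rcases eq_or_ne i j with rfl | h
    · rw [FrobeniusTrace.pi_dual, vcomp_eq_assoc' (rcup_snd_tok_e _ _ _)]
    · rw [rcup_cap, FrobeniusTrace.pi_dual, vcomp_eq_assoc' (rcup_snd_tok_e_ne h _ _), zero_vcomp,
        if_neg]
      simp [h.symm]

theorem fst_tokDown_e_cap (r : Fin (-l).toNat) (i : Fin n) (b : ι i) :
    fst up ⟪tokDown (e i)⟫≫ᵥ⟪cap r ⟨i, b⟩⟫ = ⟪cap r ⟨i, b⟩⟫ := by
  classical
  refine eq_of_t_vcomp ?_ ?_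
  · rw [vcomp_eq_assoc (t_fst_tokDown _), t_cap, vcomp_zero]
  · rintro r' ⟨j, b'⟩
    rcases eq_or_ne i j with rfl | h
    · rw [FrobeniusTrace.pi_dual, vcomp_eq_assoc' (rcup_fst_tokDown_e _ _ _)]
    · rw [rcup_cap, FrobeniusTrace.pi_dual, vcomp_eq_assoc' (rcup_fst_tokDown_e_ne h _ _),
        zero_vcomp, if_neg]
      simp [h.symm]

/-- The colored morphisms of the Frobenius Heisenberg category of a direct sum, indexed by the
generators of the colored presentation. -/
def ofColGen {X Y : List Sgn} :
    ColHeis.Gen F ι l X Y → Term k (Gen (∀ j, F j) (Σ j, ι j) l) X Y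
  | .x i => colX i
  | .s i j => colS i j
  | .c i => colC i
  | .d i => colD i
  | .tok i f => tok (Pi.single i f)
  | .tl i j => colTl i j
  -- No idempotents are written: a left cup or cap with label from the `i`th basis has color `i`
  -- already. `cls_colCup` and `cls_colCap` reconcile this with the values demanded by the theorem.
  | .cup i r b => cup r ⟨i, b⟩
  | .cap i r b => cap r ⟨i, b⟩

theorem cls_colX (i : Fin n) : ⟪colX i⟫ = ⟪tok (e i)⟫≫ᵥ⟪x⟫ := rfl
theorem cls_colS (i j : Fin n) :
    ⟪colS i j⟫ = fst up ⟪tok (e i)⟫≫ᵥsnd up ⟪tok (e j)⟫≫ᵥ⟪s⟫ := by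
  have h : ⟪colS i j⟫ = two ⟪tok (e i)⟫ ⟪tok (e j)⟫≫ᵥ⟪s⟫ := rfl
  rw [h, two_eq, vcomp_assoc]
theorem cls_colC (i : Fin n) : ⟪colC i⟫ = ⟪c⟫≫ᵥfst up ⟪tokDown (e i)⟫ := by
  have h : ⟪colC i⟫ = ⟪c⟫≫ᵥtwo ⟪tokDown (e i)⟫ (one [up]) := rfl
  rw [h, two_eq, snd_one, vcomp_one]
theorem cls_colD (i : Fin n) : ⟪colD i⟫ = fst down ⟪tok (e i)⟫≫ᵥ⟪d⟫ := by
  have h : ⟪colD i⟫ = two ⟪tok (e i)⟫ (one [down])≫ᵥ⟪d⟫ := rfl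
  rw [h, two_eq, snd_one, vcomp_one]
theorem cls_colTl (i j : Fin n) :
    ⟪colTl i j⟫ = fst up ⟪tokDown (e i)⟫≫ᵥsnd down ⟪tok (e j)⟫≫ᵥ⟪tl⟫ := by
  have h : ⟪colTl i j⟫ = two (one [down]) ⟪tok (e j)⟫≫ᵥ⟪tl⟫≫ᵥtwo (one [up]) ⟪tokDown (e i)⟫ := rfl
  rw [h, two_eq, two_eq, fst_one, fst_one, one_vcomp, one_vcomp, tl_snd_tokDown, snd_fst_assoc]
-- The cup, crossing and cap in `colT i j` bring one idempotent on the upward strand and three on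
-- the downward strand. They slide to the lower ends and merge.
theorem cls_colT (i j : Fin n) :
    ⟪colT i j⟫ = fst down ⟪tok (e i)⟫≫ᵥsnd up ⟪tokDown (e j)⟫≫ᵥ⟪t⟫ := by
  have h : ⟪colT i j⟫ = rotate ⟪colC j⟫ ⟪colS j i⟫ ⟪colD j⟫ :=
    hcomp_rotate ⟪colC j⟫ ⟪colS j i⟫ ⟪colD j⟫
  rw [h, cls_colC, cls_colS, cls_colD, rotate_cup_fst, rotate_fst_cap, vcomp_assoc, vcomp_assoc,
    ← fst_tok_s, ← snd_fst_assoc, ← snd_fst_assoc, ← fst_rotate,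
    vcomp_eq_assoc' (f := fst up ⟪tok (e j)⟫) (g := fst up ⟪tok (e j)⟫)
      (by rw [← fst_vcomp, tok_e_tok_e]), fst_tok_s, ← rotate_fst_cap, ← snd_tokDown_d,
      ← snd_rotate, ← cls_t, vcomp_assoc, vcomp_assoc, t_fst_tokDown,
      vcomp_eq_assoc' (f := snd up ⟪tokDown (e j)⟫) (g := snd up ⟪tokDown (e j)⟫)
      (by rw [← snd_vcomp, tokDown_e_tokDown_e]), snd_fst_assoc]

theorem cls_lift_E (i : Fin n) : ⟪(ColHeis.E i).lift ofColGen⟫ = ⟪tok (e i)⟫ := rfl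
theorem cls_lift_D (i : Fin n) : ⟪(ColHeis.D i).lift ofColGen⟫ = ⟪tokDown (e i)⟫ := by
  have h : ⟪(ColHeis.D i).lift ofColGen⟫ = mate ⟪colC i⟫ ⟪tok (e i)⟫ ⟪colD i⟫ :=
    hcomp_mate ⟪colC i⟫ ⟪colD i⟫ ⟪tok (e i)⟫
  rw [h, cls_colC, cls_colD, mate_cup_fst, mate_fst_cap, tok_e_tok_e, ← cls_tokDown,
    tokDown_e_tokDown_e]

/-- The token is needed because the zeroth power of `colX i` is the uncolored strand. Next to it,
the idempotents in the other powers are absorbed. -/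
theorem tok_pow_colX (i : Fin n) (r : ℕ) (f : F i) :
    ⟪tok (Pi.single i f)⟫≫ᵥ⟪(colX i).pow r⟫ = ⟪tok (Pi.single i f)⟫≫ᵥ⟪x.pow r⟫ := by
  induction r with
  | zero => rfl
  | succ r ih =>
    rw [Term.pow, cls_comp, ← vcomp_assoc, ih, cls_colX, Term.pow, cls_comp, vcomp_assoc,
      vcomp_eq_assoc (pow_x_tok _ _), vcomp_eq_assoc' (tok_single_tok_e _ _)]

theorem cls_lift_rcap (i : Fin n) (r : ℕ) (f : F i) :
    ⟪(ColHeis.rcap i r f).lift ofColGen⟫ = ⟪rcap r (Pi.single i f)⟫ := by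
  have h : ⟪(ColHeis.rcap i r f).lift ofColGen⟫ =
    two (⟪tok (Pi.single i f)⟫≫ᵥ⟪((ColHeis.x i).pow r).lift ofColGen⟫) (one [down])≫ᵥ⟪colD i⟫ := rfl
  rw [h, Term.lift_pow]
  change two (⟪tok (Pi.single i f)⟫≫ᵥ⟪(colX i).pow r⟫) (one [down])≫ᵥ⟪colD i⟫ = _
  rw [tok_pow_colX, two_eq, snd_one, vcomp_one, cls_colD, ← vcomp_assoc, ← fst_vcomp,
    vcomp_assoc, pow_x_tok, vcomp_eq_assoc' (tok_single_tok_e _ _), fst_vcomp, vcomp_assoc,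
    cls_rcap]

theorem cls_lift_rcup (i : Fin n) (r : ℕ) (f : F i) :
    ⟪(ColHeis.rcup i r f).lift ofColGen⟫ = ⟪rcup r (Pi.single i f)⟫ := by
  have h : ⟪(ColHeis.rcup i r f).lift ofColGen⟫ =
    ⟪colC i⟫≫ᵥtwo (one [down]) (⟪tok (Pi.single i f)⟫≫ᵥ⟪((ColHeis.x i).pow r).lift ofColGen⟫) := rfl
  rw [h, Term.lift_pow]
  change ⟪colC i⟫≫ᵥtwo (one [down]) (⟪tok (Pi.single i f)⟫≫ᵥ⟪(colX i).pow r⟫) = _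
  rw [tok_pow_colX, two_eq, fst_one, one_vcomp, cls_colC, c_fst_tokDown, vcomp_assoc,
    ← snd_vcomp, vcomp_eq_assoc' (tok_e_tok_single _ _), snd_vcomp, cls_rcup]

end Heis

/-! ### Verification of the colored relations in the plain category. -/

namespace Heis

open Presented

variable {k : Type u} [CommRing k] {n : ℕ} {F : Fin n → Type v} [∀ i, Ring (F i)]
  [∀ i, Algebra k (F i)] {ι : Fin n → Type w} [∀ i, Fintype (ι i)]
  {φ : ∀ i, FrobeniusTrace k (F i)} {B : ∀ i, Module.Basis (ι i) k (F i)} {l : ℤ}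

local notation "⟪" t "⟫" => cls (R := R (FrobeniusTrace.pi φ) (Pi.basis B) l) t

section absorb

variable {q : Sgn} {X : List Sgn}

theorem fst_tok_e_fst_tok_e (i : Fin n) (f : Mor (R (.pi φ) (Pi.basis B) l) [up, q] X) :
    fst q ⟪tok (e i)⟫≫ᵥfst q ⟪tok (e i)⟫≫ᵥf = fst q ⟪tok (e i)⟫≫ᵥf :=
  vcomp_eq_assoc' (by rw [← fst_vcomp, tok_e_tok_e]) f
theorem snd_tok_e_snd_tok_e (i : Fin n) (f : Mor (R (.pi φ) (Pi.basis B) l) [q, up] X) :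
    snd q ⟪tok (e i)⟫≫ᵥsnd q ⟪tok (e i)⟫≫ᵥf = snd q ⟪tok (e i)⟫≫ᵥf :=
  vcomp_eq_assoc' (by rw [← snd_vcomp, tok_e_tok_e]) f
theorem fst_tokDown_e_fst_tokDown_e (i : Fin n)
    (f : Mor (R (.pi φ) (Pi.basis B) l) [down, q] X) :
    fst q ⟪tokDown (e i)⟫≫ᵥfst q ⟪tokDown (e i)⟫≫ᵥf = fst q ⟪tokDown (e i)⟫≫ᵥf :=
  vcomp_eq_assoc' (by rw [← fst_vcomp, tokDown_e_tokDown_e]) f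
theorem snd_tokDown_e_snd_tokDown_e (i : Fin n)
    (f : Mor (R (.pi φ) (Pi.basis B) l) [q, down] X) :
    snd q ⟪tokDown (e i)⟫≫ᵥsnd q ⟪tokDown (e i)⟫≫ᵥf = snd q ⟪tokDown (e i)⟫≫ᵥf :=
  vcomp_eq_assoc' (by rw [← snd_vcomp, tokDown_e_tokDown_e]) f

end absorb

theorem colS_absorb (i j : Fin n) : ⟪colS i j⟫≫ᵥfst up ⟪tok (e j)⟫≫ᵥsnd up ⟪tok (e i)⟫ =
    ⟪colS i j⟫ := by
  rw [cls_colS]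
  simp only [vcomp_assoc, vcomp_eq_assoc (snd_tok_s _).symm, (fst_tok_s _).symm, snd_fst_assoc,
    fst_tok_e_fst_tok_e, snd_tok_e_snd_tok_e]

theorem absorb_colS (i j : Fin n) : fst up ⟪tok (e i)⟫≫ᵥsnd up ⟪tok (e j)⟫≫ᵥ⟪colS i j⟫ =
    ⟪colS i j⟫ := by
  rw [cls_colS]
  simp only [snd_fst_assoc, fst_tok_e_fst_tok_e, snd_tok_e_snd_tok_e]

theorem colTl_absorb (i j : Fin n) : ⟪colTl i j⟫≫ᵥfst down ⟪tok (e j)⟫≫ᵥsnd up ⟪tokDown (e i)⟫ =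
    ⟪colTl i j⟫ := by
  rw [cls_colTl]
  simp only [vcomp_assoc, vcomp_eq_assoc (tl_fst_tok _), tl_snd_tokDown, snd_fst_assoc,
    fst_tokDown_e_fst_tokDown_e, snd_tok_e_snd_tok_e]

theorem absorb_colTl (i j : Fin n) : fst up ⟪tokDown (e i)⟫≫ᵥsnd down ⟪tok (e j)⟫≫ᵥ⟪colTl i j⟫ =
    ⟪colTl i j⟫ := by
  rw [cls_colTl]
  simp only [snd_fst_assoc, fst_tokDown_e_fst_tokDown_e, snd_tok_e_snd_tok_e]

/-- The inner colors match, so all idempotents can be collected at the bottom. What remains is the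
plain composite, to which the inversion relation applies. -/
theorem colT_colTl (i j : Fin n) : ⟪colT i j⟫≫ᵥ⟪colTl j i⟫ =
    fst down ⟪tok (e i)⟫≫ᵥsnd up ⟪tokDown (e j)⟫≫ᵥ⟪t⟫≫ᵥ⟪tl⟫ := by
  rw [cls_colT, cls_colTl]
  simp only [vcomp_assoc, vcomp_eq_assoc (t_fst_tokDown _), vcomp_eq_assoc (t_snd_tok _),
    snd_fst_assoc, fst_tok_e_fst_tok_e, snd_tokDown_e_snd_tokDown_e]

theorem colTl_colT (i j : Fin n) : ⟪colTl i j⟫≫ᵥ⟪colT j i⟫ =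
    fst up ⟪tokDown (e i)⟫≫ᵥsnd down ⟪tok (e j)⟫≫ᵥ⟪tl⟫≫ᵥ⟪t⟫ := by
  rw [cls_colT, cls_colTl]
  simp only [vcomp_assoc, vcomp_eq_assoc (tl_snd_tokDown _), vcomp_eq_assoc (tl_fst_tok _),
    snd_fst_assoc, fst_tokDown_e_fst_tokDown_e, snd_tok_e_snd_tok_e]

/-- The two tokens in a summand come from the same factor, so strands of different colors annihilate
it. -/
theorem sum_dual_ne {i j : Fin n} (h : i ≠ j) : fst up ⟪tok (e i)⟫≫ᵥsnd up ⟪tok (e j)⟫≫ᵥ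
    (∑ b, fst up ⟪tok ((FrobeniusTrace.pi φ).dual (Pi.basis B) b)⟫≫ᵥ
      snd up ⟪tok (Pi.basis B b)⟫) = 0 := by
  simp only [vcomp_sum]
  refine Finset.sum_eq_zero ?_
  rintro ⟨m, b⟩ -
  rw [FrobeniusTrace.pi_dual, Pi.basis_apply, snd_fst_assoc, ← snd_vcomp, ← vcomp_assoc,
    ← fst_vcomp]
  rcases eq_or_ne i m with rfl | hm
  · rw [tok_e_tok_single_ne h.symm, snd_zero, vcomp_zero]
  · rw [tok_e_tok_single_ne hm, fst_zero, zero_vcomp]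

theorem sum_dual_self (i : Fin n) : fst up ⟪tok (e i)⟫≫ᵥsnd up ⟪tok (e i)⟫≫ᵥ
    (∑ b, fst up ⟪tok ((FrobeniusTrace.pi φ).dual (Pi.basis B) b)⟫≫ᵥ
      snd up ⟪tok (Pi.basis B b)⟫) =
    ∑ b, fst up ⟪tok (Pi.single i ((φ i).dual (B i) b))⟫≫ᵥ
      snd up ⟪tok (Pi.single i (B i b))⟫ := by
  simp only [vcomp_sum]
  rw [Fintype.sum_sigma, Finset.sum_eq_single i]
  · refine Finset.sum_congr rfl fun b _ => ?_
    rw [FrobeniusTrace.pi_dual, Pi.basis_apply, snd_fst_assoc, ← snd_vcomp, ← vcomp_assoc,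
      ← fst_vcomp, tok_e_tok_single, tok_e_tok_single]
  · intro m _ hm
    refine Finset.sum_eq_zero fun b _ => ?_
    rw [FrobeniusTrace.pi_dual, snd_fst_assoc, ← vcomp_assoc, ← fst_vcomp,
      tok_e_tok_single_ne hm.symm, fst_zero, zero_vcomp]
  · simp

/-- The plain dot-crossing relation cut down to the colors `i`, `j` at the bottom. The equal and
unequal cases of the colored relation differ only in whether the correction sum survives. -/
theorem colS_colX (i j : Fin n) : ⟪colS i j⟫≫ᵥfst up ⟪colX j⟫≫ᵥsnd up ⟪tok (e i)⟫ =
    (fst up ⟪tok (e i)⟫≫ᵥsnd up ⟪colX j⟫)≫ᵥ⟪colS i j⟫ +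
    fst up ⟪tok (e i)⟫≫ᵥsnd up ⟪tok (e j)⟫≫ᵥ
    (∑ b, fst up ⟪tok ((FrobeniusTrace.pi φ).dual (Pi.basis B) b)⟫≫ᵥ
      snd up ⟪tok (Pi.basis B b)⟫) := by
  have h : ∀ {X : List Sgn} (g : Mor _ _ X), snd up ⟪x⟫≫ᵥsnd up ⟪tok (e j)⟫≫ᵥg =
      snd up ⟪tok (e j)⟫≫ᵥsnd up ⟪x⟫≫ᵥg :=
    fun g => vcomp_eq_assoc (by rw [← snd_vcomp, ← snd_vcomp, x_tok]) g
  rw [cls_colS, cls_colX]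
  simp only [vcomp_assoc, fst_vcomp, snd_vcomp, ← snd_fst, vcomp_eq_assoc (fst_tok_s _).symm,
    vcomp_eq_assoc (snd_tok_s _).symm, s_fst_x]
  simp only [snd_fst_assoc, fst_tok_e_fst_tok_e, snd_tok_e_snd_tok_e, h, vcomp_add]

/-- Both legs of a right cap labelled from the `m`th factor have color `m`. Hence no correction term
is left for two different colors, and `colT i j` is inverted by `colTl j i` alone. -/
theorem sum_rcap_cup_ne {i j : Fin n} (h : i ≠ j) :
    fst down ⟪tok (e i)⟫≫ᵥsnd up ⟪tokDown (e j)⟫≫ᵥ(∑ r : Fin l.toNat, ∑ b,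
      ⟪rcap r ((FrobeniusTrace.pi φ).dual (Pi.basis B) b)⟫≫ᵥ⟪cup r b⟫) = 0 := by
  simp only [vcomp_sum]
  refine Finset.sum_eq_zero fun r _ => Finset.sum_eq_zero ?_
  rintro ⟨m, b⟩ -
  rw [FrobeniusTrace.pi_dual]
  rcases eq_or_ne j m with rfl | hm
  · rw [vcomp_eq_assoc' (snd_tokDown_e_rcap _ _ _), vcomp_eq_assoc' (fst_tok_e_rcap_ne h _ _),
      zero_vcomp]
  · rw [vcomp_eq_assoc' (snd_tokDown_e_rcap_ne hm _ _), zero_vcomp, vcomp_zero]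

theorem sum_rcap_cup_self (i : Fin n) :
    fst down ⟪tok (e i)⟫≫ᵥsnd up ⟪tokDown (e i)⟫≫ᵥ(∑ r : Fin l.toNat, ∑ b,
      ⟪rcap r ((FrobeniusTrace.pi φ).dual (Pi.basis B) b)⟫≫ᵥ⟪cup r b⟫) =
    ∑ r : Fin l.toNat, ∑ b, ⟪rcap r (Pi.single i ((φ i).dual (B i) b))⟫≫ᵥ⟪cup r ⟨i, b⟩⟫ := by
  simp only [vcomp_sum]
  refine Finset.sum_congr rfl fun r _ => ?_
  rw [Fintype.sum_sigma, Finset.sum_eq_single i]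
  · refine Finset.sum_congr rfl fun b _ => ?_
    rw [FrobeniusTrace.pi_dual, vcomp_eq_assoc' (snd_tokDown_e_rcap _ _ _),
      vcomp_eq_assoc' (fst_tok_e_rcap _ _ _)]
  · intro m _ hm
    refine Finset.sum_eq_zero fun b _ => ?_
    rw [FrobeniusTrace.pi_dual, vcomp_eq_assoc' (snd_tokDown_e_rcap_ne hm.symm _ _), zero_vcomp,
      vcomp_zero]
  · simp

theorem sum_cap_rcup_ne {i j : Fin n} (h : i ≠ j) :
    (∑ r : Fin (-l).toNat, ∑ b,
      ⟪cap r b⟫≫ᵥ⟪rcup r ((FrobeniusTrace.pi φ).dual (Pi.basis B) b)⟫)≫ᵥ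
      fst up ⟪tokDown (e i)⟫≫ᵥsnd down ⟪tok (e j)⟫ = 0 := by
  simp only [sum_vcomp]
  refine Finset.sum_eq_zero fun r _ => Finset.sum_eq_zero ?_
  rintro ⟨m, b⟩ -
  rw [FrobeniusTrace.pi_dual, vcomp_assoc]
  rcases eq_or_ne i m with rfl | hm
  · rw [vcomp_eq_assoc' (rcup_fst_tokDown_e _ _ _), rcup_snd_tok_e_ne h.symm, vcomp_zero]
  · rw [vcomp_eq_assoc' (rcup_fst_tokDown_e_ne hm _ _), zero_vcomp, vcomp_zero]

theorem sum_cap_rcup_self (i : Fin n) :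
    (∑ r : Fin (-l).toNat, ∑ b,
      ⟪cap r b⟫≫ᵥ⟪rcup r ((FrobeniusTrace.pi φ).dual (Pi.basis B) b)⟫)≫ᵥ
      fst up ⟪tokDown (e i)⟫≫ᵥsnd down ⟪tok (e i)⟫ =
    ∑ r : Fin (-l).toNat, ∑ b, ⟪cap r ⟨i, b⟩⟫≫ᵥ⟪rcup r (Pi.single i ((φ i).dual (B i) b))⟫ := by
  simp only [sum_vcomp]
  refine Finset.sum_congr rfl fun r _ => ?_
  rw [Fintype.sum_sigma, Finset.sum_eq_single i]
  · refine Finset.sum_congr rfl fun b _ => ?_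
    rw [FrobeniusTrace.pi_dual, vcomp_assoc, vcomp_eq_assoc' (rcup_fst_tokDown_e _ _ _),
      rcup_snd_tok_e]
  · intro m _ hm
    refine Finset.sum_eq_zero fun b _ => ?_
    rw [FrobeniusTrace.pi_dual, vcomp_assoc, vcomp_eq_assoc' (rcup_fst_tokDown_e_ne hm.symm _ _),
      zero_vcomp, vcomp_zero]
  · simp

theorem fst_snd_eq_colT (i j : Fin n) : fst down ⟪tok (e i)⟫≫ᵥsnd up ⟪tokDown (e j)⟫ =
    ⟪colT i j⟫≫ᵥ⟪colTl j i⟫ +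
    fst down ⟪tok (e i)⟫≫ᵥsnd up ⟪tokDown (e j)⟫≫ᵥ(∑ r : Fin l.toNat, ∑ b,
      ⟪rcap r ((FrobeniusTrace.pi φ).dual (Pi.basis B) b)⟫≫ᵥ⟪cup r b⟫) := by
  rw [colT_colTl, ← vcomp_add, ← vcomp_add, ← up_down, vcomp_one]

theorem fst_snd_eq_colTl (i j : Fin n) : fst up ⟪tokDown (e i)⟫≫ᵥsnd down ⟪tok (e j)⟫ =
    ⟪colTl i j⟫≫ᵥ⟪colT j i⟫ +
    (∑ r : Fin (-l).toNat, ∑ b,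
      ⟪cap r b⟫≫ᵥ⟪rcup r ((FrobeniusTrace.pi φ).dual (Pi.basis B) b)⟫)≫ᵥ
      fst up ⟪tokDown (e i)⟫≫ᵥsnd down ⟪tok (e j)⟫ := by
  -- The idempotents are carried from the bottom to the top, since in the correction sum it is the
  -- right cup, at the top, whose color is known from its token.
  have h : fst up ⟪tokDown (e i)⟫≫ᵥsnd down ⟪tok (e j)⟫≫ᵥ⟪tl⟫≫ᵥ⟪t⟫ =
      (⟪tl⟫≫ᵥ⟪t⟫)≫ᵥfst up ⟪tokDown (e i)⟫≫ᵥsnd down ⟪tok (e j)⟫ := by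
    rw [vcomp_assoc, vcomp_eq_assoc (t_fst_tokDown _), t_snd_tok,
      vcomp_eq_assoc (tl_snd_tokDown _), vcomp_eq_assoc (tl_fst_tok _)]
  rw [colTl_colT, h, ← add_vcomp, ← down_up, one_vcomp]

theorem colC_absorb (i : Fin n) :
    ⟪colC i⟫≫ᵥfst up ⟪tokDown (e i)⟫≫ᵥsnd down ⟪tok (e i)⟫ = ⟪colC i⟫ := by
  have h : snd down ⟪tok (e i)⟫≫ᵥsnd down ⟪tok (e i)⟫ = snd down ⟪tok (e i)⟫ := by
    rw [← snd_vcomp, tok_e_tok_e]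
  rw [cls_colC, vcomp_assoc, fst_tokDown_e_fst_tokDown_e,
    vcomp_eq_assoc (c_fst_tokDown _), h, c_fst_tokDown]

theorem absorb_colD (i : Fin n) :
    fst down ⟪tok (e i)⟫≫ᵥsnd up ⟪tokDown (e i)⟫≫ᵥ⟪colD i⟫ = ⟪colD i⟫ := by
  rw [cls_colD]
  simp only [snd_fst_assoc, snd_tokDown_d, fst_tok_e_fst_tok_e]

/-- The color conventions are absorption of idempotents; the other relations are the plain ones
after the idempotents have been gathered and the correction sums restricted to a single color. -/
theorem cls_lift_ofColGen {X Y : List Sgn} {f g : Term k (ColHeis.Gen F ι l) X Y}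
    (h : ColHeis.R φ B l X Y f g) : ⟪f.lift ofColGen⟫ = ⟪g.lift ofColGen⟫ := by
  cases h with
  | sum_E =>
    rw [Term.lift_sum, cls_sum]
    simp only [cls_lift_E]
    rw [← cls_tok_sum, sum_e, cls_tok_one]; rfl
  | sum_D =>
    rw [Term.lift_sum, cls_sum]
    simp only [cls_lift_D]
    rw [← tokDown_sum, sum_e, tokDown_one]; rfl
  | E_E i j h => exact tok_e_tok_e_ne h
  | D_D i j h =>
    change ⟪(ColHeis.D i).lift ofColGen⟫≫ᵥ⟪(ColHeis.D j).lift ofColGen⟫ = 0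
    rw [cls_lift_D, cls_lift_D, tokDown_e_tokDown_e_ne h]
  | color_x i =>
    change ⟪tok (e i)⟫≫ᵥ⟪colX i⟫≫ᵥ⟪tok (e i)⟫ = ⟪colX i⟫
    rw [cls_colX, vcomp_assoc, x_tok, vcomp_eq_assoc' (tok_e_tok_e i),
      vcomp_eq_assoc' (tok_e_tok_e i)]
  | color_s i j =>
    change two ⟪tok (e i)⟫ ⟪tok (e j)⟫≫ᵥ⟪colS i j⟫≫ᵥtwo ⟪tok (e j)⟫ ⟪tok (e i)⟫ = ⟪colS i j⟫
    rw [two_eq, two_eq, colS_absorb, vcomp_assoc, absorb_colS]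
  | color_c i =>
    change ⟪colC i⟫≫ᵥtwo ⟪(ColHeis.D i).lift ofColGen⟫ ⟪tok (e i)⟫ = ⟪colC i⟫
    rw [two_eq, cls_lift_D, colC_absorb]
  | color_d i =>
    change two ⟪tok (e i)⟫ ⟪(ColHeis.D i).lift ofColGen⟫≫ᵥ⟪colD i⟫ = ⟪colD i⟫
    rw [two_eq, cls_lift_D, vcomp_assoc, absorb_colD]
  | color_tl i j =>
    change two ⟪(ColHeis.D i).lift ofColGen⟫ ⟪tok (e j)⟫≫ᵥ⟪colTl i j⟫≫ᵥ
      two ⟪tok (e j)⟫ ⟪(ColHeis.D i).lift ofColGen⟫ = ⟪colTl i j⟫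
    rw [two_eq, two_eq, cls_lift_D, colTl_absorb, vcomp_assoc, absorb_colTl]
  | color_cup i r b =>
    change ⟪cup r ⟨i, b⟩⟫≫ᵥtwo ⟪tok (e i)⟫ ⟪(ColHeis.D i).lift ofColGen⟫ = ⟪cup r ⟨i, b⟩⟫
    rw [two_eq, cls_lift_D, vcomp_eq_assoc' (cup_fst_tok_e r i b), cup_snd_tokDown_e]
  | color_cap i r b =>
    change two ⟪(ColHeis.D i).lift ofColGen⟫ ⟪tok (e i)⟫≫ᵥ⟪cap r ⟨i, b⟩⟫ = ⟪cap r ⟨i, b⟩⟫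
    rw [two_eq, cls_lift_D, vcomp_assoc, snd_tok_e_cap, fst_tokDown_e_cap]
  | tok_mul i f g =>
    change ⟪tok (Pi.single i (f * g))⟫ = ⟪tok (Pi.single i g)⟫≫ᵥ⟪tok (Pi.single i f)⟫
    rw [Pi.single_mul, cls_tok_mul]
  | tok_add i f g =>
    change ⟪tok (Pi.single i (f + g))⟫ = ⟪tok (Pi.single i f)⟫ + ⟪tok (Pi.single i g)⟫
    rw [Pi.single_add, cls_tok_add]
  | tok_smul i a f =>
    change ⟪tok (Pi.single i (a • f))⟫ = a • ⟪tok (Pi.single i f)⟫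
    rw [Pi.single_smul, cls_tok_smul]
  | braid i j m =>
    change (hcomp ⟪colS i j⟫ ⟪tok (e m)⟫ rfl rfl : Mor _ [up, up, up] [up, up, up])≫ᵥ
      (hcomp ⟪tok (e j)⟫ ⟪colS i m⟫ rfl rfl : Mor _ [up, up, up] [up, up, up])≫ᵥ
      (hcomp ⟪colS j m⟫ ⟪tok (e i)⟫ rfl rfl : Mor _ [up, up, up] [up, up, up]) =
      (hcomp ⟪tok (e i)⟫ ⟪colS j m⟫ rfl rfl : Mor _ [up, up, up] [up, up, up])≫ᵥ
      (hcomp ⟪colS i m⟫ ⟪tok (e j)⟫ rfl rfl : Mor _ [up, up, up] [up, up, up])≫ᵥ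
      (hcomp ⟪tok (e m)⟫ ⟪colS i j⟫ rfl rfl : Mor _ [up, up, up] [up, up, up])
    simp only [hcomp_lft, hcomp_rgt, cls_colS]
    rw [colored_braid_left (e := fun i => ⟪tok (e i)⟫) tok_e_tok_e (fun i => fst_tok_s (e i))
      (fun i => snd_tok_s (e i)), colored_braid_right (e := fun i => ⟪tok (e i)⟫) tok_e_tok_e
      (fun i => fst_tok_s (e i)) (fun i => snd_tok_s (e i)), cls_braid]
  | s_s i j =>
    change ⟪colS i j⟫≫ᵥ⟪colS j i⟫ = two ⟪tok (e i)⟫ ⟪tok (e j)⟫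
    rw [cls_colS j i, ← vcomp_assoc, ← vcomp_assoc, vcomp_assoc ⟪colS i j⟫, colS_absorb, cls_colS,
      vcomp_assoc, vcomp_assoc, cls_s_s, vcomp_one, two_eq]
  | x_tok i f =>
    change ⟪colX i⟫≫ᵥ⟪tok (Pi.single i f)⟫ = ⟪tok (Pi.single i f)⟫≫ᵥ⟪colX i⟫
    rw [cls_colX, vcomp_assoc, x_tok, vcomp_eq_assoc' (tok_e_tok_single _ _),
      vcomp_eq_assoc' (tok_single_tok_e _ _)]
  | tok_s i j f =>
    change two ⟪tok (Pi.single i f)⟫ ⟪tok (e j)⟫≫ᵥ⟪colS i j⟫ =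
      ⟪colS i j⟫≫ᵥtwo ⟪tok (e j)⟫ ⟪tok (Pi.single i f)⟫
    have h : ∀ {X : List Sgn} (g : Mor _ _ X), fst up ⟪tok (Pi.single i f)⟫≫ᵥ
        fst up ⟪tok (e i)⟫≫ᵥg = fst up ⟪tok (Pi.single i f)⟫≫ᵥg :=
      fun g => vcomp_eq_assoc' (by rw [← fst_vcomp, tok_single_tok_e]) g
    have h' : ∀ {X : List Sgn} (g : Mor _ _ X), fst up ⟪tok (e i)⟫≫ᵥ
        fst up ⟪tok (Pi.single i f)⟫≫ᵥg = fst up ⟪tok (Pi.single i f)⟫≫ᵥg :=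
      fun g => vcomp_eq_assoc' (by rw [← fst_vcomp, tok_e_tok_single]) g
    rw [cls_colS]
    simp only [two_eq, vcomp_assoc, vcomp_eq_assoc (snd_tok_s _).symm, (fst_tok_s _).symm,
      snd_fst_assoc, snd_tok_e_snd_tok_e, h, h']
  | x_s i =>
    change ⟪colS i i⟫≫ᵥtwo ⟪colX i⟫ ⟪tok (e i)⟫ = two ⟪tok (e i)⟫ ⟪colX i⟫≫ᵥ⟪colS i i⟫ +
      (⟪(Term.sum fun b => ColHeis.tok i ((φ i).dual (B i) b)⊠ColHeis.tok i (B i b)).lift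
        ofColGen⟫ : Mor _ [up, up] [up, up])
    rw [two_eq, two_eq, colS_colX, sum_dual_self, Term.lift_sum, cls_sum]
    congr 1
    exact Finset.sum_congr rfl fun b _ => (two_eq ⟪tok (Pi.single i ((φ i).dual (B i) b))⟫
      ⟪tok (Pi.single i (B i b))⟫).symm
  | x_s_ne i j h =>
    change ⟪colS i j⟫≫ᵥtwo ⟪colX j⟫ ⟪tok (e i)⟫ = two ⟪tok (e i)⟫ ⟪colX j⟫≫ᵥ⟪colS i j⟫
    rw [two_eq, two_eq, colS_colX, sum_dual_ne h, add_zero]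
  | zigzag_up i =>
    have h : ⟪((ColHeis.E i⊠ColHeis.c i)⨟(ColHeis.d i⊠ColHeis.E i)).lift ofColGen⟫ =
        (hcomp ⟪tok (e i)⟫ ⟪colC i⟫ rfl rfl : Mor _ [up] [up, down, up])≫ᵥ
        hcomp ⟪colD i⟫ ⟪tok (e i)⟫ rfl rfl := rfl
    rw [cls_lift_E]
    refine h.trans ?_
    rw [hcomp_zigzag_colored, cls_colC, cls_colD, c_fst_tokDown, zigzag_cup_snd, ← vcomp_zigzag,
      cls_zigzag, vcomp_one]
    rw [tok_e_tok_e, tok_e_tok_e, tok_e_tok_e]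
  | zigzag_down i =>
    have h : ⟪((ColHeis.c i⊠ColHeis.D i)⨟(ColHeis.D i⊠ColHeis.d i)).lift ofColGen⟫ =
        (hcomp ⟪colC i⟫ ⟪(ColHeis.D i).lift ofColGen⟫ rfl rfl : Mor _ [down] [down, up, down])≫ᵥ
        hcomp ⟪(ColHeis.D i).lift ofColGen⟫ ⟪colD i⟫ rfl rfl := rfl
    refine h.trans ?_
    rw [cls_lift_D, hcomp_mate_one_colored, cls_colC, cls_colD, mate_cup_fst, mate_fst_cap,
      one_vcomp, ← cls_tokDown]
    rw [tokDown_e_tokDown_e, tokDown_e_tokDown_e, tokDown_e_tokDown_e]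
  | up_down_ne i j h =>
    change two ⟪tok (e i)⟫ ⟪(ColHeis.D j).lift ofColGen⟫ = ⟪colT i j⟫≫ᵥ⟪colTl j i⟫
    rw [cls_lift_D, two_eq, fst_snd_eq_colT, sum_rcap_cup_ne h, add_zero]
  | down_up_ne i j h =>
    change two ⟪(ColHeis.D i).lift ofColGen⟫ ⟪tok (e j)⟫ = ⟪colTl i j⟫≫ᵥ⟪colT j i⟫
    rw [cls_lift_D, two_eq, fst_snd_eq_colTl, sum_cap_rcup_ne h, add_zero]
  | up_down i =>
    change two ⟪tok (e i)⟫ ⟪(ColHeis.D i).lift ofColGen⟫ = ⟪colT i i⟫≫ᵥ⟪colTl i i⟫ +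
      ⟪(Term.sum fun r : Fin l.toNat => Term.sum fun b =>
        ColHeis.rcap i r ((φ i).dual (B i) b)⨟ColHeis.cup i r b).lift ofColGen⟫
    rw [cls_lift_D, two_eq, fst_snd_eq_colT, sum_rcap_cup_self]
    simp only [Term.lift_sum, cls_sum, Term.lift, cls_comp, cls_lift_rcap]
    rfl
  | down_up i =>
    change two ⟪(ColHeis.D i).lift ofColGen⟫ ⟪tok (e i)⟫ = ⟪colTl i i⟫≫ᵥ⟪colT i i⟫ +
      ⟪(Term.sum fun r : Fin (-l).toNat => Term.sum fun b =>
        ColHeis.cap i r b⨟ColHeis.rcup i r ((φ i).dual (B i) b)).lift ofColGen⟫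
    rw [cls_lift_D, two_eq, fst_snd_eq_colTl, sum_cap_rcup_self]
    simp only [Term.lift_sum, cls_sum, Term.lift, cls_comp, cls_lift_rcup]
    rfl
  | cup_t i r b =>
    change ⟪cup r ⟨i, b⟩⟫≫ᵥ⟪colT i i⟫ = 0
    rw [cls_colT, vcomp_eq_assoc' (cup_fst_tok_e r i b), vcomp_eq_assoc' (cup_snd_tokDown_e r i b),
      cup_t]
  | tl_rcap i r b =>
    change ⟪colTl i i⟫≫ᵥ⟪(ColHeis.rcap i r ((φ i).dual (B i) b)).lift ofColGen⟫ = 0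
    rw [cls_lift_rcap, cls_colTl, vcomp_assoc, vcomp_assoc, tl_rcap, vcomp_zero, vcomp_zero]
  | cup_rcap i r b =>
    classical
    change ⟪cup r ⟨i, b⟩⟫≫ᵥ⟪(ColHeis.rcap i r ((φ i).dual (B i) b)).lift ofColGen⟫ = one []
    rw [cls_lift_rcap, ← FrobeniusTrace.pi_dual, cup_rcap, if_pos rfl]
  | cup_rcap_ne i r r' b b' h =>
    classical
    change ⟪cup r ⟨i, b⟩⟫≫ᵥ⟪(ColHeis.rcap i r' ((φ i).dual (B i) b')).lift ofColGen⟫ = 0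
    rw [cls_lift_rcap, ← FrobeniusTrace.pi_dual, cup_rcap, if_neg]
    simpa using h
  | t_cap i r b =>
    change ⟪colT i i⟫≫ᵥ⟪cap r ⟨i, b⟩⟫ = 0
    rw [cls_colT, vcomp_assoc, vcomp_assoc, t_cap, vcomp_zero, vcomp_zero]
  | rcup_tl i r b =>
    change ⟪(ColHeis.rcup i r ((φ i).dual (B i) b)).lift ofColGen⟫≫ᵥ⟪colTl i i⟫ = 0
    rw [cls_lift_rcup, cls_colTl, vcomp_eq_assoc' (rcup_fst_tokDown_e _ _ _),
      vcomp_eq_assoc' (rcup_snd_tok_e _ _ _), rcup_tl]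
  | rcup_cap i r b =>
    classical
    change ⟪(ColHeis.rcup i r ((φ i).dual (B i) b)).lift ofColGen⟫≫ᵥ⟪cap r ⟨i, b⟩⟫ = one []
    rw [cls_lift_rcup, ← FrobeniusTrace.pi_dual, rcup_cap, if_pos rfl]
  | rcup_cap_ne i r r' b b' h =>
    classical
    change ⟪(ColHeis.rcup i r ((φ i).dual (B i) b)).lift ofColGen⟫≫ᵥ⟪cap r' ⟨i, b'⟩⟫ = 0
    rw [cls_lift_rcup, ← FrobeniusTrace.pi_dual, rcup_cap, if_neg]
    simpa using h

end Heis

/-! ### Orthogonal families that resolve the identity. -/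

namespace Presented

variable {k : Type u} [CommRing k] {O : Type v} {Gen : List O → List O → Type w}
  {R : ∀ X Y : List O, Term k Gen X Y → Term k Gen X Y → Prop} {X Y : List O}
  {ι : Type z} [Fintype ι]

/-- If the summand `f i` absorbs `p i`, orthogonality makes `p i` pick this summand out of the sum.
Idempotency of `p i` is not needed. -/
theorem vcomp_sum_eq (p : ι → Mor R X X) (hp : ∀ i j, i ≠ j → p i≫ᵥp j = 0) (f : ι → Mor R X Y)
    (hf : ∀ i, p i≫ᵥf i = f i) (i : ι) : p i≫ᵥ(∑ j, f j) = f i := by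
  rw [vcomp_sum, Finset.sum_eq_single i, hf]
  · intro j _ hj
    rw [← hf j, vcomp_eq_assoc' (hp i j hj.symm), zero_vcomp]
  · simp

theorem sum_vcomp_eq (p : ι → Mor R X X) (hp : ∀ i j, i ≠ j → p i≫ᵥp j = 0) (f : ι → Mor R Y X)
    (hf : ∀ i, f i≫ᵥp i = f i) (i : ι) : (∑ j, f j)≫ᵥp i = f i := by
  rw [sum_vcomp, Finset.sum_eq_single i, hf]
  · intro j _ hj
    rw [← hf j, vcomp_assoc, hp j i hj, vcomp_zero]
  · simp

theorem eq_of_sum_eq_one (p : ι → Mor R X X) (hp : ∑ i, p i = one X) {f g : Mor R X Y}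
    (h : ∀ i, p i≫ᵥf = p i≫ᵥg) : f = g := by
  rw [← one_vcomp f, ← one_vcomp g, ← hp, sum_vcomp, sum_vcomp]
  exact Finset.sum_congr rfl fun i _ => h i

end Presented

/-! ### Consequences of the colored relations -/

namespace ColHeis

open Presented

variable {k : Type u} [CommRing k] {n : ℕ} {F : Fin n → Type v} [∀ i, Ring (F i)]
  [∀ i, Algebra k (F i)] {ι : Fin n → Type w} [∀ i, Fintype (ι i)]
  {φ : ∀ i, FrobeniusTrace k (F i)} {B : ∀ i, Module.Basis (ι i) k (F i)} {l : ℤ}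

local notation "⟪" t "⟫" => cls (R := R φ B l) t

theorem cls_tok_mul (i : Fin n) (f g : F i) : ⟪tok i (f * g)⟫ = ⟪tok i g⟫≫ᵥ⟪tok i f⟫ :=
  cls_sound (.of (.tok_mul i f g))
theorem cls_tok_add (i : Fin n) (f g : F i) : ⟪tok i (f + g)⟫ = ⟪tok i f⟫ + ⟪tok i g⟫ :=
  cls_sound (.of (.tok_add i f g))
theorem cls_tok_smul (i : Fin n) (a : k) (f : F i) : ⟪tok i (a • f)⟫ = a • ⟪tok i f⟫ :=
  cls_sound (.of (.tok_smul i a f))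
theorem cls_tok_zero (i : Fin n) : ⟪tok i 0⟫ = 0 := by
  have h := cls_tok_smul (φ := φ) (B := B) (l := l) i 0 0
  rwa [smul_zero, zero_smul] at h

theorem sum_E : ∑ i, ⟪E i⟫ = one [up] := by
  rw [← cls_sum]; exact cls_sound (.of .sum_E)
theorem sum_D : ∑ i, ⟪D i⟫ = one [down] := by
  rw [← cls_sum]; exact cls_sound (.of .sum_D)
theorem E_tok (i : Fin n) (f : F i) : ⟪E i⟫≫ᵥ⟪tok i f⟫ = ⟪tok i f⟫ := by
  rw [E, ← cls_tok_mul, mul_one]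
theorem tok_E (i : Fin n) (f : F i) : ⟪tok i f⟫≫ᵥ⟪E i⟫ = ⟪tok i f⟫ := by
  rw [E, ← cls_tok_mul, one_mul]
theorem E_E (i : Fin n) : ⟪E i⟫≫ᵥ⟪E i⟫ = ⟪E i⟫ := E_tok i 1
theorem E_E_ne (i j : Fin n) (h : i ≠ j) : ⟪E i⟫≫ᵥ⟪E j⟫ = 0 := cls_sound (.of (.E_E i j h))
theorem D_D_ne (i j : Fin n) (h : i ≠ j) : ⟪D i⟫≫ᵥ⟪D j⟫ = 0 := cls_sound (.of (.D_D i j h))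
-- The presentation imposes no multiplication rule on downward strands. Idempotency follows from
-- orthogonality together with the fact that the `D j` add up to the identity.
theorem D_D (i : Fin n) : ⟪D i⟫≫ᵥ⟪D i⟫ = ⟪D i⟫ := by
  have h : ⟪D i⟫≫ᵥ(∑ j, ⟪D j⟫) = ⟪D i⟫≫ᵥ⟪D i⟫ := by
    rw [vcomp_sum, Finset.sum_eq_single i]
    · intro j _ hj; exact D_D_ne i j hj.symm
    · simp
  rw [← h, sum_D, vcomp_one]

section families

variable (q : Sgn)

theorem fst_E_E (i : Fin n) : fst q ⟪E i⟫≫ᵥfst q ⟪E i⟫ = fst q ⟪E i⟫ := by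
  rw [← fst_vcomp, E_E]
theorem snd_E_E (i : Fin n) : snd q ⟪E i⟫≫ᵥsnd q ⟪E i⟫ = snd q ⟪E i⟫ := by
  rw [← snd_vcomp, E_E]
theorem fst_D_D (i : Fin n) : fst q ⟪D i⟫≫ᵥfst q ⟪D i⟫ = fst q ⟪D i⟫ := by
  rw [← fst_vcomp, D_D]
theorem snd_D_D (i : Fin n) : snd q ⟪D i⟫≫ᵥsnd q ⟪D i⟫ = snd q ⟪D i⟫ := by
  rw [← snd_vcomp, D_D]
theorem fst_E_E_ne (i j : Fin n) (h : i ≠ j) : fst q ⟪E i⟫≫ᵥfst q ⟪E j⟫ = 0 := by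
  rw [← fst_vcomp, E_E_ne i j h, fst_zero]
theorem snd_E_E_ne (i j : Fin n) (h : i ≠ j) : snd q ⟪E i⟫≫ᵥsnd q ⟪E j⟫ = 0 := by
  rw [← snd_vcomp, E_E_ne i j h, snd_zero]
theorem fst_D_D_ne (i j : Fin n) (h : i ≠ j) : fst q ⟪D i⟫≫ᵥfst q ⟪D j⟫ = 0 := by
  rw [← fst_vcomp, D_D_ne i j h, fst_zero]
theorem snd_D_D_ne (i j : Fin n) (h : i ≠ j) : snd q ⟪D i⟫≫ᵥsnd q ⟪D j⟫ = 0 := by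
  rw [← snd_vcomp, D_D_ne i j h, snd_zero]
theorem sum_fst_E : ∑ i, fst q ⟪E i⟫ = one [up, q] := by rw [← fst_sum, sum_E, fst_one]
theorem sum_snd_E : ∑ i, snd q ⟪E i⟫ = one [q, up] := by rw [← snd_sum, sum_E, snd_one]
theorem sum_fst_D : ∑ i, fst q ⟪D i⟫ = one [down, q] := by rw [← fst_sum, sum_D, fst_one]
theorem sum_snd_D : ∑ i, snd q ⟪D i⟫ = one [q, down] := by rw [← snd_sum, sum_D, snd_one]

/-- This and the next two lemmas allow a relation between two-strand diagrams to be checked for each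
pair of colors at the bottom. -/
theorem eq_of_fst_E_snd_E {X : List Sgn} {f g : Mor (R φ B l) [up, up] X}
    (h : ∀ i j, fst up ⟪E i⟫≫ᵥsnd up ⟪E j⟫≫ᵥf = fst up ⟪E i⟫≫ᵥsnd up ⟪E j⟫≫ᵥg) : f = g :=
  eq_of_sum_eq_one _ (sum_snd_E up) fun j => eq_of_sum_eq_one _ (sum_fst_E up) fun i => h i j
theorem eq_of_fst_E_snd_D {X : List Sgn} {f g : Mor (R φ B l) [up, down] X}
    (h : ∀ i j, fst down ⟪E i⟫≫ᵥsnd up ⟪D j⟫≫ᵥf = fst down ⟪E i⟫≫ᵥsnd up ⟪D j⟫≫ᵥg) : f = g :=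
  eq_of_sum_eq_one _ (sum_snd_D up) fun j => eq_of_sum_eq_one _ (sum_fst_E down) fun i => h i j
theorem eq_of_fst_D_snd_E {X : List Sgn} {f g : Mor (R φ B l) [down, up] X}
    (h : ∀ i j, fst up ⟪D i⟫≫ᵥsnd down ⟪E j⟫≫ᵥf = fst up ⟪D i⟫≫ᵥsnd down ⟪E j⟫≫ᵥg) : f = g :=
  eq_of_sum_eq_one _ (sum_snd_E down) fun j => eq_of_sum_eq_one _ (sum_fst_D up) fun i => h i j

end families

theorem color_x (i : Fin n) : ⟪E i⟫≫ᵥ⟪x i⟫≫ᵥ⟪E i⟫ = ⟪x i⟫ := cls_sound (.of (.color_x i))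
theorem E_x (i : Fin n) : ⟪E i⟫≫ᵥ⟪x i⟫ = ⟪x i⟫ := by
  rw [← color_x, vcomp_eq_assoc' (E_E i)]
theorem x_E (i : Fin n) : ⟪x i⟫≫ᵥ⟪E i⟫ = ⟪x i⟫ := by
  rw [← color_x, vcomp_assoc, vcomp_assoc, E_E i]

theorem color_s (i j : Fin n) : fst up ⟪E i⟫≫ᵥsnd up ⟪E j⟫≫ᵥ⟪s i j⟫≫ᵥ
    fst up ⟪E j⟫≫ᵥsnd up ⟪E i⟫ = ⟪s i j⟫ := by
  have h : two ⟪E i⟫ ⟪E j⟫≫ᵥ⟪s i j⟫≫ᵥtwo ⟪E j⟫ ⟪E i⟫ = ⟪s i j⟫ := cls_sound (.of (.color_s i j))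
  simpa only [two_eq, vcomp_assoc] using h
theorem fst_E_s (i j : Fin n) : fst up ⟪E i⟫≫ᵥ⟪s i j⟫ = ⟪s i j⟫ := by
  rw [← color_s, vcomp_eq_assoc' (fst_E_E up i)]
theorem snd_E_s (i j : Fin n) : snd up ⟪E j⟫≫ᵥ⟪s i j⟫ = ⟪s i j⟫ := by
  rw [← color_s, snd_fst_assoc, vcomp_eq_assoc' (snd_E_E up j)]
theorem s_fst_E (i j : Fin n) : ⟪s i j⟫≫ᵥfst up ⟪E j⟫ = ⟪s i j⟫ := by
  rw [← color_s]
  simp only [vcomp_assoc, snd_fst, vcomp_eq_assoc' (fst_E_E up j)]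
theorem s_snd_E (i j : Fin n) : ⟪s i j⟫≫ᵥsnd up ⟪E i⟫ = ⟪s i j⟫ := by
  rw [← color_s]
  simp only [vcomp_assoc, snd_E_E up i]

theorem color_c (i : Fin n) : ⟪c i⟫≫ᵥfst up ⟪D i⟫≫ᵥsnd down ⟪E i⟫ = ⟪c i⟫ := by
  have h : ⟪c i⟫≫ᵥtwo ⟪D i⟫ ⟪E i⟫ = ⟪c i⟫ := cls_sound (.of (.color_c i))
  rwa [two_eq] at h
theorem c_fst_D (i : Fin n) : ⟪c i⟫≫ᵥfst up ⟪D i⟫ = ⟪c i⟫ := by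
  rw [← color_c, vcomp_assoc, vcomp_assoc, snd_fst, vcomp_eq_assoc' (fst_D_D up i)]
theorem c_snd_E (i : Fin n) : ⟪c i⟫≫ᵥsnd down ⟪E i⟫ = ⟪c i⟫ := by
  rw [← color_c, vcomp_assoc, vcomp_assoc, snd_E_E]

theorem color_d (i : Fin n) : fst down ⟪E i⟫≫ᵥsnd up ⟪D i⟫≫ᵥ⟪d i⟫ = ⟪d i⟫ := by
  have h : two ⟪E i⟫ ⟪D i⟫≫ᵥ⟪d i⟫ = ⟪d i⟫ := cls_sound (.of (.color_d i))
  rwa [two_eq, vcomp_assoc] at h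
theorem fst_E_d (i : Fin n) : fst down ⟪E i⟫≫ᵥ⟪d i⟫ = ⟪d i⟫ := by
  rw [← color_d, vcomp_eq_assoc' (fst_E_E down i)]
theorem snd_D_d (i : Fin n) : snd up ⟪D i⟫≫ᵥ⟪d i⟫ = ⟪d i⟫ := by
  rw [← color_d, snd_fst_assoc, vcomp_eq_assoc' (snd_D_D up i)]

theorem color_tl (i j : Fin n) : fst up ⟪D i⟫≫ᵥsnd down ⟪E j⟫≫ᵥ⟪tl i j⟫≫ᵥ
    fst down ⟪E j⟫≫ᵥsnd up ⟪D i⟫ = ⟪tl i j⟫ := by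
  have h : two ⟪D i⟫ ⟪E j⟫≫ᵥ⟪tl i j⟫≫ᵥtwo ⟪E j⟫ ⟪D i⟫ = ⟪tl i j⟫ :=
    cls_sound (.of (.color_tl i j))
  simpa only [two_eq, vcomp_assoc] using h
theorem fst_D_tl (i j : Fin n) : fst up ⟪D i⟫≫ᵥ⟪tl i j⟫ = ⟪tl i j⟫ := by
  rw [← color_tl, vcomp_eq_assoc' (fst_D_D up i)]
theorem snd_E_tl (i j : Fin n) : snd down ⟪E j⟫≫ᵥ⟪tl i j⟫ = ⟪tl i j⟫ := by
  rw [← color_tl, snd_fst_assoc, vcomp_eq_assoc' (snd_E_E down j)]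
theorem tl_fst_E (i j : Fin n) : ⟪tl i j⟫≫ᵥfst down ⟪E j⟫ = ⟪tl i j⟫ := by
  rw [← color_tl]
  simp only [vcomp_assoc, snd_fst, vcomp_eq_assoc' (fst_E_E down j)]
theorem tl_snd_D (i j : Fin n) : ⟪tl i j⟫≫ᵥsnd up ⟪D i⟫ = ⟪tl i j⟫ := by
  rw [← color_tl]
  simp only [vcomp_assoc, snd_D_D up i]

theorem color_cup (i : Fin n) (r : Fin l.toNat) (b : ι i) :
    ⟪cup i r b⟫≫ᵥfst down ⟪E i⟫≫ᵥsnd up ⟪D i⟫ = ⟪cup i r b⟫ := by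
  have h : ⟪cup i r b⟫≫ᵥtwo ⟪E i⟫ ⟪D i⟫ = ⟪cup i r b⟫ := cls_sound (.of (.color_cup i r b))
  rwa [two_eq] at h
theorem cup_fst_E (i : Fin n) (r : Fin l.toNat) (b : ι i) :
    ⟪cup i r b⟫≫ᵥfst down ⟪E i⟫ = ⟪cup i r b⟫ := by
  rw [← color_cup, vcomp_assoc, vcomp_assoc, snd_fst, vcomp_eq_assoc' (fst_E_E down i)]

theorem color_cap (i : Fin n) (r : Fin (-l).toNat) (b : ι i) :
    fst up ⟪D i⟫≫ᵥsnd down ⟪E i⟫≫ᵥ⟪cap i r b⟫ = ⟪cap i r b⟫ := by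
  have h : two ⟪D i⟫ ⟪E i⟫≫ᵥ⟪cap i r b⟫ = ⟪cap i r b⟫ := cls_sound (.of (.color_cap i r b))
  rwa [two_eq, vcomp_assoc] at h
theorem fst_D_cap (i : Fin n) (r : Fin (-l).toNat) (b : ι i) :
    fst up ⟪D i⟫≫ᵥ⟪cap i r b⟫ = ⟪cap i r b⟫ := by
  rw [← color_cap, vcomp_eq_assoc' (fst_D_D up i)]
theorem snd_E_cap (i : Fin n) (r : Fin (-l).toNat) (b : ι i) :
    snd down ⟪E i⟫≫ᵥ⟪cap i r b⟫ = ⟪cap i r b⟫ := by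
  rw [← color_cap, snd_fst_assoc, vcomp_eq_assoc' (snd_E_E down i)]

theorem cls_t (i j : Fin n) : ⟪t i j⟫ = rotate ⟪c j⟫ ⟪s j i⟫ ⟪d j⟫ :=
  hcomp_rotate ⟪c j⟫ ⟪s j i⟫ ⟪d j⟫
theorem cls_D (i : Fin n) : ⟪D i⟫ = mate ⟪c i⟫ ⟪E i⟫ ⟪d i⟫ := hcomp_mate ⟪c i⟫ ⟪d i⟫ ⟪E i⟫

/-- The right crossing is a composite, not a generator; the colors of its four ends are inherited
from `c j`, `s j i` and `d j`. -/
theorem fst_E_t (i j : Fin n) : fst down ⟪E i⟫≫ᵥ⟪t i j⟫ = ⟪t i j⟫ := by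
  rw [cls_t, fst_rotate, snd_E_s]
theorem snd_D_t (i j : Fin n) : snd up ⟪D j⟫≫ᵥ⟪t i j⟫ = ⟪t i j⟫ := by
  rw [cls_t, snd_rotate, snd_D_d]
theorem t_fst_D (i j : Fin n) : ⟪t i j⟫≫ᵥfst up ⟪D j⟫ = ⟪t i j⟫ := by
  rw [cls_t, ← rotate_cup_fst, c_fst_D]
theorem t_snd_E (i j : Fin n) : ⟪t i j⟫≫ᵥsnd down ⟪E i⟫ = ⟪t i j⟫ := by
  rw [cls_t, rotate_snd, s_fst_E]

/-- Only commutation holds, not absorption: the zeroth power is the uncolored strand. -/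
theorem pow_x_comm (i : Fin n) (r : ℕ) : ⟪E i⟫≫ᵥ⟪(x i).pow r⟫ = ⟪(x i).pow r⟫≫ᵥ⟪E i⟫ := by
  induction r with
  | zero => simp only [Term.pow, cls_id, one_vcomp, vcomp_one]
  | succ r ih => rw [Term.pow, cls_comp, vcomp_assoc, x_E, ← vcomp_assoc, ih, vcomp_assoc, E_x]

theorem cls_rcap (i : Fin n) (r : ℕ) (f : F i) :
    ⟪rcap i r f⟫ = fst down (⟪tok i f⟫≫ᵥ⟪(x i).pow r⟫)≫ᵥ⟪d i⟫ := by
  have h : ⟪rcap i r f⟫ = two (⟪tok i f⟫≫ᵥ⟪(x i).pow r⟫) (one [down])≫ᵥ⟪d i⟫ := rfl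
  rw [h, two_eq, snd_one, vcomp_one]
theorem cls_rcup (i : Fin n) (r : ℕ) (f : F i) :
    ⟪rcup i r f⟫ = ⟪c i⟫≫ᵥsnd down (⟪tok i f⟫≫ᵥ⟪(x i).pow r⟫) := by
  have h : ⟪rcup i r f⟫ = ⟪c i⟫≫ᵥtwo (one [down]) (⟪tok i f⟫≫ᵥ⟪(x i).pow r⟫) := rfl
  rw [h, two_eq, fst_one, one_vcomp]

theorem fst_E_rcap (i : Fin n) (r : ℕ) (f : F i) :
    fst down ⟪E i⟫≫ᵥ⟪rcap i r f⟫ = ⟪rcap i r f⟫ := by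
  rw [cls_rcap, ← vcomp_assoc, ← fst_vcomp, vcomp_eq_assoc' (E_tok i f)]
theorem snd_D_rcap (i : Fin n) (r : ℕ) (f : F i) :
    snd up ⟪D i⟫≫ᵥ⟪rcap i r f⟫ = ⟪rcap i r f⟫ := by
  rw [cls_rcap, snd_fst_assoc, snd_D_d]
theorem rcup_snd_E (i : Fin n) (r : ℕ) (f : F i) :
    ⟪rcup i r f⟫≫ᵥsnd down ⟪E i⟫ = ⟪rcup i r f⟫ := by
  rw [cls_rcup, vcomp_assoc, ← snd_vcomp, vcomp_assoc, ← pow_x_comm, vcomp_eq_assoc' (tok_E i f)]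
theorem rcup_fst_D (i : Fin n) (r : ℕ) (f : F i) :
    ⟪rcup i r f⟫≫ᵥfst up ⟪D i⟫ = ⟪rcup i r f⟫ := by
  rw [cls_rcup, vcomp_assoc, snd_fst, vcomp_eq_assoc' (c_fst_D i)]
theorem colored_braid (i j m : Fin n) :
    (lft ⟪s i j⟫≫ᵥstrand₃ ⟪E m⟫)≫ᵥ(strand₁ ⟪E j⟫≫ᵥrgt ⟪s i m⟫)≫ᵥlft ⟪s j m⟫≫ᵥstrand₃ ⟪E i⟫ =
    (strand₁ ⟪E i⟫≫ᵥrgt ⟪s j m⟫)≫ᵥ(lft ⟪s i m⟫≫ᵥstrand₃ ⟪E j⟫)≫ᵥstrand₁ ⟪E m⟫≫ᵥrgt ⟪s i j⟫ := by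
  have h : (hcomp ⟪s i j⟫ ⟪E m⟫ rfl rfl : Mor (R φ B l) [up, up, up] [up, up, up])≫ᵥ
      (hcomp ⟪E j⟫ ⟪s i m⟫ rfl rfl : Mor (R φ B l) [up, up, up] [up, up, up])≫ᵥ
      (hcomp ⟪s j m⟫ ⟪E i⟫ rfl rfl : Mor (R φ B l) [up, up, up] [up, up, up]) =
      (hcomp ⟪E i⟫ ⟪s j m⟫ rfl rfl : Mor (R φ B l) [up, up, up] [up, up, up])≫ᵥ
      (hcomp ⟪s i m⟫ ⟪E j⟫ rfl rfl : Mor (R φ B l) [up, up, up] [up, up, up])≫ᵥ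
      (hcomp ⟪E m⟫ ⟪s i j⟫ rfl rfl : Mor (R φ B l) [up, up, up] [up, up, up]) :=
    cls_sound (.of (.braid i j m))
  simpa only [hcomp_lft, hcomp_rgt] using h

theorem s_s (i j : Fin n) : ⟪s i j⟫≫ᵥ⟪s j i⟫ = fst up ⟪E i⟫≫ᵥsnd up ⟪E j⟫ := by
  have h : ⟪s i j⟫≫ᵥ⟪s j i⟫ = two ⟪E i⟫ ⟪E j⟫ := cls_sound (.of (.s_s i j))
  rwa [two_eq] at h

theorem x_tok (i : Fin n) (f : F i) : ⟪x i⟫≫ᵥ⟪tok i f⟫ = ⟪tok i f⟫≫ᵥ⟪x i⟫ :=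
  cls_sound (.of (.x_tok i f))

theorem fst_tok_s (i j : Fin n) (f : F i) :
    fst up ⟪tok i f⟫≫ᵥ⟪s i j⟫ = ⟪s i j⟫≫ᵥsnd up ⟪tok i f⟫ := by
  have h : two ⟪tok i f⟫ ⟪E j⟫≫ᵥ⟪s i j⟫ = ⟪s i j⟫≫ᵥtwo ⟪E j⟫ ⟪tok i f⟫ :=
    cls_sound (.of (.tok_s i j f))
  rwa [two_eq, two_eq, vcomp_assoc, snd_E_s, vcomp_eq_assoc' (s_fst_E i j)] at h

theorem s_fst_x (i : Fin n) : ⟪s i i⟫≫ᵥfst up ⟪x i⟫ = snd up ⟪x i⟫≫ᵥ⟪s i i⟫ +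
    ∑ b, fst up ⟪tok i ((φ i).dual (B i) b)⟫≫ᵥsnd up ⟪tok i (B i b)⟫ := by
  have h : ⟪s i i⟫≫ᵥtwo ⟪x i⟫ ⟪E i⟫ = two ⟪E i⟫ ⟪x i⟫≫ᵥ⟪s i i⟫ +
      cls (Term.sum fun b => tok i ((φ i).dual (B i) b)⊠tok i (B i b)) :=
    cls_sound (.of (.x_s i))
  rw [cls_sum, two_eq, two_eq, ← snd_fst, vcomp_eq_assoc' (s_snd_E i i), ← snd_fst, vcomp_assoc,
    fst_E_s] at h
  rw [h]
  congr 1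
  exact Finset.sum_congr rfl fun b _ => two_eq ⟪tok i ((φ i).dual (B i) b)⟫ ⟪tok i (B i b)⟫

theorem s_fst_x_ne (i j : Fin n) (hij : i ≠ j) :
    ⟪s i j⟫≫ᵥfst up ⟪x j⟫ = snd up ⟪x j⟫≫ᵥ⟪s i j⟫ := by
  have h : ⟪s i j⟫≫ᵥtwo ⟪x j⟫ ⟪E i⟫ = two ⟪E i⟫ ⟪x j⟫≫ᵥ⟪s i j⟫ :=
    cls_sound (.of (.x_s_ne i j hij))
  rwa [two_eq, two_eq, ← snd_fst, vcomp_eq_assoc' (s_snd_E i j), ← snd_fst, vcomp_assoc,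
    fst_E_s] at h

/-- The colored strands written at the free ends of the relation are already contained in `c i` and
`d i`. -/
theorem zigzag_E (i : Fin n) : zigzag ⟪c i⟫ ⟪d i⟫ = ⟪E i⟫ := by
  have h : (hcomp ⟪E i⟫ ⟪c i⟫ rfl rfl : Mor (R φ B l) [up] [up, down, up])≫ᵥ
      hcomp ⟪d i⟫ ⟪E i⟫ rfl rfl = ⟪E i⟫ := cls_sound (.of (.zigzag_up i))
  rwa [hcomp_zigzag_colored, ← zigzag_cup_snd, c_snd_E, vcomp_zigzag, fst_E_d] at h

theorem mate_one_D (i : Fin n) : mate ⟪c i⟫ (one [up]) ⟪d i⟫ = ⟪D i⟫ := by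
  have h : (hcomp ⟪c i⟫ ⟪D i⟫ rfl rfl : Mor (R φ B l) [down] [down, up, down])≫ᵥ
      hcomp ⟪D i⟫ ⟪d i⟫ rfl rfl = ⟪D i⟫ := cls_sound (.of (.zigzag_down i))
  rwa [hcomp_mate_one_colored, ← mate_cup_fst, c_fst_D, vcomp_mate, snd_D_d] at h

theorem up_down_ne (i j : Fin n) (h : i ≠ j) :
    fst down ⟪E i⟫≫ᵥsnd up ⟪D j⟫ = ⟪t i j⟫≫ᵥ⟪tl j i⟫ := by
  have h : two ⟪E i⟫ ⟪D j⟫ = ⟪t i j⟫≫ᵥ⟪tl j i⟫ := cls_sound (.of (.up_down_ne i j h))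
  rwa [two_eq] at h
theorem down_up_ne (i j : Fin n) (h : i ≠ j) :
    fst up ⟪D i⟫≫ᵥsnd down ⟪E j⟫ = ⟪tl i j⟫≫ᵥ⟪t j i⟫ := by
  have h : two ⟪D i⟫ ⟪E j⟫ = ⟪tl i j⟫≫ᵥ⟪t j i⟫ := cls_sound (.of (.down_up_ne i j h))
  rwa [two_eq] at h
theorem up_down (i : Fin n) : fst down ⟪E i⟫≫ᵥsnd up ⟪D i⟫ = ⟪t i i⟫≫ᵥ⟪tl i i⟫ +
    ∑ r : Fin l.toNat, ∑ b, ⟪rcap i r ((φ i).dual (B i) b)⟫≫ᵥ⟪cup i r b⟫ := by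
  have h : two ⟪E i⟫ ⟪D i⟫ = ⟪t i i⟫≫ᵥ⟪tl i i⟫ + cls (Term.sum fun r : Fin l.toNat =>
      Term.sum fun b => rcap i r ((φ i).dual (B i) b)⨟cup i r b) := cls_sound (.of (.up_down i))
  simpa only [two_eq, cls_sum, cls_comp] using h
theorem down_up (i : Fin n) : fst up ⟪D i⟫≫ᵥsnd down ⟪E i⟫ = ⟪tl i i⟫≫ᵥ⟪t i i⟫ +
    ∑ r : Fin (-l).toNat, ∑ b, ⟪cap i r b⟫≫ᵥ⟪rcup i r ((φ i).dual (B i) b)⟫ := by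
  have h : two ⟪D i⟫ ⟪E i⟫ = ⟪tl i i⟫≫ᵥ⟪t i i⟫ + cls (Term.sum fun r : Fin (-l).toNat =>
      Term.sum fun b => cap i r b⨟rcup i r ((φ i).dual (B i) b)) := cls_sound (.of (.down_up i))
  simpa only [two_eq, cls_sum, cls_comp] using h

end ColHeis

/-! ### Sums of colored morphisms satisfy the uncolored relations -/

namespace ColHeis

open Presented

variable {k : Type u} [CommRing k] {n : ℕ} {F : Fin n → Type v} [∀ i, Ring (F i)]
  [∀ i, Algebra k (F i)] {ι : Fin n → Type w} [∀ i, Fintype (ι i)]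
  {φ : ∀ i, FrobeniusTrace k (F i)} {B : ∀ i, Module.Basis (ι i) k (F i)} {l : ℤ}

/-- The sums over all colors of the colored morphisms, indexed by the generators of the
Frobenius Heisenberg category of a direct sum. -/
noncomputable def ofGen {X Y : List Sgn} :
    Heis.Gen (∀ j, F j) (Σ j, ι j) l X Y → Term k (Gen F ι l) X Y
  | .x => .sum x
  | .s => .sum fun i => .sum fun j => s i j
  | .c => .sum c
  | .d => .sum d
  | .tok f => .sum fun i => tok i (f i)
  | .tl => .sum fun i => .sum fun j => tl i j
  | .cup r b => cup b.1 r b.2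
  | .cap r b => cap b.1 r b.2

local notation "⟪" t "⟫" => cls (R := R φ B l) t
local notation "⟪" t "⟫⁺" => cls (R := R φ B l) (Term.lift ofGen t)

theorem cls_lift_x : ⟪Heis.x⟫⁺ = ∑ i, ⟪x i⟫ := cls_sum _
theorem cls_lift_s : ⟪Heis.s⟫⁺ = ∑ i, ∑ j, ⟪s i j⟫ :=
  (cls_sum _).trans (Finset.sum_congr rfl fun _ _ => cls_sum _)
theorem cls_lift_c : ⟪Heis.c⟫⁺ = ∑ i, ⟪c i⟫ := cls_sum _
theorem cls_lift_d : ⟪Heis.d⟫⁺ = ∑ i, ⟪d i⟫ := cls_sum _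
theorem cls_lift_tok (f : ∀ j, F j) : ⟪Heis.tok f⟫⁺ = ∑ i, ⟪tok i (f i)⟫ := cls_sum _
theorem cls_lift_tl : ⟪Heis.tl⟫⁺ = ∑ i, ∑ j, ⟪tl i j⟫ :=
  (cls_sum _).trans (Finset.sum_congr rfl fun _ _ => cls_sum _)

/-- Here and below, colored strands at suitable ends of a substituted generator recover its colored
component. For two-strand generators one end fixes the color of one strand, which explains the
remaining sums in `fst_E_lift_s` and its variants. -/
theorem E_lift_x (i : Fin n) : ⟪E i⟫≫ᵥ⟪Heis.x⟫⁺ = ⟪x i⟫ := by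
  rw [cls_lift_x, vcomp_sum_eq _ E_E_ne _ E_x]
theorem E_lift_tok (i : Fin n) (f : ∀ j, F j) : ⟪E i⟫≫ᵥ⟪Heis.tok f⟫⁺ = ⟪tok i (f i)⟫ := by
  rw [cls_lift_tok, vcomp_sum_eq _ E_E_ne _ fun i => E_tok i (f i)]
theorem lift_tok_single (i : Fin n) (f : F i) : ⟪Heis.tok (Pi.single i f)⟫⁺ = ⟪tok i f⟫ := by
  rw [cls_lift_tok, Finset.sum_eq_single i, Pi.single_eq_same]
  · intro j _ hj
    rw [Pi.single_eq_of_ne hj, cls_tok_zero]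
  · simp

theorem lift_c_fst_D (i : Fin n) : ⟪Heis.c⟫⁺≫ᵥfst up ⟪D i⟫ = ⟪c i⟫ := by
  rw [cls_lift_c, sum_vcomp_eq _ (fst_D_D_ne up) _ c_fst_D]
theorem lift_c_snd_E (i : Fin n) : ⟪Heis.c⟫⁺≫ᵥsnd down ⟪E i⟫ = ⟪c i⟫ := by
  rw [cls_lift_c, sum_vcomp_eq _ (snd_E_E_ne down) _ c_snd_E]
theorem fst_E_lift_d (i : Fin n) : fst down ⟪E i⟫≫ᵥ⟪Heis.d⟫⁺ = ⟪d i⟫ := by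
  rw [cls_lift_d, vcomp_sum_eq _ (fst_E_E_ne down) _ fst_E_d]
theorem snd_D_lift_d (i : Fin n) : snd up ⟪D i⟫≫ᵥ⟪Heis.d⟫⁺ = ⟪d i⟫ := by
  rw [cls_lift_d, vcomp_sum_eq _ (snd_D_D_ne up) _ snd_D_d]

theorem fst_E_lift_s (i : Fin n) : fst up ⟪E i⟫≫ᵥ⟪Heis.s⟫⁺ = ∑ j, ⟪s i j⟫ := by
  rw [cls_lift_s, vcomp_sum_eq _ (fst_E_E_ne up)]
  intro i; simp only [vcomp_sum, fst_E_s]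
theorem lift_s_snd_E (i : Fin n) : ⟪Heis.s⟫⁺≫ᵥsnd up ⟪E i⟫ = ∑ j, ⟪s i j⟫ := by
  rw [cls_lift_s, sum_vcomp_eq _ (snd_E_E_ne up)]
  intro i; simp only [sum_vcomp, s_snd_E]
theorem snd_E_lift_s (j : Fin n) : snd up ⟪E j⟫≫ᵥ⟪Heis.s⟫⁺ = ∑ i, ⟪s i j⟫ := by
  rw [cls_lift_s, Finset.sum_comm, vcomp_sum_eq _ (snd_E_E_ne up)]
  intro i; simp only [vcomp_sum, snd_E_s]
theorem lift_s_fst_E (j : Fin n) : ⟪Heis.s⟫⁺≫ᵥfst up ⟪E j⟫ = ∑ i, ⟪s i j⟫ := by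
  rw [cls_lift_s, Finset.sum_comm, sum_vcomp_eq _ (fst_E_E_ne up)]
  intro i; simp only [sum_vcomp, s_fst_E]
theorem fst_E_snd_E_lift_s (i j : Fin n) :
    fst up ⟪E i⟫≫ᵥsnd up ⟪E j⟫≫ᵥ⟪Heis.s⟫⁺ = ⟪s i j⟫ := by
  rw [snd_E_lift_s, vcomp_sum_eq _ (fst_E_E_ne up) _ fun i => fst_E_s i j]

theorem fst_D_snd_E_lift_tl (i j : Fin n) :
    fst up ⟪D i⟫≫ᵥsnd down ⟪E j⟫≫ᵥ⟪Heis.tl⟫⁺ = ⟪tl i j⟫ := by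
  rw [cls_lift_tl, Finset.sum_comm, vcomp_sum_eq _ (snd_E_E_ne down),
    vcomp_sum_eq _ (fst_D_D_ne up) _ fun i => fst_D_tl i j]
  intro i; simp only [vcomp_sum, snd_E_tl]
theorem lift_tl_fst_E_snd_D (i j : Fin n) :
    ⟪Heis.tl⟫⁺≫ᵥfst down ⟪E j⟫≫ᵥsnd up ⟪D i⟫ = ⟪tl i j⟫ := by
  rw [← vcomp_assoc, cls_lift_tl, Finset.sum_comm, sum_vcomp_eq _ (fst_E_E_ne down),
    sum_vcomp_eq _ (snd_D_D_ne up) _ fun i => tl_snd_D i j]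
  intro i; simp only [sum_vcomp, tl_fst_E]
theorem snd_E_lift_tl_snd_D (i j : Fin n) :
    snd down ⟪E j⟫≫ᵥ⟪Heis.tl⟫⁺≫ᵥsnd up ⟪D i⟫ = ⟪tl i j⟫ := by
  rw [cls_lift_tl, sum_vcomp_eq _ (snd_D_D_ne up), vcomp_sum_eq _ (snd_E_E_ne down) _ (snd_E_tl i)]
  intro i; simp only [sum_vcomp, tl_snd_D]

theorem lift_tokDown_e (i : Fin n) : ⟪Heis.tokDown (Heis.e i)⟫⁺ = ⟪D i⟫ := by
  have h : ⟪Heis.tokDown (Heis.e i)⟫⁺ = mate ⟪Heis.c⟫⁺ ⟪Heis.tok (Heis.e i)⟫⁺ ⟪Heis.d⟫⁺ :=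
    hcomp_mate ⟪Heis.c⟫⁺ ⟪Heis.d⟫⁺ ⟪Heis.tok (Heis.e i)⟫⁺
  -- Three copies of the idempotent: one selects the color of the cup, one that of the cap, and one
  -- stays as the token.
  have h' : ⟪Heis.tok (Heis.e i)⟫⁺ = ⟪E i⟫≫ᵥ⟪E i⟫≫ᵥ⟪E i⟫ := by
    rw [Heis.e, lift_tok_single, E_E, E_E]; rfl
  rw [h, h', ← mate_cup_snd, ← mate_fst_cap, lift_c_snd_E, fst_E_lift_d, cls_D]

/-- The two lower ends determine all colors. `D j` selects `d j`; the color `j` of its left leg,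
together with `E i`, selects `s j i`; and the first input of that crossing selects `c j`. -/
theorem fst_E_snd_D_lift_t (i j : Fin n) :
    fst down ⟪E i⟫≫ᵥsnd up ⟪D j⟫≫ᵥ⟪Heis.t⟫⁺ = ⟪t i j⟫ := by
  have h : ⟪Heis.t⟫⁺ = rotate ⟪Heis.c⟫⁺ ⟪Heis.s⟫⁺ ⟪Heis.d⟫⁺ :=
    hcomp_rotate ⟪Heis.c⟫⁺ ⟪Heis.s⟫⁺ ⟪Heis.d⟫⁺
  rw [h, snd_rotate, snd_D_lift_d, ← fst_E_d, fst_rotate, rotate_fst_cap, vcomp_assoc,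
    lift_s_snd_E, vcomp_sum_eq _ (snd_E_E_ne up) _ (snd_E_s j), ← fst_E_s, ← rotate_cup_snd,
    lift_c_snd_E, cls_t]

theorem cls_lift_t : ⟪Heis.t⟫⁺ = ∑ i, ∑ j, ⟪t i j⟫ := by
  refine eq_of_fst_E_snd_D fun i j => ?_
  rw [fst_E_snd_D_lift_t, Finset.sum_comm, vcomp_sum_eq _ (snd_D_D_ne up),
    vcomp_sum_eq _ (fst_E_E_ne down) _ fun i => fst_E_t i j]
  intro j; simp only [vcomp_sum, snd_D_t]

theorem lift_t_fst_D_snd_E (i j : Fin n) :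
    ⟪Heis.t⟫⁺≫ᵥfst up ⟪D j⟫≫ᵥsnd down ⟪E i⟫ = ⟪t i j⟫ := by
  rw [cls_lift_t, ← vcomp_assoc, Finset.sum_comm, sum_vcomp_eq _ (fst_D_D_ne up),
    sum_vcomp_eq _ (snd_E_E_ne down) _ fun i => t_snd_E i j]
  intro j; simp only [sum_vcomp, t_fst_D]

/-- The color of the token travels through each power of the dot and selects the `i`th summand of
the next one. -/
theorem tok_pow_lift_x (i : Fin n) (r : ℕ) (f : F i) :
    ⟪tok i f⟫≫ᵥ⟪Heis.x.pow r⟫⁺ = ⟪tok i f⟫≫ᵥ⟪(x i).pow r⟫ := by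
  induction r with
  | zero => rfl
  | succ r ih =>
    change ⟪tok i f⟫≫ᵥ⟪Heis.x.pow r⟫⁺≫ᵥ⟪Heis.x⟫⁺ = ⟪tok i f⟫≫ᵥ⟪(x i).pow r⟫≫ᵥ⟪x i⟫
    rw [← vcomp_assoc, ih, ← tok_E, vcomp_assoc, vcomp_assoc, vcomp_eq_assoc (pow_x_comm i r),
      E_lift_x, vcomp_assoc]
    rw [vcomp_eq_assoc (pow_x_comm i r), E_x]

theorem lift_rcap_single (i : Fin n) (r : ℕ) (f : F i) :
    ⟪Heis.rcap r (Pi.single i f)⟫⁺ = ⟪rcap i r f⟫ := by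
  have h : ⟪Heis.rcap r (Pi.single i f)⟫⁺ =
    two (⟪Heis.tok (Pi.single i f)⟫⁺≫ᵥ⟪Heis.x.pow r⟫⁺) (one [down])≫ᵥ⟪Heis.d⟫⁺ := rfl
  rw [h, two_eq, snd_one, vcomp_one, lift_tok_single, tok_pow_lift_x, cls_rcap, ← tok_E,
    vcomp_assoc, pow_x_comm, ← vcomp_assoc, fst_vcomp, vcomp_assoc, fst_E_lift_d, vcomp_assoc,
    fst_E_d]

theorem lift_rcup_single (i : Fin n) (r : ℕ) (f : F i) :
    ⟪Heis.rcup r (Pi.single i f)⟫⁺ = ⟪rcup i r f⟫ := by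
  have h : ⟪Heis.rcup r (Pi.single i f)⟫⁺ =
    ⟪Heis.c⟫⁺≫ᵥtwo (one [down]) (⟪Heis.tok (Pi.single i f)⟫⁺≫ᵥ⟪Heis.x.pow r⟫⁺) := rfl
  rw [h, two_eq, fst_one, one_vcomp, lift_tok_single, tok_pow_lift_x, cls_rcup, ← E_tok,
    vcomp_assoc, snd_vcomp, ← vcomp_assoc, lift_c_snd_E, ← vcomp_assoc, c_snd_E]

theorem tl_rcap (i : Fin n) (r : Fin l.toNat) (b : ι i) :
    ⟪tl i i⟫≫ᵥ⟪rcap i r ((φ i).dual (B i) b)⟫ = 0 := cls_sound (.of (.tl_rcap i r b))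
theorem rcup_tl (i : Fin n) (r : Fin (-l).toNat) (b : ι i) :
    ⟪rcup i r ((φ i).dual (B i) b)⟫≫ᵥ⟪tl i i⟫ = 0 := cls_sound (.of (.rcup_tl i r b))
theorem cup_t (i : Fin n) (r : Fin l.toNat) (b : ι i) : ⟪cup i r b⟫≫ᵥ⟪t i i⟫ = 0 :=
  cls_sound (.of (.cup_t i r b))
theorem t_cap (i : Fin n) (r : Fin (-l).toNat) (b : ι i) : ⟪t i i⟫≫ᵥ⟪cap i r b⟫ = 0 :=
  cls_sound (.of (.t_cap i r b))

/-- Grouped by color, each partial sum absorbs its own color on both strands. The pair `i`, `j`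
therefore selects one partial sum if `i = j` and nothing otherwise. The next two lemmas do the same
for the correction terms of the inversion relations. -/
theorem sum_fst_snd_E_dual (i j : Fin n) : fst up ⟪E i⟫≫ᵥsnd up ⟪E j⟫≫ᵥ(∑ b,
    fst up ⟪Heis.tok ((FrobeniusTrace.pi φ).dual (Pi.basis B) b)⟫⁺≫ᵥ
      snd up ⟪Heis.tok (Pi.basis B b)⟫⁺) =
    if i = j then ∑ b, fst up ⟪tok i ((φ i).dual (B i) b)⟫≫ᵥsnd up ⟪tok i (B i b)⟫ else 0 := by
  have h : ∀ m (b : ι m), snd up ⟪Heis.tok (Pi.basis B ⟨m, b⟩)⟫⁺ = snd up ⟪tok m (B m b)⟫ := by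
    intro m b; rw [Pi.basis_apply, lift_tok_single]
  simp only [Fintype.sum_sigma, FrobeniusTrace.pi_dual, lift_tok_single, h]
  have h₂ := vcomp_sum_eq _ (snd_E_E_ne (φ := φ) (B := B) (l := l) up) (fun m => ∑ b,
    fst up ⟪tok m ((φ m).dual (B m) b)⟫≫ᵥsnd up ⟪tok m (B m b)⟫) (fun m => by
      simp only [vcomp_sum, snd_fst_assoc, ← snd_vcomp, E_tok]) j
  have h₁ : ∀ i, fst up ⟪E i⟫≫ᵥ(∑ b, fst up ⟪tok i ((φ i).dual (B i) b)⟫≫ᵥ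
      snd up ⟪tok i (B i b)⟫) = ∑ b, fst up ⟪tok i ((φ i).dual (B i) b)⟫≫ᵥ
      snd up ⟪tok i (B i b)⟫ := fun i => by
    simp only [vcomp_sum, ← vcomp_assoc, ← fst_vcomp, E_tok]
  rw [h₂]
  split_ifs with hij
  · subst hij; exact h₁ i
  · rw [← h₁ j, vcomp_eq_assoc' (fst_E_E_ne up i j hij), zero_vcomp]

theorem sum_fst_E_snd_D_rcap (i j : Fin n) : fst down ⟪E i⟫≫ᵥsnd up ⟪D j⟫≫ᵥ
    (∑ r : Fin l.toNat, ∑ b, ⟪Heis.rcap r ((FrobeniusTrace.pi φ).dual (Pi.basis B) b)⟫⁺≫ᵥ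
      ⟪Heis.cup r b⟫⁺) =
    if i = j then ∑ r : Fin l.toNat, ∑ b, ⟪rcap i r ((φ i).dual (B i) b)⟫≫ᵥ⟪cup i r b⟫
    else 0 := by
  have h : ∀ (r : Fin l.toNat) m (b : ι m), ⟪Heis.cup r ⟨m, b⟩⟫⁺ = ⟪cup m r b⟫ :=
    fun _ _ _ => rfl
  simp only [Fintype.sum_sigma, FrobeniusTrace.pi_dual, lift_rcap_single, h]
  -- The color becomes the outer summation index, as `vcomp_sum_eq` requires.
  rw [Finset.sum_comm]
  have h₂ := vcomp_sum_eq _ (snd_D_D_ne (φ := φ) (B := B) (l := l) up) (fun m =>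
    ∑ r : Fin l.toNat, ∑ b, ⟪rcap m r ((φ m).dual (B m) b)⟫≫ᵥ⟪cup m r b⟫) (fun m => by
      simp only [vcomp_sum, ← vcomp_assoc, snd_D_rcap]) j
  have h₁ : ∀ i, fst down ⟪E i⟫≫ᵥ
      (∑ r : Fin l.toNat, ∑ b, ⟪rcap i r ((φ i).dual (B i) b)⟫≫ᵥ⟪cup i r b⟫) =
      ∑ r : Fin l.toNat, ∑ b, ⟪rcap i r ((φ i).dual (B i) b)⟫≫ᵥ⟪cup i r b⟫ := fun i => by
    simp only [vcomp_sum, ← vcomp_assoc, fst_E_rcap]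
  rw [h₂]
  split_ifs with hij
  · subst hij; exact h₁ i
  · rw [← h₁ j, vcomp_eq_assoc' (fst_E_E_ne down i j hij), zero_vcomp]

theorem sum_fst_D_snd_E_cap (i j : Fin n) : fst up ⟪D i⟫≫ᵥsnd down ⟪E j⟫≫ᵥ
    (∑ r : Fin (-l).toNat, ∑ b, ⟪Heis.cap r b⟫⁺≫ᵥ
      ⟪Heis.rcup r ((FrobeniusTrace.pi φ).dual (Pi.basis B) b)⟫⁺) =
    if i = j then ∑ r : Fin (-l).toNat, ∑ b, ⟪cap i r b⟫≫ᵥ⟪rcup i r ((φ i).dual (B i) b)⟫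
    else 0 := by
  have h : ∀ (r : Fin (-l).toNat) m (b : ι m), ⟪Heis.cap r ⟨m, b⟩⟫⁺ = ⟪cap m r b⟫ :=
    fun _ _ _ => rfl
  simp only [Fintype.sum_sigma, FrobeniusTrace.pi_dual, lift_rcup_single, h]
  rw [Finset.sum_comm]
  have h₂ := vcomp_sum_eq _ (snd_E_E_ne (φ := φ) (B := B) (l := l) down) (fun m =>
    ∑ r : Fin (-l).toNat, ∑ b, ⟪cap m r b⟫≫ᵥ⟪rcup m r ((φ m).dual (B m) b)⟫) (fun m => by
      simp only [vcomp_sum, ← vcomp_assoc, snd_E_cap]) j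
  have h₁ : ∀ i, fst up ⟪D i⟫≫ᵥ
      (∑ r : Fin (-l).toNat, ∑ b, ⟪cap i r b⟫≫ᵥ⟪rcup i r ((φ i).dual (B i) b)⟫) =
      ∑ r : Fin (-l).toNat, ∑ b, ⟪cap i r b⟫≫ᵥ⟪rcup i r ((φ i).dual (B i) b)⟫ := fun i => by
    simp only [vcomp_sum, ← vcomp_assoc, fst_D_cap]
  rw [h₂]
  split_ifs with hij
  · subst hij; exact h₁ i
  · rw [← h₁ j, vcomp_eq_assoc' (fst_D_D_ne up i j hij), zero_vcomp]

/-- Not part of the colored presentation, which treats one color at a time, but required by the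
plain inversion relation: the meeting legs have orthogonal colors. -/
theorem cup_rcap_color_ne (i j : Fin n) (h : i ≠ j) (r : Fin l.toNat) (r' : ℕ) (b : ι i) (f : F j) :
    ⟪cup i r b⟫≫ᵥ⟪rcap j r' f⟫ = 0 := by
  rw [← cup_fst_E, ← fst_E_rcap, vcomp_assoc, vcomp_eq_assoc' (fst_E_E_ne down i j h), zero_vcomp,
    vcomp_zero]
theorem rcup_cap_color_ne (i j : Fin n) (h : i ≠ j) (r' : ℕ) (r : Fin (-l).toNat) (f : F i)
    (b : ι j) : ⟪rcup i r' f⟫≫ᵥ⟪cap j r b⟫ = 0 := by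
  rw [← rcup_snd_E, ← snd_E_cap, vcomp_assoc, vcomp_eq_assoc' (snd_E_E_ne down i j h), zero_vcomp,
    vcomp_zero]

/-- Inserting all triples of colors at the bottom reduces the claim to `colored_braid`, with
`colored_braid_left` and `colored_braid_right` read from right to left. -/
theorem lift_braid : lft ⟪Heis.s⟫⁺≫ᵥrgt ⟪Heis.s⟫⁺≫ᵥlft ⟪Heis.s⟫⁺ =
    rgt ⟪Heis.s⟫⁺≫ᵥlft ⟪Heis.s⟫⁺≫ᵥrgt ⟪Heis.s⟫⁺ := by
  have h₁ : ∑ i, strand₁ ⟪E i⟫ = one _ := by rw [← strand₁_sum, sum_E, strand₁_one]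
  have h₂ : ∑ i, strand₂ ⟪E i⟫ = one _ := by rw [← strand₂_sum, sum_E, strand₂_one]
  have h₃ : ∑ i, strand₃ ⟪E i⟫ = one _ := by rw [← strand₃_sum, sum_E, strand₃_one]
  refine eq_of_sum_eq_one _ h₃ fun m => eq_of_sum_eq_one _ h₂ fun j =>
    eq_of_sum_eq_one _ h₁ fun i => ?_
  have hf : ∀ i, fst up ⟪E i⟫≫ᵥ⟪Heis.s⟫⁺ = ⟪Heis.s⟫⁺≫ᵥsnd up ⟪E i⟫ := fun i => by
    rw [fst_E_lift_s, lift_s_snd_E]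
  have hs : ∀ i, snd up ⟪E i⟫≫ᵥ⟪Heis.s⟫⁺ = ⟪Heis.s⟫⁺≫ᵥfst up ⟪E i⟫ := fun i => by
    rw [snd_E_lift_s, lift_s_fst_E]
  rw [← colored_braid_left (e := fun i => ⟪E i⟫) E_E hf hs,
    ← colored_braid_right (e := fun i => ⟪E i⟫) E_E hf hs]
  simp only [fst_E_snd_E_lift_s]
  exact colored_braid i j m

theorem cls_lift_ofGen {X Y : List Sgn}
    {f g : Term k (Heis.Gen (∀ j, F j) (Σ j, ι j) l) X Y}
    (h : Heis.R (FrobeniusTrace.pi φ) (Pi.basis B) l X Y f g) : ⟪f⟫⁺ = ⟪g⟫⁺ := by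
  cases h with
  | tok_one =>
    rw [cls_lift_tok]
    exact sum_E
  | tok_mul f g =>
    change ⟪Heis.tok (f * g)⟫⁺ = ⟪Heis.tok g⟫⁺≫ᵥ⟪Heis.tok f⟫⁺
    refine eq_of_sum_eq_one _ sum_E fun i => ?_
    rw [E_lift_tok, ← vcomp_assoc, E_lift_tok, ← tok_E i (g i), vcomp_assoc, E_lift_tok, ← cls_tok_mul,
      Pi.mul_apply]
  | tok_add f g =>
    change ⟪Heis.tok (f + g)⟫⁺ = ⟪Heis.tok f⟫⁺ + ⟪Heis.tok g⟫⁺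
    simp only [cls_lift_tok, Pi.add_apply, cls_tok_add, Finset.sum_add_distrib]
  | tok_smul a f =>
    change ⟪Heis.tok (a • f)⟫⁺ = a • ⟪Heis.tok f⟫⁺
    simp only [cls_lift_tok, Pi.smul_apply, cls_tok_smul, Finset.smul_sum]
  | braid =>
    change (hcomp ⟪Heis.s⟫⁺ (one [up]) rfl rfl : Mor (R φ B l) [up, up, up] [up, up, up])≫ᵥ
      (hcomp (one [up]) ⟪Heis.s⟫⁺ rfl rfl : Mor (R φ B l) [up, up, up] [up, up, up])≫ᵥ
      (hcomp ⟪Heis.s⟫⁺ (one [up]) rfl rfl : Mor (R φ B l) [up, up, up] [up, up, up]) =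
      (hcomp (one [up]) ⟪Heis.s⟫⁺ rfl rfl : Mor (R φ B l) [up, up, up] [up, up, up])≫ᵥ
      (hcomp ⟪Heis.s⟫⁺ (one [up]) rfl rfl : Mor (R φ B l) [up, up, up] [up, up, up])≫ᵥ
      (hcomp (one [up]) ⟪Heis.s⟫⁺ rfl rfl : Mor (R φ B l) [up, up, up] [up, up, up])
    simpa only [hcomp_lft, hcomp_rgt, strand₁_one, strand₃_one, one_vcomp, vcomp_one]
      using lift_braid
  | s_s =>
    change ⟪Heis.s⟫⁺≫ᵥ⟪Heis.s⟫⁺ = two (one [up]) (one [up])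
    refine eq_of_fst_E_snd_E fun i j => ?_
    -- The bottom colors turn the first crossing into `s i j`; its top colors are then split off to
    -- select `s j i` from the second one.
    rw [← vcomp_assoc, ← vcomp_assoc, vcomp_assoc (fst up ⟪E i⟫), fst_E_snd_E_lift_s, ← s_snd_E,
      ← s_fst_E, vcomp_assoc, vcomp_assoc, fst_E_snd_E_lift_s, s_s, two_eq, fst_one, snd_one,
      vcomp_one, vcomp_one]
  | x_tok f =>
    change ⟪Heis.x⟫⁺≫ᵥ⟪Heis.tok f⟫⁺ = ⟪Heis.tok f⟫⁺≫ᵥ⟪Heis.x⟫⁺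
    refine eq_of_sum_eq_one _ sum_E fun i => ?_
    rw [vcomp_eq_assoc' (E_lift_x i), vcomp_eq_assoc' (E_lift_tok i f), ← tok_E, ← x_E,
      vcomp_assoc, vcomp_assoc, E_lift_tok, E_lift_x, x_tok]
  | tok_s f =>
    change two ⟪Heis.tok f⟫⁺ (one [up])≫ᵥ⟪Heis.s⟫⁺ = ⟪Heis.s⟫⁺≫ᵥtwo (one [up]) ⟪Heis.tok f⟫⁺
    refine eq_of_fst_E_snd_E fun i j => ?_
    have h : ⟪E i⟫≫ᵥ⟪Heis.tok f⟫⁺ = ⟪tok i (f i)⟫≫ᵥ⟪E i⟫ := by rw [E_lift_tok, tok_E]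
    rw [two_eq, two_eq, snd_one, vcomp_one, fst_one, one_vcomp, snd_fst_assoc, ← vcomp_assoc,
      ← fst_vcomp, h, fst_vcomp, vcomp_assoc, fst_E_snd_E_lift_s, fst_tok_s, ← vcomp_assoc (snd _ _),
      ← vcomp_assoc, fst_E_snd_E_lift_s, ← s_snd_E, vcomp_assoc, vcomp_assoc, ← snd_vcomp,
      ← snd_vcomp, E_tok, E_lift_tok]
  | x_s =>
    change ⟪Heis.s⟫⁺≫ᵥtwo ⟪Heis.x⟫⁺ (one [up]) = two (one [up]) ⟪Heis.x⟫⁺≫ᵥ⟪Heis.s⟫⁺ +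
      (⟪Term.sum fun b => Heis.tok ((FrobeniusTrace.pi φ).dual (Pi.basis B) b)⊠
        Heis.tok (Pi.basis B b)⟫⁺ : Mor _ [up, up] [up, up])
    have hsum : (⟪Term.sum fun b => Heis.tok ((FrobeniusTrace.pi φ).dual (Pi.basis B) b)⊠
        Heis.tok (Pi.basis B b)⟫⁺ : Mor _ [up, up] [up, up]) =
        ∑ b, fst up ⟪Heis.tok ((FrobeniusTrace.pi φ).dual (Pi.basis B) b)⟫⁺≫ᵥ
          snd up ⟪Heis.tok (Pi.basis B b)⟫⁺ := by
      rw [Term.lift_sum, cls_sum]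
      exact Finset.sum_congr rfl fun b _ => two_eq
        ⟪Heis.tok ((FrobeniusTrace.pi φ).dual (Pi.basis B) b)⟫⁺ ⟪Heis.tok (Pi.basis B b)⟫⁺
    rw [hsum, two_eq, two_eq, snd_one, vcomp_one, fst_one, one_vcomp]
    refine eq_of_fst_E_snd_E fun i j => ?_
    have hx : ⟪E j⟫≫ᵥ⟪Heis.x⟫⁺ = ⟪x j⟫≫ᵥ⟪E j⟫ := by rw [E_lift_x, x_E]
    have hl : fst up ⟪E i⟫≫ᵥsnd up ⟪E j⟫≫ᵥ⟪Heis.s⟫⁺≫ᵥfst up ⟪Heis.x⟫⁺ =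
        ⟪s i j⟫≫ᵥfst up ⟪x j⟫ := by
      rw [← vcomp_assoc (snd _ _), ← vcomp_assoc, fst_E_snd_E_lift_s, ← s_fst_E, vcomp_assoc,
        vcomp_assoc, ← fst_vcomp, ← fst_vcomp, E_lift_x, E_x]
    have hr : fst up ⟪E i⟫≫ᵥsnd up ⟪E j⟫≫ᵥsnd up ⟪Heis.x⟫⁺≫ᵥ⟪Heis.s⟫⁺ =
        snd up ⟪x j⟫≫ᵥ⟪s i j⟫ := by
      rw [← vcomp_assoc (snd _ _), ← snd_vcomp, hx, snd_vcomp, vcomp_assoc, ← snd_fst_assoc,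
        fst_E_snd_E_lift_s]
    rw [hl, vcomp_add, vcomp_add, hr, sum_fst_snd_E_dual]
    split_ifs with hij
    · subst hij; exact s_fst_x i
    · rw [add_zero, s_fst_x_ne i j hij]
  | zigzag_up =>
    have h : ⟪(Heis.idUp⊠Heis.c)⨟(Heis.d⊠Heis.idUp)⟫⁺ = zigzag ⟪Heis.c⟫⁺ ⟪Heis.d⟫⁺ :=
      hcomp_zigzag ⟪Heis.c⟫⁺ ⟪Heis.d⟫⁺
    refine h.trans ?_
    change _ = one [up]
    refine eq_of_sum_eq_one _ sum_E fun i => ?_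
    -- `E i` turns the cap into `d i`. The color of its other leg runs along the middle of the
    -- zigzag and turns the cup into `c i`.
    rw [vcomp_zigzag, fst_E_lift_d, ← snd_D_d, ← zigzag_cup_fst, lift_c_fst_D, zigzag_E, vcomp_one]
  | zigzag_down =>
    have h : ⟪(Heis.c⊠Heis.idDown)⨟(Heis.idDown⊠Heis.d)⟫⁺ =
        mate ⟪Heis.c⟫⁺ (one [up]) ⟪Heis.d⟫⁺ := hcomp_mate_one ⟪Heis.c⟫⁺ ⟪Heis.d⟫⁺
    refine h.trans ?_
    change _ = one [down]
    refine eq_of_sum_eq_one _ sum_D fun i => ?_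
    rw [vcomp_mate, snd_D_lift_d, ← fst_E_d, mate_fst_cap, one_vcomp, ← vcomp_one ⟪E i⟫,
      ← mate_cup_snd, lift_c_snd_E, mate_one_D, vcomp_one]
  | up_down =>
    change two (one [up]) (one [down]) = ⟪Heis.t⟫⁺≫ᵥ⟪Heis.tl⟫⁺ +
      ⟪Term.sum fun r : Fin l.toNat => Term.sum fun b =>
        Heis.rcap r ((FrobeniusTrace.pi φ).dual (Pi.basis B) b)⨟Heis.cup r b⟫⁺
    simp only [Term.lift_sum, cls_sum, Term.lift, cls_comp, two_eq, fst_one, snd_one, one_vcomp]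
    refine eq_of_fst_E_snd_D fun i j => ?_
    have h : fst down ⟪E i⟫≫ᵥsnd up ⟪D j⟫≫ᵥ⟪Heis.t⟫⁺≫ᵥ⟪Heis.tl⟫⁺ = ⟪t i j⟫≫ᵥ⟪tl j i⟫ := by
      rw [← vcomp_assoc (snd _ _), ← vcomp_assoc, fst_E_snd_D_lift_t, ← t_snd_E, ← t_fst_D,
        vcomp_assoc, vcomp_assoc, fst_D_snd_E_lift_tl, t_fst_D, t_snd_E]
    rw [vcomp_one, vcomp_add, vcomp_add, h, sum_fst_E_snd_D_rcap]
    split_ifs with hij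
    · subst hij; exact up_down i
    · rw [add_zero, up_down_ne i j hij]
  | down_up =>
    change two (one [down]) (one [up]) = ⟪Heis.tl⟫⁺≫ᵥ⟪Heis.t⟫⁺ +
      ⟪Term.sum fun r : Fin (-l).toNat => Term.sum fun b =>
        Heis.cap r b⨟Heis.rcup r ((FrobeniusTrace.pi φ).dual (Pi.basis B) b)⟫⁺
    simp only [Term.lift_sum, cls_sum, Term.lift, cls_comp, two_eq, fst_one, snd_one, one_vcomp]
    refine eq_of_fst_D_snd_E fun i j => ?_
    have h : fst up ⟪D i⟫≫ᵥsnd down ⟪E j⟫≫ᵥ⟪Heis.tl⟫⁺≫ᵥ⟪Heis.t⟫⁺ = ⟪tl i j⟫≫ᵥ⟪t j i⟫ := by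
      rw [← vcomp_assoc (snd _ _), ← vcomp_assoc, fst_D_snd_E_lift_tl, ← tl_snd_D, ← tl_fst_E,
        vcomp_assoc, vcomp_assoc, fst_E_snd_D_lift_t, tl_fst_E, tl_snd_D]
    rw [vcomp_one, vcomp_add, vcomp_add, h, sum_fst_D_snd_E_cap]
    split_ifs with hij
    · subst hij; exact down_up i
    · rw [add_zero, down_up_ne i j hij]
  | cup_t r b =>
    obtain ⟨i, b⟩ := b
    change ⟪cup i r b⟫≫ᵥ⟪Heis.t⟫⁺ = 0
    -- The two legs of the cup have color `i`, so only the summand `t i i` of the right crossing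
    -- meets it.
    rw [← color_cup, vcomp_assoc, vcomp_assoc, fst_E_snd_D_lift_t, cup_t]
  | tl_rcap r b =>
    obtain ⟨i, b⟩ := b
    rw [FrobeniusTrace.pi_dual]
    change ⟪Heis.tl⟫⁺≫ᵥ⟪Heis.rcap r (Pi.single i ((φ i).dual (B i) b))⟫⁺ = 0
    rw [lift_rcap_single, ← fst_E_rcap, ← snd_D_rcap, ← vcomp_assoc (fst _ _), ← vcomp_assoc,
      lift_tl_fst_E_snd_D, tl_rcap]
  | cup_rcap r b =>
    obtain ⟨i, b⟩ := b
    rw [FrobeniusTrace.pi_dual]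
    change ⟪cup i r b⟫≫ᵥ⟪Heis.rcap r (Pi.single i ((φ i).dual (B i) b))⟫⁺ = one []
    rw [lift_rcap_single]
    exact cls_sound (.of (.cup_rcap i r b))
  | cup_rcap_ne r r' b b' h =>
    obtain ⟨i, b⟩ := b
    obtain ⟨j, b'⟩ := b'
    rw [FrobeniusTrace.pi_dual]
    change ⟪cup i r b⟫≫ᵥ⟪Heis.rcap r' (Pi.single j ((φ j).dual (B j) b'))⟫⁺ = 0
    rw [lift_rcap_single]
    rcases eq_or_ne i j with rfl | hij
    · exact cls_sound (.of (.cup_rcap_ne i r r' b b' (by simpa using h)))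
    · exact cup_rcap_color_ne i j hij r r' b _
  | t_cap r b =>
    obtain ⟨i, b⟩ := b
    change ⟪Heis.t⟫⁺≫ᵥ⟪cap i r b⟫ = 0
    rw [← color_cap, ← vcomp_assoc (fst _ _), ← vcomp_assoc, lift_t_fst_D_snd_E, t_cap]
  | rcup_tl r b =>
    obtain ⟨i, b⟩ := b
    rw [FrobeniusTrace.pi_dual]
    change ⟪Heis.rcup r (Pi.single i ((φ i).dual (B i) b))⟫⁺≫ᵥ⟪Heis.tl⟫⁺ = 0
    rw [lift_rcup_single, ← rcup_snd_E, ← rcup_fst_D, vcomp_assoc, vcomp_assoc,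
      fst_D_snd_E_lift_tl, rcup_tl]
  | rcup_cap r b =>
    obtain ⟨i, b⟩ := b
    rw [FrobeniusTrace.pi_dual]
    change ⟪Heis.rcup r (Pi.single i ((φ i).dual (B i) b))⟫⁺≫ᵥ⟪cap i r b⟫ = one []
    rw [lift_rcup_single]
    exact cls_sound (.of (.rcup_cap i r b))
  | rcup_cap_ne r r' b b' h =>
    obtain ⟨i, b⟩ := b
    obtain ⟨j, b'⟩ := b'
    rw [FrobeniusTrace.pi_dual]
    change ⟪Heis.rcup r (Pi.single i ((φ i).dual (B i) b))⟫⁺≫ᵥ⟪cap j r' b'⟫ = 0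
    rw [lift_rcup_single]
    rcases eq_or_ne i j with rfl | hij
    · exact cls_sound (.of (.rcup_cap_ne i r r' b b' (by simpa using h)))
    · exact rcup_cap_color_ne i j hij r r' _ b'

end ColHeis

/-! ### The two functors are inverse to each other -/

section

open Presented

variable {k : Type u} [CommRing k] {n : ℕ} {F : Fin n → Type v} [∀ i, Ring (F i)]
  [∀ i, Algebra k (F i)] {ι : Fin n → Type w} [∀ i, Fintype (ι i)]
  {φ : ∀ i, FrobeniusTrace k (F i)} {B : ∀ i, Module.Basis (ι i) k (F i)} {l : ℤ}

/-- A colored generator becomes the sum over all colors cut down by its own colors, which leaves the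
generator itself. -/
theorem ColHeis.cls_lift_ofColGen_lift_ofGen {X Y : List Sgn} (g : ColHeis.Gen F ι l X Y) :
    cls (R := ColHeis.R φ B l) ((Heis.ofColGen g).lift (k := k) ColHeis.ofGen) = cls (.gen g) := by
  have he : ∀ i, cls (R := ColHeis.R φ B l) ((Heis.tok (Heis.e i)).lift (k := k) ColHeis.ofGen) =
      cls (ColHeis.E i) := fun i => ColHeis.lift_tok_single i 1
  cases g with
  | x i =>
    change cls (R := ColHeis.R φ B l) ((Heis.tok (Heis.e i)).lift (k := k) ColHeis.ofGen)≫ᵥ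
      cls (Heis.x.lift ColHeis.ofGen) = cls (ColHeis.x i)
    rw [he, ColHeis.E_lift_x]
  | s i j =>
    change two (cls (R := ColHeis.R φ B l) ((Heis.tok (Heis.e i)).lift (k := k) ColHeis.ofGen))
      (cls ((Heis.tok (Heis.e j)).lift ColHeis.ofGen))≫ᵥcls (Heis.s.lift ColHeis.ofGen) =
      cls (ColHeis.s i j)
    rw [he, he, two_eq, vcomp_assoc, ColHeis.fst_E_snd_E_lift_s]
  | c i =>
    change cls (R := ColHeis.R φ B l) (Heis.c.lift (k := k) ColHeis.ofGen)≫ᵥ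
      two (cls ((Heis.tokDown (Heis.e i)).lift ColHeis.ofGen)) (one [up]) = cls (ColHeis.c i)
    rw [ColHeis.lift_tokDown_e, two_eq, snd_one, vcomp_one, ColHeis.lift_c_fst_D]
  | d i =>
    change two (cls (R := ColHeis.R φ B l) ((Heis.tok (Heis.e i)).lift (k := k) ColHeis.ofGen))
      (one [down])≫ᵥcls (Heis.d.lift ColHeis.ofGen) = cls (ColHeis.d i)
    rw [he, two_eq, snd_one, vcomp_one, ColHeis.fst_E_lift_d]
  | tok i f => exact ColHeis.lift_tok_single i f
  | tl i j =>
    change two (one [down])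
      (cls (R := ColHeis.R φ B l) ((Heis.tok (Heis.e j)).lift (k := k) ColHeis.ofGen))≫ᵥ
      cls (Heis.tl.lift ColHeis.ofGen)≫ᵥ
      two (one [up]) (cls ((Heis.tokDown (Heis.e i)).lift ColHeis.ofGen)) = cls (ColHeis.tl i j)
    rw [he, ColHeis.lift_tokDown_e, two_eq, two_eq, fst_one, fst_one, one_vcomp, one_vcomp,
      ColHeis.snd_E_lift_tl_snd_D]
  | cup i r b => rfl
  | cap i r b => rfl

local notation "⟪" t "⟫" => cls (R := Heis.R (FrobeniusTrace.pi φ) (Pi.basis B) l) t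

/-- A plain generator becomes the sum of its cut-down pieces; the idempotents stand at its ends and
add up to the identity there. -/
theorem Heis.cls_lift_ofGen_lift_ofColGen {X Y : List Sgn}
    (g : Heis.Gen (∀ j, F j) (Σ j, ι j) l X Y) :
    ⟪(ColHeis.ofGen g).lift Heis.ofColGen⟫ = ⟪.gen g⟫ := by
  have hE : ∀ q, ∑ i, fst q ⟪Heis.tok (Heis.e i)⟫ = one _ := fun q => by
    rw [← fst_sum, ← Heis.cls_tok_sum, Heis.sum_e, Heis.cls_tok_one, fst_one]
  have hE' : ∀ q, ∑ i, snd q ⟪Heis.tok (Heis.e i)⟫ = one _ := fun q => by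
    rw [← snd_sum, ← Heis.cls_tok_sum, Heis.sum_e, Heis.cls_tok_one, snd_one]
  have hD : ∀ q, ∑ i, fst q ⟪Heis.tokDown (Heis.e i)⟫ = one _ := fun q => by
    rw [← fst_sum, ← Heis.tokDown_sum, Heis.sum_e, Heis.tokDown_one, fst_one]
  cases g with
  | x =>
    simp only [ColHeis.ofGen, Term.lift_sum, cls_sum]
    change ∑ i, ⟪Heis.colX i⟫ = ⟪Heis.x⟫
    simp only [Heis.cls_colX]
    rw [← sum_vcomp, ← Heis.cls_tok_sum, Heis.sum_e, Heis.cls_tok_one, one_vcomp]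
  | s =>
    simp only [ColHeis.ofGen, Term.lift_sum, cls_sum]
    change ∑ i, ∑ j, ⟪Heis.colS i j⟫ = ⟪Heis.s⟫
    simp only [Heis.cls_colS]
    simp only [← vcomp_sum, ← sum_vcomp, hE, hE', one_vcomp]
  | c =>
    simp only [ColHeis.ofGen, Term.lift_sum, cls_sum]
    change ∑ i, ⟪Heis.colC i⟫ = ⟪Heis.c⟫
    simp only [Heis.cls_colC]
    rw [← vcomp_sum, hD, vcomp_one]
  | d =>
    simp only [ColHeis.ofGen, Term.lift_sum, cls_sum]
    change ∑ i, ⟪Heis.colD i⟫ = ⟪Heis.d⟫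
    simp only [Heis.cls_colD]
    rw [← sum_vcomp, hE, one_vcomp]
  | tok f =>
    simp only [ColHeis.ofGen, Term.lift_sum, cls_sum]
    change ∑ i, ⟪Heis.tok (Pi.single i (f i))⟫ = ⟪Heis.tok f⟫
    rw [← Heis.cls_tok_sum, Finset.univ_sum_single]
  | tl =>
    simp only [ColHeis.ofGen, Term.lift_sum, cls_sum]
    change ∑ i, ∑ j, ⟪Heis.colTl i j⟫ = ⟪Heis.tl⟫
    simp only [Heis.cls_colTl]
    simp only [← vcomp_sum, ← sum_vcomp, hD, hE', one_vcomp]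
  | cup r b => rfl
  | cap r b => rfl

/-- The expansion of `Pi.single i f` involves only basis labels of color `i`, and the corresponding
cups absorb the idempotents in `colCup`. -/
theorem Heis.cls_colCup (i : Fin n) (r : Fin l.toNat) (f : F i) :
    ⟪(ColHeis.cupLin B i r f).lift Heis.ofColGen⟫ = ⟪Heis.colCup (Pi.basis B) i r f⟫ := by
  have h : ⟪Heis.cupLin (Pi.basis B) r (Pi.single i f)⟫ =
      ∑ b, (B i).repr f b • cls (Heis.cup r ⟨i, b⟩) := by
    rw [Heis.cupLin, cls_sum]
    simp only [cls_smul, Pi.basis_repr]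
    rw [Fintype.sum_sigma, Finset.sum_eq_single i]
    · simp only [Pi.single_eq_same]
    · intro j _ hj
      simp only [Pi.single_eq_of_ne hj, map_zero, Finsupp.zero_apply, zero_smul,
        Finset.sum_const_zero]
    · simp
  have h' : ⟪Heis.colCup (Pi.basis B) i r f⟫ = cls (Heis.cupLin (Pi.basis B) r (Pi.single i f))≫ᵥ
      two (cls (Heis.tok (Heis.e i))) (cls (Heis.tokDown (Heis.e i))) := rfl
  rw [h', h, two_eq, sum_vcomp, ColHeis.cupLin, Term.lift_sum, cls_sum]
  refine Finset.sum_congr rfl fun b _ => ?_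
  rw [smul_vcomp, vcomp_eq_assoc' (Heis.cup_fst_tok_e r i b), Heis.cup_snd_tokDown_e]
  rfl

theorem Heis.cls_colCap (i : Fin n) (r : Fin (-l).toNat) (f : F i) :
    ⟪(ColHeis.capLin B i r f).lift Heis.ofColGen⟫ = ⟪Heis.colCap (Pi.basis B) i r f⟫ := by
  have h : ⟪Heis.capLin (Pi.basis B) r (Pi.single i f)⟫ =
      ∑ b, (B i).repr f b • cls (Heis.cap r ⟨i, b⟩) := by
    rw [Heis.capLin, cls_sum]
    simp only [cls_smul, Pi.basis_repr]
    rw [Fintype.sum_sigma, Finset.sum_eq_single i]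
    · simp only [Pi.single_eq_same]
    · intro j _ hj
      simp only [Pi.single_eq_of_ne hj, map_zero, Finsupp.zero_apply, zero_smul,
        Finset.sum_const_zero]
    · simp
  have h' : ⟪Heis.colCap (Pi.basis B) i r f⟫ = two (cls (Heis.tokDown (Heis.e i)))
      (cls (Heis.tok (Heis.e i)))≫ᵥcls (Heis.capLin (Pi.basis B) r (Pi.single i f)) := rfl
  rw [h', h, two_eq, vcomp_sum, ColHeis.capLin, Term.lift_sum, cls_sum]
  refine Finset.sum_congr rfl fun b _ => ?_
  rw [vcomp_smul, vcomp_assoc, Heis.snd_tok_e_cap, Heis.fst_tokDown_e_cap]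
  rfl

/-- The coordinates of `f` in the union basis are those of its components, so the sum over labels
splits by color. -/
theorem ColHeis.cls_lift_cupLin (r : Fin l.toNat) (f : ∀ i, F i) :
    cls (R := ColHeis.R φ B l) ((Heis.cupLin (Pi.basis B) r f).lift ColHeis.ofGen) =
    ∑ i, cls (ColHeis.cupLin B i r (f i)) := by
  rw [Heis.cupLin, Term.lift_sum, cls_sum, Fintype.sum_sigma]
  refine Finset.sum_congr rfl fun i _ => ?_
  rw [ColHeis.cupLin, cls_sum]
  refine Finset.sum_congr rfl fun b _ => ?_
  rw [Pi.basis_repr]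
  rfl

theorem ColHeis.cls_lift_capLin (r : Fin (-l).toNat) (f : ∀ i, F i) :
    cls (R := ColHeis.R φ B l) ((Heis.capLin (Pi.basis B) r f).lift ColHeis.ofGen) =
    ∑ i, cls (ColHeis.capLin B i r (f i)) := by
  rw [Heis.capLin, Term.lift_sum, cls_sum, Fintype.sum_sigma]
  refine Finset.sum_congr rfl fun i _ => ?_
  rw [ColHeis.capLin, cls_sum]
  refine Finset.sum_congr rfl fun b _ => ?_
  rw [Pi.basis_repr]
  rfl

end

open Presented in
theorem mainTheorem2 {k : Type u} [CommRing k] {n : ℕ} {F : Fin n → Type v} [∀ i, Ring (F i)]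
    [∀ i, Algebra k (F i)] {ι : Fin n → Type w} [∀ i, Fintype (ι i)]
    (φ : ∀ i, FrobeniusTrace k (F i)) (B : ∀ i, Module.Basis (ι i) k (F i)) (l : ℤ) :
    ∃ (Φ : ColHeis φ B l ⥤ Heis (FrobeniusTrace.pi φ) (Pi.basis B) l)
      (Ψ : Heis (FrobeniusTrace.pi φ) (Pi.basis B) l ⥤ ColHeis φ B l),
      -- strict `k`-linear monoidal functors
      (Φ.Additive ∧ Φ.Linear k ∧ IsStrictMonoidal Φ) ∧
      (Ψ.Additive ∧ Ψ.Linear k ∧ IsStrictMonoidal Ψ) ∧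
      -- inverse to each other
      Φ ⋙ Ψ = 𝟭 (ColHeis φ B l) ∧ Ψ ⋙ Φ = 𝟭 (Heis (FrobeniusTrace.pi φ) (Pi.basis B) l) ∧
      -- values of `Φ`
      (∀ X : List Sgn, Φ.obj (ob X) = ob X) ∧
      (∀ i j, SendsTo Φ (mk (ColHeis.s i j)) (mk (Heis.colS i j))) ∧
      (∀ i, SendsTo Φ (mk (ColHeis.c i)) (mk (Heis.colC i))) ∧
      (∀ i, SendsTo Φ (mk (ColHeis.d i)) (mk (Heis.colD i))) ∧
      (∀ i, SendsTo Φ (mk (ColHeis.x i)) (mk (Heis.colX i))) ∧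
      (∀ i (f : F i), SendsTo Φ (mk (ColHeis.tok i f)) (mk (Heis.tok (Pi.single i f)))) ∧
      (∀ i j, SendsTo Φ (mk (ColHeis.t i j)) (mk (Heis.colT i j))) ∧
      (∀ i j, SendsTo Φ (mk (ColHeis.tl i j)) (mk (Heis.colTl i j))) ∧
      (∀ i r (f : F i), SendsTo Φ (mk (ColHeis.cupLin B i r f))
        (mk (Heis.colCup (Pi.basis B) i r f))) ∧
      (∀ i r (f : F i), SendsTo Φ (mk (ColHeis.capLin B i r f))
        (mk (Heis.colCap (Pi.basis B) i r f))) ∧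
      -- values of `Ψ`
      (∀ X : List Sgn, Ψ.obj (ob X) = ob X) ∧
      SendsTo Ψ (mk Heis.s) (∑ i, ∑ j, mk (ColHeis.s i j)) ∧
      SendsTo Ψ (mk Heis.c) (∑ i, mk (ColHeis.c i)) ∧
      SendsTo Ψ (mk Heis.d) (∑ i, mk (ColHeis.d i)) ∧
      SendsTo Ψ (mk Heis.x) (∑ i, mk (ColHeis.x i)) ∧
      (∀ f : ∀ i, F i, SendsTo Ψ (mk (Heis.tok f)) (∑ i, mk (ColHeis.tok i (f i)))) ∧
      SendsTo Ψ (mk Heis.t) (∑ i, ∑ j, mk (ColHeis.t i j)) ∧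
      SendsTo Ψ (mk Heis.tl) (∑ i, ∑ j, mk (ColHeis.tl i j)) ∧
      (∀ r (f : ∀ i, F i), SendsTo Ψ (mk (Heis.cupLin (Pi.basis B) r f))
        (∑ i, mk (ColHeis.cupLin B i r (f i)))) ∧
      (∀ r (f : ∀ i, F i), SendsTo Ψ (mk (Heis.capLin (Pi.basis B) r f))
        (∑ i, mk (ColHeis.capLin B i r (f i)))) := by
  refine ⟨liftFunctor Heis.ofColGen Heis.cls_lift_ofColGen,
    liftFunctor ColHeis.ofGen ColHeis.cls_lift_ofGen,
    ⟨liftFunctor_additive _ _, liftFunctor_linear _ _, liftFunctor_isStrictMonoidal _ _⟩,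
    ⟨liftFunctor_additive _ _, liftFunctor_linear _ _, liftFunctor_isStrictMonoidal _ _⟩,
    liftFunctor_comp_liftFunctor _ _ _ _ ColHeis.cls_lift_ofColGen_lift_ofGen,
    liftFunctor_comp_liftFunctor _ _ _ _ Heis.cls_lift_ofGen_lift_ofColGen,
    fun _ => rfl,
    -- On these morphisms substitution yields the prescribed expression on the nose, including `t i
    -- j`, where it acts on the three factors of the formula.
    fun i j => liftFunctor_sendsTo _ _ rfl, fun i => liftFunctor_sendsTo _ _ rfl,
    fun i => liftFunctor_sendsTo _ _ rfl, fun i => liftFunctor_sendsTo _ _ rfl,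
    fun i f => liftFunctor_sendsTo _ _ rfl, fun i j => liftFunctor_sendsTo _ _ rfl,
    fun i j => liftFunctor_sendsTo _ _ rfl,
    fun i r f => liftFunctor_sendsTo _ _ (Heis.cls_colCup i r f),
    fun i r f => liftFunctor_sendsTo _ _ (Heis.cls_colCap i r f),
    fun _ => rfl,
    liftFunctor_sendsTo _ _ ColHeis.cls_lift_s, liftFunctor_sendsTo _ _ ColHeis.cls_lift_c,
    liftFunctor_sendsTo _ _ ColHeis.cls_lift_d, liftFunctor_sendsTo _ _ ColHeis.cls_lift_x,
    fun f => liftFunctor_sendsTo _ _ (ColHeis.cls_lift_tok f),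
    liftFunctor_sendsTo _ _ ColHeis.cls_lift_t, liftFunctor_sendsTo _ _ ColHeis.cls_lift_tl,
    fun r f => liftFunctor_sendsTo _ _ (ColHeis.cls_lift_cupLin r f),
    fun r f => liftFunctor_sendsTo _ _ (ColHeis.cls_lift_capLin r f)⟩
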